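/- **Definitions.** A graded polarizable mixed Hodge structure of level $\le 1$ is a finitely generated abelian group $H_{\mathbb Z}$ with a weight filtration $0\subseteq W_{-2}\subseteq W_{-1}\subseteq W_0=H_{\mathbb Q}$ and a subspace $F^0\subseteq H_{\mathbb C}$ ($F^{-1}=H_{\mathbb C}$, $F^1=0$) such that $\mathrm{gr}^W_{-2}$, $\mathrm{gr}^W_{-1}$, $\mathrm{gr}^W_0$ are Hodge structures of types $\{(-1,-1)\}$, $\{(-1,0),(0,-1)\}$, $\{(0,0)\}$ respectively, with $\mathrm{gr}^W_{-1}$ polarizable. They form the category $\mathrm{MHS}_1$, morphisms being the group homomorphisms that respect the filtrations. A formal group here is a commutative formal group $H=H^0\times H_{\mathbb Z}$ over $\mathbb C$ with finitely generated étale part $H_{\mathbb Z}=H(\mathbb C)$ and connected part $H^0\cong\hat{\mathbb C}^s$ for some $s\ge 0$ (as a group; $\hat{\mathbb C}$ is the formal additive group). The category $\mathrm{FHS}_1$ of formal Hodge structures of level $\le 1$ has as objects $(H,V)$ the following data: a formal group $H$; a structure $H_{\text{ét}}\in\mathrm{MHS}_1$ on $H_{\mathbb Z}$; a finite-dimensional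 $\mathbb C$-vector space $V$ with subspaces $V^0\subseteq V^1\subseteq V$; a group homomorphism $v:H\to V$; and a $\mathbb C$-linear isomorphism $\sigma:H_{\mathbb C}/F^0\to V/V^0$ that restricts to $W_{-2}H_{\mathbb C}\cong V^1/V^0$, such that $\sigma$ composed with $H_{\mathbb Z}\to H_{\mathbb C}/F^0$ equals $H_{\mathbb Z}\xrightarrow{v_{\mathbb Z}}V\to V/V^0$. A morphism $(H,V)\to(H',V')$ is a pair $(f,g)$ of a homomorphism of formal groups $f:H\to H'$ inducing a morphism $H_{\text{ét}}\to H'_{\text{ét}}$ in $\mathrm{MHS}_1$ and a linear map $g:V\to V'$ with $g(V^i)\subseteq V'^i$ for $i=0,1$, such that $gv=v'f$ and the induced maps satisfy $\bar g\sigma=\sigma'\bar f$. Let $\iota:\mathrm{FHS}_1^0\subseteq\mathrm{FHS}_1$ be the full subcategory of connected structures, i.e. those with $H=H^0$. Let $e:\mathrm{FHS}_1\to\mathrm{MHS}_1$ be $(H,V)\mapsto H_{\text{ét}}$. Let $c:\mathrm{MHS}_1\to\mathrm{FHS}_1$ send $(H_{\mathbb Z},W,F)$ to $(H_{\mathbb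 Z},H_{\mathbb C}/F^0)$ with $V^0=0$, $V^1=W_{-2}H_{\mathbb C}$, $v$ the canonical map and $\sigma=\mathrm{id}$. Let $\pi:\mathrm{FHS}_1\to\mathrm{FHS}_1^0$ send $(H,V)$ to $(H^0,V)$, with $V=V^1=V^0$ and the restriction of $v$. **Proposition.** The categories $\mathrm{FHS}_1$, $\mathrm{MHS}_1$ and $\mathrm{FHS}_1^0$ are abelian, and $\mathrm{FHS}_1^0$ is a Serre subcategory of $\mathrm{FHS}_1$. The sequence $$0\to\mathrm{FHS}_1^0\xrightarrow{\ \iota\ }\mathrm{FHS}_1\xrightarrow{\ e\ }\mathrm{MHS}_1\to0$$ is an exact sequence of abelian categories: $\iota$ and $e$ are exact, $e(H,V)=0$ if and only if $(H,V)$ is connected, and $e$ factors through an equivalence $\mathrm{FHS}_1/\mathrm{FHS}_1^0\simeq\mathrm{MHS}_1$ from the Serre quotient. Moreover $ec=1$, and $\pi\iota=1$ in the sense that the inclusions $H^0\subseteq H$ together with the identities of $V$ form a natural isomorphism from $\pi\iota$ to the identity functor of $\mathrm{FHS}_1^0$. -/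

import Mathlib

open CategoryTheory Limits
open scoped TensorProduct

noncomputable section

namespace FormalHodge

/-! ### Mixed Hodge structures of level at most one -/

/-- Complex conjugation `z ⊗ a ↦ conj z ⊗ a` on `A_ℂ = ℂ ⊗ A`. -/
def conj (A : Type) [AddCommGroup A] : (ℂ ⊗[ℤ] A) →+ (ℂ ⊗[ℤ] A) :=
  (LinearMap.rTensor A (starRingEnd ℂ).toAddMonoidHom.toIntLinearMap).toAddMonoidHom

theorem conj_tmul (A : Type) [AddCommGroup A] (z : ℂ) (a : A) :
    conj A (z ⊗ₜ a) = (starRingEnd ℂ z) ⊗ₜ a := rfl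

theorem conj_smul (A : Type) [AddCommGroup A] (z : ℂ) (x : ℂ ⊗[ℤ] A) :
    conj A (z • x) = (starRingEnd ℂ z) • conj A x := by
  induction x with
  | zero => simp
  | tmul w a => simp [TensorProduct.smul_tmul', conj_tmul]
  | add x y hx hy => simp only [smul_add, map_add, hx, hy]

/-- The complex conjugate of a complex subspace of `A_ℂ`. -/
def conjSubmodule {A : Type} [AddCommGroup A] (S : Submodule ℂ (ℂ ⊗[ℤ] A)) :
    Submodule ℂ (ℂ ⊗[ℤ] A) where
  carrier := {x | conj A x ∈ S}
  add_mem' {x y} hx hy := by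
    simp only [Set.mem_ofPred_eq, map_add] at *
    exact S.add_mem hx hy
  zero_mem' := by simp
  smul_mem' z x hx := by
    simp only [Set.mem_ofPred_eq, conj_smul] at *
    exact S.smul_mem _ hx

/-- The complex subspace `W_ℂ` of `A_ℂ` spanned by a rational subspace `W` of `A_ℚ`. -/
def complexify {A : Type} [AddCommGroup A] (W : Submodule ℚ (ℚ ⊗[ℤ] A)) :
    Submodule ℂ (ℂ ⊗[ℤ] A) :=
  Submodule.span ℂ
    ((LinearMap.rTensor A (algebraMap ℚ ℂ).toAddMonoidHom.toIntLinearMap) '' (W : Set (ℚ ⊗[ℤ] A)))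

/-- A graded polarizable mixed Hodge structure of level at most one on an abelian group `A`,
i.e. one with Hodge types in `{(0,0), (-1,0), (0,-1), (-1,-1)}`. The weight filtration is
`0 = W₋₃ ⊆ W₋₂ ⊆ W₋₁ ⊆ W₀ = A_ℚ` and the Hodge filtration is `A_ℂ = F⁻¹ ⊇ F⁰ ⊇ F¹ = 0`. -/
structure LevelOneMHS (A : Type) [AddCommGroup A] where
  /-- `W₋₂` -/
  Wm2 : Submodule ℚ (ℚ ⊗[ℤ] A)
  /-- `W₋₁` -/
  Wm1 : Submodule ℚ (ℚ ⊗[ℤ] A)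
  /-- `F⁰` -/
  F0 : Submodule ℂ (ℂ ⊗[ℤ] A)
  Wm2_le : Wm2 ≤ Wm1
  /-- `gr₋₂` is of type `(-1,-1)`: `F⁰ gr₋₂ = 0`. -/
  gr_m2 : F0 ⊓ complexify Wm2 = ⊥
  /-- `gr₋₁` has weight `-1`: `gr₋₁ = F⁰ gr₋₁ + conj (F⁰ gr₋₁)`. -/
  gr_m1_sup : (F0 ⊓ complexify Wm1) ⊔ conjSubmodule (F0 ⊓ complexify Wm1) ⊔ complexify Wm2 =
    complexify Wm1
  /-- `gr₋₁` has weight `-1`: `F⁰ gr₋₁ ∩ conj (F⁰ gr₋₁) = 0`. -/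
  gr_m1_inf : ((F0 ⊓ complexify Wm1) ⊔ complexify Wm2) ⊓
    (conjSubmodule (F0 ⊓ complexify Wm1) ⊔ complexify Wm2) = complexify Wm2
  /-- `gr₀` is of type `(0,0)`: `F⁰ gr₀ = gr₀`. -/
  gr_0 : F0 ⊔ complexify Wm1 = ⊤
  /-- `gr₋₁` is polarizable (`gr₀` and `gr₋₂` automatically are): there is a rational bilinear form,
  written here as the restriction of its extension to a rational form on `A_ℂ`, which induces
  an alternating form on `gr₋₁`, vanishes on `F⁰ gr₋₁ × F⁰ gr₋₁`, and for which the Hermitian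
  form `i ψ(x, conj x)` is positive definite on `F⁰ gr₋₁`. -/
  polarizable : ∃ ψ : (ℂ ⊗[ℤ] A) →ₗ[ℂ] (ℂ ⊗[ℤ] A) →ₗ[ℂ] ℂ,
    (∀ a b : A, ∃ q : ℚ, ψ (1 ⊗ₜ a) (1 ⊗ₜ b) = (q : ℂ)) ∧
    (∀ x ∈ complexify Wm1, ψ x x = 0) ∧
    (∀ x ∈ complexify Wm2, ∀ y ∈ complexify Wm1, ψ x y = 0) ∧
    (∀ x ∈ F0 ⊓ complexify Wm1, ∀ y ∈ F0 ⊓ complexify Wm1, ψ x y = 0) ∧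
    (∀ x ∈ F0 ⊓ complexify Wm1, x ≠ 0 → 0 < (Complex.I * ψ x (conj A x)).re)

/-- The map `f_ℂ : A_ℂ → B_ℂ` induced by a group homomorphism. -/
abbrev mapC {A B : Type} [AddCommGroup A] [AddCommGroup B] (f : A →+ B) :
    (ℂ ⊗[ℤ] A) →ₗ[ℂ] (ℂ ⊗[ℤ] B) :=
  f.toIntLinearMap.baseChange ℂ

/-- The map `f_ℚ : A_ℚ → B_ℚ` induced by a group homomorphism. -/
abbrev mapQ {A B : Type} [AddCommGroup A] [AddCommGroup B] (f : A →+ B) :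
    (ℚ ⊗[ℤ] A) →ₗ[ℚ] (ℚ ⊗[ℤ] B) :=
  f.toIntLinearMap.baseChange ℚ

/-- Compatibility of a group homomorphism with the weight and Hodge filtrations. -/
structure IsMHSHom {A B : Type} [AddCommGroup A] [AddCommGroup B]
    (S : LevelOneMHS A) (T : LevelOneMHS B) (f : A →+ B) : Prop where
  Wm2 : ∀ x ∈ S.Wm2, mapQ f x ∈ T.Wm2
  Wm1 : ∀ x ∈ S.Wm1, mapQ f x ∈ T.Wm1
  F0 : ∀ x ∈ S.F0, mapC f x ∈ T.F0

theorem mapC_id (A : Type) [AddCommGroup A] : mapC (AddMonoidHom.id A) = LinearMap.id := by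
  ext; rfl

theorem mapQ_id (A : Type) [AddCommGroup A] : mapQ (AddMonoidHom.id A) = LinearMap.id := by
  ext; rfl

theorem mapC_comp {A B C : Type} [AddCommGroup A] [AddCommGroup B] [AddCommGroup C]
    (g : B →+ C) (f : A →+ B) : mapC (g.comp f) = (mapC g).comp (mapC f) := by
  ext; rfl

theorem mapQ_comp {A B C : Type} [AddCommGroup A] [AddCommGroup B] [AddCommGroup C]
    (g : B →+ C) (f : A →+ B) : mapQ (g.comp f) = (mapQ g).comp (mapQ f) := by
  ext; rfl

theorem IsMHSHom.id {A : Type} [AddCommGroup A] (S : LevelOneMHS A) :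
    IsMHSHom S S (AddMonoidHom.id A) where
  Wm2 x hx := by rw [mapQ_id]; exact hx
  Wm1 x hx := by rw [mapQ_id]; exact hx
  F0 x hx := by rw [mapC_id]; exact hx

theorem IsMHSHom.comp {A B C : Type} [AddCommGroup A] [AddCommGroup B] [AddCommGroup C]
    {S : LevelOneMHS A} {T : LevelOneMHS B} {U : LevelOneMHS C} {g : B →+ C} {f : A →+ B}
    (hg : IsMHSHom T U g) (hf : IsMHSHom S T f) : IsMHSHom S U (g.comp f) where
  Wm2 x hx := by rw [mapQ_comp]; exact hg.Wm2 _ (hf.Wm2 _ hx)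
  Wm1 x hx := by rw [mapQ_comp]; exact hg.Wm1 _ (hf.Wm1 _ hx)
  F0 x hx := by rw [mapC_comp]; exact hg.F0 _ (hf.F0 _ hx)

/-- Objects of `MHS₁`: finitely generated abelian groups with a graded polarizable mixed Hodge
structure of level at most one. -/
structure MHS1 where
  /-- the underlying abelian group -/
  carrier : Type
  [group : AddCommGroup carrier]
  /-- the mixed Hodge structure -/
  str : LevelOneMHS carrier
  fg : Module.Finite ℤ carrier

attribute [instance] MHS1.group

/-- Morphisms of `MHS₁`. -/
@[ext]
structure MHS1.Hom (X Y : MHS1) where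
  /-- the underlying group homomorphism -/
  map : X.carrier →+ Y.carrier
  isHom : IsMHSHom X.str Y.str map

instance : Category MHS1 where
  Hom := MHS1.Hom
  id X := ⟨AddMonoidHom.id _, IsMHSHom.id _⟩
  comp f g := ⟨g.map.comp f.map, g.isHom.comp f.isHom⟩

/-! ### Commutative formal groups over `ℂ` -/

/-- The category of local Artinian (i.e. local and finite-dimensional) `ℂ`-algebras. -/
abbrev ArtAlg := ObjectProperty.FullSubcategory
  (fun R : CommAlgCat.{0} ℂ => IsLocalRing R ∧ Module.Finite ℂ R)

/-- The algebra homomorphism underlying a morphism of `ArtAlg`. -/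
abbrev ArtAlg.alg {R S : ArtAlg} (φ : R ⟶ S) : R.obj →ₐ[ℂ] S.obj := φ.hom.hom

/-- The algebra `ℂ`, whose formal spectrum is the point. -/
def pt : ArtAlg where
  obj := CommAlgCat.of ℂ ℂ
  property := ⟨inferInstanceAs (IsLocalRing ℂ), inferInstanceAs (Module.Finite ℂ ℂ)⟩

/-- Commutative group functors on local Artinian `ℂ`-algebras. -/
abbrev GroupFunctor := ArtAlg ⥤ AddCommGrpCat.{0}

/-- The subgroup `G⁰(R) ⊆ G(R)` of points which specialise to zero at the closed point. -/
def connectedSubgroup (G : GroupFunctor) (R : ArtAlg) : AddSubgroup (G.obj R) :=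
  ⨅ φ : R ⟶ pt, (G.map φ).hom.ker

theorem mem_connectedSubgroup {G : GroupFunctor} {R : ArtAlg} {x : G.obj R} :
    x ∈ connectedSubgroup G R ↔ ∀ φ : R ⟶ pt, (G.map φ).hom x = 0 := by
  simp [connectedSubgroup, AddSubgroup.mem_iInf]

theorem map_mem_connectedSubgroup (G : GroupFunctor) {R S : ArtAlg} (φ : R ⟶ S) {x : G.obj R}
    (hx : x ∈ connectedSubgroup G R) : (G.map φ).hom x ∈ connectedSubgroup G S := by
  rw [mem_connectedSubgroup] at *
  intro χ
  have := hx (φ ≫ χ)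
  rw [G.map_comp] at this
  exact this

theorem natTrans_mem_connectedSubgroup {G G' : GroupFunctor} (f : G ⟶ G') {R : ArtAlg}
    {x : G.obj R} (hx : x ∈ connectedSubgroup G R) :
    (f.app R).hom x ∈ connectedSubgroup G' R := by
  rw [mem_connectedSubgroup] at *
  intro χ
  have h := ConcreteCategory.congr_hom (f.naturality χ) x
  change (f.app pt).hom ((G.map χ).hom x) = (G'.map χ).hom ((f.app R).hom x) at h
  rw [← h, hx χ, map_zero]

/-- The connected component `G⁰` of the identity of `G`. -/
def connectedPart (G : GroupFunctor) : GroupFunctor where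
  obj R := AddCommGrpCat.of (connectedSubgroup G R)
  map φ := AddCommGrpCat.ofHom
    (((G.map φ).hom.comp (AddSubgroup.subtype _)).codRestrict _
      fun x => map_mem_connectedSubgroup G φ x.2)
  map_id R := by
    ext x
    change (G.map (𝟙 R)).hom x.1 = x.1
    rw [G.map_id]; rfl
  map_comp φ χ := by
    ext x
    change (G.map (φ ≫ χ)).hom x.1 = (G.map χ).hom ((G.map φ).hom x.1)
    rw [G.map_comp]; rfl

/-- The inclusion `G⁰ ⊆ G`. -/
def connectedIncl (G : GroupFunctor) : connectedPart G ⟶ G where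
  app _ := AddCommGrpCat.ofHom (AddSubgroup.subtype _)
  naturality _ _ _ := rfl

/-- The restriction `f⁰ : G⁰ → G'⁰` of a homomorphism. -/
def connectedMap {G G' : GroupFunctor} (f : G ⟶ G') : connectedPart G ⟶ connectedPart G' where
  app R := AddCommGrpCat.ofHom
    (((f.app R).hom.comp (AddSubgroup.subtype _)).codRestrict _
      fun x => natTrans_mem_connectedSubgroup f x.2)
  naturality R S φ := by
    ext x
    apply Subtype.ext
    exact ConcreteCategory.congr_hom (f.naturality φ) x.1

/-- The connected formal additive group `Ĝₐˢ`, with `R`-points the `s`-tuples of nilpotent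
elements of `R`. -/
def formalAdditive (s : ℕ) : GroupFunctor where
  obj R := AddCommGrpCat.of (Fin s → nilradical R.obj)
  map φ := AddCommGrpCat.ofHom
    { toFun := fun x i => ⟨ArtAlg.alg φ (x i).1, by
        have h := (x i).2
        rw [mem_nilradical] at *
        exact h.map _⟩
      map_zero' := by ext; simp
      map_add' := fun x y => by ext; simp }

/-- Commutative formal groups over `ℂ`, as functors of points on local Artinian algebras:
the group `G(ℂ)`, which is the étale part of `G`, is finitely generated, and the connected part
is (non-canonically) isomorphic to a power of the formal additive group. Any such `G` is
canonically the product of `G⁰` and of the constant group `G(ℂ)`. -/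
structure IsFormalGroup (G : GroupFunctor) : Prop where
  fg : Module.Finite ℤ (G.obj pt)
  connected : ∃ s : ℕ, Nonempty (connectedPart G ≅ formalAdditive s)

/-- A complex vector space as the (vector) group functor `R ↦ R ⊗ V`. -/
def vectorGroup (V : Type) [AddCommGroup V] [Module ℂ V] : GroupFunctor where
  obj R := AddCommGrpCat.of (R.obj ⊗[ℂ] V)
  map φ := AddCommGrpCat.ofHom (LinearMap.rTensor V (ArtAlg.alg φ).toLinearMap).toAddMonoidHom
  map_id R := by
    ext x
    exact LinearMap.rTensor_id_apply V R.obj x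
  map_comp φ χ := by
    ext x
    exact LinearMap.rTensor_comp_apply V (ArtAlg.alg χ).toLinearMap (ArtAlg.alg φ).toLinearMap x

/-- The homomorphism of vector groups given by a linear map. -/
def vectorGroupMap {V V' : Type} [AddCommGroup V] [Module ℂ V] [AddCommGroup V'] [Module ℂ V']
    (g : V →ₗ[ℂ] V') : vectorGroup V ⟶ vectorGroup V' where
  app R := AddCommGrpCat.ofHom (LinearMap.lTensor R.obj g).toAddMonoidHom
  naturality R S φ := by
    ext x
    have h := (LinearMap.lTensor_comp_rTensor R.obj (ArtAlg.alg φ).toLinearMap g).trans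
      (LinearMap.rTensor_comp_lTensor R.obj (ArtAlg.alg φ).toLinearMap g).symm
    exact LinearMap.congr_fun h x

theorem vectorGroupMap_id (V : Type) [AddCommGroup V] [Module ℂ V] :
    vectorGroupMap (LinearMap.id : V →ₗ[ℂ] V) = 𝟙 _ := by
  ext R x
  exact LinearMap.lTensor_id_apply R.obj V x

theorem vectorGroupMap_comp {V V' V'' : Type} [AddCommGroup V] [Module ℂ V] [AddCommGroup V']
    [Module ℂ V'] [AddCommGroup V''] [Module ℂ V''] (g : V →ₗ[ℂ] V') (g' : V' →ₗ[ℂ] V'') :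
    vectorGroupMap (g'.comp g) = vectorGroupMap g ≫ vectorGroupMap g' := by
  ext R x
  exact LinearMap.lTensor_comp_apply R.obj g' g x

/-- The map `v_ℤ : H_ℤ → V` induced on `ℂ`-points by `v : H → V`. -/
def intMap {G : GroupFunctor} {V : Type} [AddCommGroup V] [Module ℂ V] (v : G ⟶ vectorGroup V) :
    G.obj pt →+ V :=
  (TensorProduct.lid ℂ V).toLinearMap.toAddMonoidHom.comp (v.app pt).hom

/-! ### Formal Hodge structures of level at most one -/

/-- Objects `(H, V)` of `FHS₁`. -/
structure FHS1 where
  /-- the formal group `H` -/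
  H : GroupFunctor
  isFormalGroup : IsFormalGroup H
  /-- the mixed Hodge structure `H_ét` on `H_ℤ = H(ℂ)` -/
  et : LevelOneMHS (H.obj pt)
  /-- the vector space `V` -/
  V : Type
  [addCommGroup : AddCommGroup V]
  [module : Module ℂ V]
  [finite : FiniteDimensional ℂ V]
  /-- `V⁰` -/
  V0 : Submodule ℂ V
  /-- `V¹` -/
  V1 : Submodule ℂ V
  V0_le : V0 ≤ V1
  /-- the homomorphism `v : H → V` -/
  v : H ⟶ vectorGroup V
  /-- the isomorphism `σ : H_ℂ / F⁰ ≃ V / V⁰` -/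
  σ : ((ℂ ⊗[ℤ] (H.obj pt)) ⧸ et.F0) ≃ₗ[ℂ] (V ⧸ V0)
  /-- `σ` restricts to an isomorphism `W₋₂ H_ℂ ≃ V¹ / V⁰`; recall that `W₋₂ H_ℂ` meets `F⁰`
  trivially. -/
  σ_Wm2 : ((complexify et.Wm2).map et.F0.mkQ).map σ.toLinearMap = V1.map V0.mkQ
  comm : ∀ h : H.obj pt, σ (et.F0.mkQ (1 ⊗ₜ h)) = V0.mkQ (intMap v h)

attribute [instance] FHS1.addCommGroup FHS1.module FHS1.finite

/-- Morphisms `(f, g)` of `FHS₁`. -/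
@[ext]
structure FHS1.Hom (X Y : FHS1) where
  /-- the homomorphism of formal groups -/
  f : X.H ⟶ Y.H
  /-- the linear map -/
  g : X.V →ₗ[ℂ] Y.V
  isMHSHom : IsMHSHom X.et Y.et (f.app pt).hom
  map_V0 : X.V0 ≤ Y.V0.comap g
  map_V1 : X.V1 ≤ Y.V1.comap g
  square : X.v ≫ vectorGroupMap g = f ≫ Y.v
  square_σ : ∀ x, Y.σ (X.et.F0.mapQ Y.et.F0 (mapC (f.app pt).hom) isMHSHom.F0 x) =
    X.V0.mapQ Y.V0 g map_V0 (X.σ x)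

/-- The identity morphism of a formal Hodge structure. -/
def FHS1.Hom.id (X : FHS1) : FHS1.Hom X X where
  f := 𝟙 _
  g := LinearMap.id
  isMHSHom := IsMHSHom.id _
  map_V0 := le_rfl
  map_V1 := le_rfl
  square := by rw [vectorGroupMap_id, Category.comp_id, Category.id_comp]
  square_σ x := by
    obtain ⟨x, rfl⟩ := Submodule.mkQ_surjective _ x
    obtain ⟨y, hy⟩ := Submodule.mkQ_surjective _ (X.σ (X.et.F0.mkQ x))
    have h : mapC ((𝟙 X.H : X.H ⟶ X.H).app pt).hom x = x := by
      change mapC (AddMonoidHom.id _) x = x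
      rw [mapC_id]; rfl
    rw [← hy]
    simp only [Submodule.mkQ_apply, Submodule.mapQ_apply, h]
    exact hy.symm

/-- Composition of morphisms of formal Hodge structures. -/
def FHS1.Hom.comp {X Y Z : FHS1} (a : FHS1.Hom X Y) (b : FHS1.Hom Y Z) : FHS1.Hom X Z where
  f := a.f ≫ b.f
  g := b.g.comp a.g
  isMHSHom := b.isMHSHom.comp a.isMHSHom
  map_V0 := fun _ hx => b.map_V0 (a.map_V0 hx)
  map_V1 := fun _ hx => b.map_V1 (a.map_V1 hx)
  square := by
    rw [vectorGroupMap_comp, ← Category.assoc, a.square, Category.assoc, b.square, Category.assoc]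
  square_σ x := by
    have h1 := a.square_σ x
    have h2 := b.square_σ (X.et.F0.mapQ Y.et.F0 (mapC (a.f.app pt).hom) a.isMHSHom.F0 x)
    rw [h1] at h2
    obtain ⟨x, rfl⟩ := Submodule.mkQ_surjective _ x
    obtain ⟨y, hy⟩ := Submodule.mkQ_surjective _ (X.σ (X.et.F0.mkQ x))
    rw [← hy] at h2 ⊢
    have h : mapC ((a.f ≫ b.f).app pt).hom x =
        mapC (b.f.app pt).hom (mapC (a.f.app pt).hom x) := by
      change mapC ((b.f.app pt).hom.comp (a.f.app pt).hom) x = _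
      rw [mapC_comp]; rfl
    simp only [Submodule.mkQ_apply, Submodule.mapQ_apply, h] at h2 ⊢
    exact h2

instance : Category FHS1 where
  Hom := FHS1.Hom
  id := FHS1.Hom.id
  comp := FHS1.Hom.comp

/-- The functor `e : FHS₁ → MHS₁`, `(H, V) ↦ H_ét`. -/
def e : FHS1 ⥤ MHS1 where
  obj X := { carrier := X.H.obj pt, str := X.et, fg := X.isFormalGroup.fg }
  map φ := ⟨(φ.f.app pt).hom, φ.isMHSHom⟩

/-! ### Étale structures -/

/-- The constant group functor. -/
def constantGroup (A : Type) [AddCommGroup A] : GroupFunctor :=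
  (Functor.const _).obj (AddCommGrpCat.of A)

theorem nonempty_iso_formalAdditive_zero (G : GroupFunctor)
    (h : ∀ R, Subsingleton (G.obj R)) : Nonempty (G ≅ formalAdditive 0) := by
  have h' : ∀ R, Subsingleton ((formalAdditive 0).obj R) := fun R =>
    inferInstanceAs (Subsingleton (Fin 0 → nilradical R.obj))
  refine ⟨NatIso.ofComponents (fun R => ⟨0, 0, ?_, ?_⟩) ?_⟩
  · ext x; exact (h R).elim _ _
  · ext x; exact (h' R).elim _ _
  · intro R S φ
    ext x; exact (h' S).elim _ _

theorem ArtAlg.exists_hom_pt (R : ArtAlg) : Nonempty (R ⟶ pt) := by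
  have := R.property.1
  have := R.property.2
  have : FiniteDimensional ℂ (IsLocalRing.ResidueField R.obj) :=
    inferInstanceAs (Module.Finite ℂ (R.obj ⧸ IsLocalRing.maximalIdeal R.obj))
  have hb : Function.Bijective (algebraMap ℂ (IsLocalRing.ResidueField R.obj)) :=
    IsAlgClosed.algebraMap_bijective_of_isIntegral
  let j : ℂ ≃ₐ[ℂ] IsLocalRing.ResidueField R.obj :=
    AlgEquiv.ofBijective (Algebra.ofId ℂ _) hb
  let p : R.obj →ₐ[ℂ] ℂ := j.symm.toAlgHom.comp
    (Ideal.Quotient.mkₐ ℂ (IsLocalRing.maximalIdeal R.obj))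
  exact ⟨ObjectProperty.homMk (CommAlgCat.ofHom p)⟩

theorem isFormalGroup_constant (A : Type) [AddCommGroup A] (h : Module.Finite ℤ A) :
    IsFormalGroup (constantGroup A) where
  fg := h
  connected := ⟨0, nonempty_iso_formalAdditive_zero _ fun R => by
    constructor
    have key : ∀ x : connectedSubgroup (constantGroup A) R, x = 0 := fun x => by
      obtain ⟨φ⟩ := ArtAlg.exists_hom_pt R
      exact Subtype.ext (mem_connectedSubgroup.1 x.2 φ)
    intro x y
    exact (key x).trans (key y).symm⟩

/-- The canonical map `A → A_ℂ / F⁰` as a map from the constant group to a vector group. -/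
def canonicalMap {A : Type} [AddCommGroup A] (F : Submodule ℂ (ℂ ⊗[ℤ] A)) :
    constantGroup A ⟶ vectorGroup ((ℂ ⊗[ℤ] A) ⧸ F) where
  app R := AddCommGrpCat.ofHom
    { toFun := fun a => (1 : R.obj) ⊗ₜ[ℂ] F.mkQ (1 ⊗ₜ a)
      map_zero' := by simp
      map_add' := fun a b => by rw [TensorProduct.tmul_add, map_add, TensorProduct.tmul_add] }
  naturality R S φ := by
    ext a
    change (1 : S.obj) ⊗ₜ[ℂ] F.mkQ (1 ⊗ₜ a) = (ArtAlg.alg φ 1) ⊗ₜ[ℂ] F.mkQ (1 ⊗ₜ a)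
    rw [map_one]

theorem intMap_canonicalMap {A : Type} [AddCommGroup A] (F : Submodule ℂ (ℂ ⊗[ℤ] A)) (a : A) :
    intMap (canonicalMap F) a = F.mkQ (1 ⊗ₜ a) :=
  one_smul ℂ (F.mkQ (1 ⊗ₜ a))

/-- The canonical étale formal Hodge structure `(H_ℤ, H_ℂ / F⁰)` of a mixed Hodge structure. -/
def cObj (X : MHS1) : FHS1 :=
  haveI := X.fg
  { H := constantGroup X.carrier
    isFormalGroup := isFormalGroup_constant _ X.fg
    et := X.str
    V := (ℂ ⊗[ℤ] X.carrier) ⧸ X.str.F0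
    V0 := ⊥
    V1 := (complexify X.str.Wm2).map X.str.F0.mkQ
    V0_le := bot_le
    v := canonicalMap X.str.F0
    σ := (Submodule.quotEquivOfEqBot ⊥ rfl).symm
    σ_Wm2 := rfl
    comm := fun h => congrArg (Submodule.mkQ _) (intMap_canonicalMap X.str.F0 h).symm }

theorem mapC_mem_complexify {A B : Type} [AddCommGroup A] [AddCommGroup B] {f : A →+ B}
    {W : Submodule ℚ (ℚ ⊗[ℤ] A)} {W' : Submodule ℚ (ℚ ⊗[ℤ] B)} (h : ∀ x ∈ W, mapQ f x ∈ W')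
    {x : ℂ ⊗[ℤ] A} (hx : x ∈ complexify W) : mapC f x ∈ complexify W' := by
  suffices complexify W ≤ (complexify W').comap (mapC f) from this hx
  refine Submodule.span_le.2 ?_
  rintro _ ⟨y, hy, rfl⟩
  refine Submodule.subset_span ⟨mapQ f y, h y hy, ?_⟩
  clear hy
  induction y with
  | zero => simp only [map_zero]
  | tmul q a => rfl
  | add y z hy hz => simp only [map_add, hy, hz]

/-- The functor `c : MHS₁ → FHS₁`. -/
def c : MHS1 ⥤ FHS1 where
  obj := cObj
  map {X Y} φ :=
    { f := (Functor.const _).map (AddCommGrpCat.ofHom φ.map)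
      g := X.str.F0.mapQ Y.str.F0 (mapC φ.map) φ.isHom.F0
      isMHSHom := φ.isHom
      map_V0 := bot_le
      map_V1 := by
        rintro _ ⟨_, hx, rfl⟩
        exact ⟨_, mapC_mem_complexify φ.isHom.Wm2 hx, rfl⟩
      square := by
        ext R a
        change (1 : R.obj) ⊗ₜ[ℂ] (Y.str.F0.mkQ (mapC φ.map (1 ⊗ₜ a))) =
          (1 : R.obj) ⊗ₜ[ℂ] (Y.str.F0.mkQ (1 ⊗ₜ φ.map a))
        rfl
      square_σ := fun x => by
        obtain ⟨x, rfl⟩ := Submodule.mkQ_surjective _ x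
        rfl }
  map_id X := by
    apply FHS1.Hom.ext
    · rfl
    · refine Submodule.linearMap_qext _ ?_
      ext a
      rfl
  map_comp {X Y Z} φ χ := by
    apply FHS1.Hom.ext
    · rfl
    · refine Submodule.linearMap_qext _ ?_
      ext a
      rfl

/-! ### Connected structures -/

/-- A formal Hodge structure `(H, V)` is connected if `H = H⁰`. -/
def connected : ObjectProperty FHS1 := fun X => ∀ R, connectedSubgroup X.H R = ⊤

/-- The full subcategory `FHS₁⁰` of connected structures. -/
abbrev FHS10 := connected.FullSubcategory

/-- The inclusion `FHS₁⁰ → FHS₁`. -/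
abbrev ι : FHS10 ⥤ FHS1 := connected.ι

instance connectedPart_subsingleton (G : GroupFunctor) :
    Subsingleton ((connectedPart G).obj pt) := by
  have key : ∀ x : connectedSubgroup G pt, x = 0 := fun x => by
    have h := mem_connectedSubgroup.1 x.2 (𝟙 pt)
    rw [G.map_id] at h
    exact Subtype.ext h
  exact ⟨fun x y => (key x).trans (key y).symm⟩

theorem connectedSubgroup_connectedPart (G : GroupFunctor) (R : ArtAlg) :
    connectedSubgroup (connectedPart G) R = ⊤ := by
  rw [eq_top_iff]
  intro x _
  rw [mem_connectedSubgroup]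
  intro φ
  exact Subsingleton.elim _ _

theorem isFormalGroup_connectedPart {G : GroupFunctor} (h : IsFormalGroup G) :
    IsFormalGroup (connectedPart G) where
  fg := Module.Finite.of_finite
  connected := by
    obtain ⟨s, ⟨i⟩⟩ := h.connected
    refine ⟨s, ⟨?_ ≪≫ i⟩⟩
    refine ⟨connectedIncl _, ⟨fun R => AddCommGrpCat.ofHom ((AddMonoidHom.id _).codRestrict
      (connectedSubgroup (connectedPart G) R)
      fun x => by rw [connectedSubgroup_connectedPart]; trivial), fun _ _ _ => rfl⟩, ?_, ?_⟩
    · ext R x; rfl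
    · ext R x; rfl

/-- The mixed Hodge structure on the zero group. -/
def zeroMHS (A : Type) [AddCommGroup A] [Subsingleton A] : LevelOneMHS A :=
  { Wm2 := ⊥
    Wm1 := ⊥
    F0 := ⊥
    Wm2_le := le_rfl
    gr_m2 := Subsingleton.elim _ _
    gr_m1_sup := Subsingleton.elim _ _
    gr_m1_inf := Subsingleton.elim _ _
    gr_0 := Subsingleton.elim _ _
    polarizable := ⟨0, fun _ _ => ⟨0, by simp⟩, fun _ _ => rfl, fun _ _ _ _ => rfl,
      fun _ _ _ _ => rfl, fun x _ hx => absurd (Subsingleton.elim x 0) hx⟩ }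

/-- The connected structure `π(H, V) = (H⁰, V)`, with `V = V¹ = V⁰` and the restriction of `v`. -/
def πObj (X : FHS1) : FHS10 where
  obj :=
    { H := connectedPart X.H
      isFormalGroup := isFormalGroup_connectedPart X.isFormalGroup
      et := zeroMHS _
      V := X.V
      V0 := ⊤
      V1 := ⊤
      V0_le := le_rfl
      v := connectedIncl X.H ≫ X.v
      σ := 0
      σ_Wm2 := Subsingleton.elim _ _
      comm := fun _ => Subsingleton.elim _ _ }
  property := connectedSubgroup_connectedPart X.H

/-- The functor `π : FHS₁ → FHS₁⁰`. -/
def π : FHS1 ⥤ FHS10 where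
  obj := πObj
  map {X Y} φ := ObjectProperty.homMk
    { f := connectedMap φ.f
      g := φ.g
      isMHSHom :=
        { Wm2 := fun x hx => by
            have hx' : x = 0 := hx
            rw [hx', map_zero]; exact Submodule.zero_mem _
          Wm1 := fun x hx => by
            have hx' : x = 0 := hx
            rw [hx', map_zero]; exact Submodule.zero_mem _
          F0 := fun x hx => by
            have hx' : x = 0 := hx
            rw [hx', map_zero]; exact Submodule.zero_mem _ }
      map_V0 := fun _ _ => trivial
      map_V1 := fun _ _ => trivial
      square := by
        change (connectedIncl X.H ≫ X.v) ≫ vectorGroupMap φ.g =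
          connectedMap φ.f ≫ connectedIncl Y.H ≫ Y.v
        rw [Category.assoc, φ.square]
        rfl
      square_σ := fun _ => Subsingleton.elim (α := Y.V ⧸ (⊤ : Submodule ℂ Y.V)) _ _ }
  map_id X := by
    apply ObjectProperty.hom_ext
    apply FHS1.Hom.ext <;> rfl
  map_comp φ χ := by
    apply ObjectProperty.hom_ext
    apply FHS1.Hom.ext <;> rfl

end FormalHodge

end

open CategoryTheory Limits
open scoped TensorProduct

noncomputable section

namespace FormalHodge

/-! ### Rational structures on complexifications -/

/-! The Hodge-theoretic input is the Deligne splitting. With `FW` = F⁰ ∩ W₋₁, `GW` its complex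
conjugate and `I00` = F⁰ ∩ (conj F⁰ + W₋₂), the complexified lattice is W₋₂ ⊕ `FW` ⊕ `GW` ⊕ `I00`
(`exists_split`, `eq_zero_of_split`), and every morphism preserves the four summands. Hence
morphisms are strict for both filtrations, bijective morphisms are isomorphisms, and kernels and
images are graded. The induced filtrations therefore make group-theoretic kernels and cokernels into
structures of level at most one. Only the polarization of a quotient is delicate: `polarizable_map`
transports the form along a rational section whose values are orthogonal to the kernel.

For formal groups, characteristic zero makes every homomorphism between powers of the formal
additive group a matrix (`exists_scalar`, `exists_eq_formalMap`), so kernels and cokernels of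
connected parts are linear algebra over ℂ. The decomposition of G(R) into G⁰(R) and the constant
group G(ℂ) handles the general case.

A formal Hodge structure amounts to a linear map H_ℂ → V for which F⁰ is the preimage of V⁰ and V is
the image plus V⁰; then σ and V¹ are determined (`ofMap`, `mk'`). Strictness for F⁰ yields
strictness for V⁰, so kernels and cokernels are computed separately on the points of H and on V.
Together these functors to abelian groups detect isomorphisms, which makes the category abelian
(`abelianOfJointlyConservative`).

By construction `e` takes these kernels and cokernels to those of mixed Hodge structures, so it is
exact, and its kernel is the class of connected structures, which is thus a Serre class. Every (H,
V) is joined to `c` of its étale part by (H, V) ← (H_ℤ, V) → (H_ℤ, H_ℂ/F⁰), and `e` maps both arrows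
to isomorphisms. Both arrows become invertible in the Serre quotient, where `c` supplies the inverse
equivalence. Finally, a connected structure has H_ℤ = 0, hence V⁰ = V, and this gives the
isomorphism from πι to the identity. -/

theorem exists_generalizedInverse {K V V' : Type*} [Field K] [AddCommGroup V] [Module K V]
    [AddCommGroup V'] [Module K V'] (u : V →ₗ[K] V') :
    ∃ N : V' →ₗ[K] V, ∀ x, u (N (u x)) = u x := by
  -- `N` is a projection of the target onto the range of `u`, followed by a section of `u` over its
  -- range.
  obtain ⟨s, hs⟩ := u.rangeRestrict.exists_rightInverse_of_surjective u.range_rangeRestrict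
  obtain ⟨p, hp⟩ := (LinearMap.range u).subtype.exists_leftInverse_of_injective
    (Submodule.ker_subtype _)
  refine ⟨s.comp p, fun x => ?_⟩
  have h1 : p (u x) = u.rangeRestrict x := LinearMap.congr_fun hp (u.rangeRestrict x)
  have h2 := congrArg Subtype.val (LinearMap.congr_fun hs (u.rangeRestrict x))
  rw [LinearMap.comp_apply, h1]
  exact h2

/-- Exhibiting a subspace as a kernel turns statements about complexified subspaces into statements
about kernels of rational maps. -/
theorem exists_projection {K V : Type*} [Field K] [AddCommGroup V] [Module K V]
    (W : Submodule K V) : ∃ p : V →ₗ[K] V, ∀ x, x ∈ W ↔ p x = 0 := by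
  obtain ⟨p, hp⟩ := W.subtype.exists_leftInverse_of_injective (Submodule.ker_subtype _)
  refine ⟨LinearMap.id - W.subtype.comp p, fun x => ⟨fun hx => ?_, fun hx => ?_⟩⟩
  · have h := congrArg Subtype.val (LinearMap.congr_fun hp ⟨x, hx⟩)
    exact sub_eq_zero.2 h.symm
  · have h : x = W.subtype (p x) := sub_eq_zero.1 hx
    rw [h]
    exact (p x).2

section Rational

variable {A B D : Type} [AddCommGroup A] [AddCommGroup B] [AddCommGroup D]

/-- The map `A_ℚ → A_ℂ`. -/
abbrev ratC (A : Type) [AddCommGroup A] : (ℚ ⊗[ℤ] A) →ₗ[ℤ] (ℂ ⊗[ℤ] A) :=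
  LinearMap.rTensor A (algebraMap ℚ ℂ).toAddMonoidHom.toIntLinearMap

theorem ratC_tmul (q : ℚ) (a : A) : ratC A (q ⊗ₜ a) = (q : ℂ) • ((1 : ℂ) ⊗ₜ[ℤ] a) := by
  rw [TensorProduct.smul_tmul', smul_eq_mul, mul_one]
  rfl

theorem ratC_smul (q : ℚ) (x : ℚ ⊗[ℤ] A) : ratC A (q • x) = (q : ℂ) • ratC A x := by
  induction x with
  | zero => simp
  | tmul r a =>
    rw [TensorProduct.smul_tmul', ratC_tmul, ratC_tmul, smul_smul, smul_eq_mul, Rat.cast_mul]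
  | add x y hx hy => simp only [smul_add, map_add, hx, hy]

/-- The group `A` may have torsion, so flatness of `A` is not available; instead a ℚ-linear
retraction of ℚ ⊂ ℂ survives tensoring with `A`. -/
theorem ratC_injective : Function.Injective (ratC A) := by
  obtain ⟨r, hr⟩ := (Algebra.linearMap ℚ ℂ).exists_leftInverse_of_injective
    (LinearMap.ker_eq_bot.2 (algebraMap ℚ ℂ).injective)
  refine Function.LeftInverse.injective
    (g := LinearMap.rTensor A r.toAddMonoidHom.toIntLinearMap) fun x => ?_
  induction x with
  | zero => simp
  | tmul q a =>
    change (r (algebraMap ℚ ℂ q)) ⊗ₜ[ℤ] a = q ⊗ₜ[ℤ] a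
    congr 1
    exact LinearMap.congr_fun hr q
  | add x y hx hy => simp only [map_add, hx, hy]

theorem conj_ratC (x : ℚ ⊗[ℤ] A) : conj A (ratC A x) = ratC A x := by
  induction x with
  | zero => simp
  | tmul q a => rw [ratC_tmul, conj_smul, conj_tmul]; simp
  | add x y hx hy => simp only [map_add, hx, hy]

theorem conj_conj (x : ℂ ⊗[ℤ] A) : conj A (conj A x) = x := by
  induction x with
  | zero => simp
  | tmul z a => rw [conj_tmul, conj_tmul, Complex.conj_conj]
  | add x y hx hy => simp only [map_add, hx, hy]

theorem span_range_ratC : Submodule.span ℂ (Set.range (ratC A)) = ⊤ := by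
  rw [eq_top_iff]
  rintro x -
  induction x with
  | zero => exact Submodule.zero_mem _
  | tmul z a =>
    have h : z ⊗ₜ[ℤ] a = z • ratC A (1 ⊗ₜ a) := by
      rw [ratC_tmul, Rat.cast_one, one_smul, TensorProduct.smul_tmul', smul_eq_mul, mul_one]
    rw [h]
    exact Submodule.smul_mem _ _ (Submodule.subset_span ⟨_, rfl⟩)
  | add x y hx hy => exact Submodule.add_mem _ hx hy

theorem hom_ext_ratC {E : Type*} [AddCommGroup E] [Module ℂ E] {f g : (ℂ ⊗[ℤ] A) →ₗ[ℂ] E}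
    (h : ∀ x, f (ratC A x) = g (ratC A x)) : f = g :=
  LinearMap.ext_on span_range_ratC (by rintro _ ⟨x, rfl⟩; exact h x)

/-- The complex linear extension of a rational linear map. -/
def extC (s : (ℚ ⊗[ℤ] A) →ₗ[ℚ] (ℚ ⊗[ℤ] B)) : (ℂ ⊗[ℤ] A) →ₗ[ℂ] (ℂ ⊗[ℤ] B) :=
  LinearMap.liftBaseChange ℂ
    ((ratC B).comp ((s.restrictScalars ℤ).comp (TensorProduct.mk ℤ ℚ A 1)))

theorem extC_ratC (s : (ℚ ⊗[ℤ] A) →ₗ[ℚ] (ℚ ⊗[ℤ] B)) (x : ℚ ⊗[ℤ] A) :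
    extC s (ratC A x) = ratC B (s x) := by
  induction x with
  | zero => simp
  | tmul q a =>
    have h : q ⊗ₜ[ℤ] a = q • ((1 : ℚ) ⊗ₜ[ℤ] a) := by
      rw [TensorProduct.smul_tmul', smul_eq_mul, mul_one]
    rw [ratC_tmul, map_smul, h, map_smul, ratC_smul]
    congr 1
    simp only [extC, LinearMap.liftBaseChange_tmul, one_smul]
    rfl
  | add x y hx hy => simp only [map_add, hx, hy]

theorem extC_mapQ (f : A →+ B) : extC (mapQ f) = mapC f := by
  refine hom_ext_ratC fun x => ?_
  rw [extC_ratC]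
  induction x with
  | zero => simp
  | tmul q a => rfl
  | add x y hx hy => simp only [map_add, hx, hy]

theorem mapC_ratC (f : A →+ B) (x : ℚ ⊗[ℤ] A) : mapC f (ratC A x) = ratC B (mapQ f x) := by
  rw [← extC_mapQ, extC_ratC]

theorem extC_comp (s : (ℚ ⊗[ℤ] A) →ₗ[ℚ] (ℚ ⊗[ℤ] B)) (t : (ℚ ⊗[ℤ] B) →ₗ[ℚ] (ℚ ⊗[ℤ] D)) :
    extC (t.comp s) = (extC t).comp (extC s) :=
  hom_ext_ratC fun x => by simp only [LinearMap.comp_apply, extC_ratC]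

theorem extC_sub (s t : (ℚ ⊗[ℤ] A) →ₗ[ℚ] (ℚ ⊗[ℤ] B)) : extC (s - t) = extC s - extC t :=
  hom_ext_ratC fun x => by simp only [LinearMap.sub_apply, extC_ratC, map_sub]

theorem extC_id : extC (LinearMap.id : (ℚ ⊗[ℤ] A) →ₗ[ℚ] (ℚ ⊗[ℤ] A)) = LinearMap.id :=
  hom_ext_ratC fun x => by rw [extC_ratC]; rfl

theorem conj_extC (s : (ℚ ⊗[ℤ] A) →ₗ[ℚ] (ℚ ⊗[ℤ] B)) (x : ℂ ⊗[ℤ] A) :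
    conj B (extC s x) = extC s (conj A x) := by
  have hx : x ∈ Submodule.span ℂ (Set.range (ratC A)) := by rw [span_range_ratC]; trivial
  induction hx using Submodule.span_induction with
  | mem x h => obtain ⟨y, rfl⟩ := h; rw [conj_ratC, extC_ratC, conj_ratC]
  | zero => simp
  | add x y _ _ hx hy => simp only [map_add, hx, hy]
  | smul z x _ hx => rw [map_smul, conj_smul, hx, conj_smul, map_smul]

theorem conj_mapC (f : A →+ B) (x : ℂ ⊗[ℤ] A) : conj B (mapC f x) = mapC f (conj A x) := by
  rw [← extC_mapQ, conj_extC]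

theorem ratC_mem_complexify {W : Submodule ℚ (ℚ ⊗[ℤ] A)} {x : ℚ ⊗[ℤ] A} (hx : x ∈ W) :
    ratC A x ∈ complexify W :=
  Submodule.subset_span ⟨x, hx, rfl⟩

theorem complexify_le {W : Submodule ℚ (ℚ ⊗[ℤ] A)} {P : Submodule ℂ (ℂ ⊗[ℤ] A)}
    (h : ∀ x ∈ W, ratC A x ∈ P) : complexify W ≤ P :=
  Submodule.span_le.2 (by rintro _ ⟨x, hx, rfl⟩; exact h x hx)

theorem complexify_mono {W W' : Submodule ℚ (ℚ ⊗[ℤ] A)} (h : W ≤ W') :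
    complexify W ≤ complexify W' :=
  complexify_le fun _ hx => ratC_mem_complexify (h hx)

theorem complexify_top : complexify (⊤ : Submodule ℚ (ℚ ⊗[ℤ] A)) = ⊤ := by
  rw [eq_top_iff, ← span_range_ratC]
  exact Submodule.span_mono (by rintro _ ⟨x, rfl⟩; exact ⟨x, trivial, rfl⟩)

theorem complexify_map (s : (ℚ ⊗[ℤ] A) →ₗ[ℚ] (ℚ ⊗[ℤ] B)) (W : Submodule ℚ (ℚ ⊗[ℤ] A)) :
    complexify (W.map s) = (complexify W).map (extC s) := by
  refine le_antisymm (complexify_le ?_) (Submodule.map_le_iff_le_comap.2 (complexify_le ?_))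
  · rintro _ ⟨x, hx, rfl⟩
    exact ⟨_, ratC_mem_complexify hx, extC_ratC s x⟩
  · intro x hx
    rw [Submodule.mem_comap, extC_ratC]
    exact ratC_mem_complexify ⟨x, hx, rfl⟩

/-- For a generalized inverse `N` of `u`, the rational map 1 − `N`∘`u` takes values in the kernel,
and its complex extension fixes every vector of the complex kernel. -/
theorem complexify_ker (u : (ℚ ⊗[ℤ] A) →ₗ[ℚ] (ℚ ⊗[ℤ] B)) :
    complexify (LinearMap.ker u) = LinearMap.ker (extC u) := by
  refine le_antisymm (complexify_le fun x hx => ?_) fun x hx => ?_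
  · rw [LinearMap.mem_ker, extC_ratC, LinearMap.mem_ker.1 hx, map_zero]
  · obtain ⟨N, hN⟩ := exists_generalizedInverse u
    have h : x = extC (LinearMap.id - N.comp u) x := by
      rw [extC_sub, extC_id, extC_comp, LinearMap.sub_apply, LinearMap.comp_apply,
        LinearMap.mem_ker.1 hx, map_zero, sub_zero]
      rfl
    have hle : (⊤ : Submodule ℚ _).map (LinearMap.id - N.comp u) ≤ LinearMap.ker u := by
      rintro _ ⟨y, -, rfl⟩
      rw [LinearMap.mem_ker, LinearMap.sub_apply, map_sub, LinearMap.comp_apply, hN]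
      exact sub_self _
    refine complexify_mono hle ?_
    rw [complexify_map, complexify_top]
    exact ⟨x, trivial, h.symm⟩

theorem complexify_comap (s : (ℚ ⊗[ℤ] A) →ₗ[ℚ] (ℚ ⊗[ℤ] B)) (W : Submodule ℚ (ℚ ⊗[ℤ] B)) :
    complexify (W.comap s) = (complexify W).comap (extC s) := by
  obtain ⟨p, hp⟩ := exists_projection W
  have hW : W = LinearMap.ker p := Submodule.ext hp
  rw [hW, ← LinearMap.ker_comp, complexify_ker, complexify_ker, extC_comp, LinearMap.ker_comp]

/-- If `p` projects onto `W`, a vector `x` of both complexifications satisfies `x` = p_ℂ(`x`), so it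
lies in the complexification of p(p⁻¹(`W'`)), and p(p⁻¹(`W'`)) is contained in `W` ⊓ `W'`. -/
theorem complexify_inf (W W' : Submodule ℚ (ℚ ⊗[ℤ] A)) :
    complexify (W ⊓ W') = complexify W ⊓ complexify W' := by
  refine le_antisymm (le_inf (complexify_mono inf_le_left) (complexify_mono inf_le_right)) ?_
  obtain ⟨p, hp⟩ := W.subtype.exists_leftInverse_of_injective (Submodule.ker_subtype _)
  have hp' : ∀ y ∈ W, (W.subtype.comp p) y = y := fun y hy =>
    congrArg Subtype.val (LinearMap.congr_fun hp ⟨y, hy⟩)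
  have hpC : complexify W ≤ LinearMap.ker (extC (W.subtype.comp p - LinearMap.id)) := by
    rw [← complexify_ker]
    exact complexify_mono fun y hy => sub_eq_zero.2 (hp' y hy)
  rintro x ⟨hx, hx'⟩
  have h1 := hpC hx
  rw [LinearMap.mem_ker, extC_sub, extC_id, LinearMap.sub_apply, sub_eq_zero] at h1
  have h2 : x ∈ complexify (((W'.comap (W.subtype.comp p))).map (W.subtype.comp p)) := by
    rw [complexify_map, complexify_comap]
    refine ⟨x, ?_, h1⟩
    change extC (W.subtype.comp p) x ∈ complexify W'
    rw [h1]
    exact hx'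
  refine complexify_mono ?_ h2
  rintro _ ⟨y, hy, rfl⟩
  exact ⟨(p y).2, hy⟩

/-- This descends weight conditions from ℂ to ℚ: strictness is proved with the complex splitting,
whereas W is rational data. -/
theorem ratC_mem_complexify_iff {W : Submodule ℚ (ℚ ⊗[ℤ] A)} {x : ℚ ⊗[ℤ] A} :
    ratC A x ∈ complexify W ↔ x ∈ W := by
  refine ⟨fun h => ?_, ratC_mem_complexify⟩
  obtain ⟨p, hp⟩ := exists_projection W
  have hW : W = LinearMap.ker p := Submodule.ext hp
  rw [hW] at h ⊢
  rw [complexify_ker, LinearMap.mem_ker, extC_ratC] at h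
  exact ratC_injective (h.trans (map_zero _).symm)

theorem conj_mem_complexify {W : Submodule ℚ (ℚ ⊗[ℤ] A)} {x : ℂ ⊗[ℤ] A}
    (hx : x ∈ complexify W) : conj A x ∈ complexify W := by
  suffices complexify W ≤ conjSubmodule (complexify W) from this hx
  refine complexify_le fun y hy => ?_
  change conj A (ratC A y) ∈ complexify W
  rw [conj_ratC]
  exact ratC_mem_complexify hy

theorem mem_conjSubmodule {P : Submodule ℂ (ℂ ⊗[ℤ] A)} {x : ℂ ⊗[ℤ] A} :
    x ∈ conjSubmodule P ↔ conj A x ∈ P := Iff.rfl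

theorem conj_mem_conjSubmodule {P : Submodule ℂ (ℂ ⊗[ℤ] A)} {x : ℂ ⊗[ℤ] A} (hx : x ∈ P) :
    conj A x ∈ conjSubmodule P := by
  rw [mem_conjSubmodule, conj_conj]; exact hx

theorem mapC_injective {f : A →+ B} (hf : Function.Injective f) : Function.Injective (mapC f) :=
  Module.Flat.lTensor_preserves_injective_linearMap (M := ℂ) f.toIntLinearMap hf

theorem mapC_surjective {f : A →+ B} (hf : Function.Surjective f) :
    Function.Surjective (mapC f) :=
  LinearMap.lTensor_surjective ℂ (g := f.toIntLinearMap) hf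

theorem mapC_exact {i : A →+ B} {p : B →+ D} (h : Function.Exact i p) :
    Function.Exact (mapC i) (mapC p) :=
  Module.Flat.lTensor_exact (M := ℂ) (f := i.toIntLinearMap) (g := p.toIntLinearMap) h

theorem ratC_one_tmul (a : A) : ratC A (1 ⊗ₜ a) = 1 ⊗ₜ a := by
  rw [ratC_tmul, Rat.cast_one, one_smul]

end Rational

/-! ### The splitting of a mixed Hodge structure and strictness -/

section Splitting

variable {A B K Q : Type} [AddCommGroup A] [AddCommGroup B] [AddCommGroup K] [AddCommGroup Q]

namespace LevelOneMHS

/-- The summand `I^{-1,-1} = W₋₂` of the Deligne splitting. -/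
abbrev W2 (S : LevelOneMHS A) : Submodule ℂ (ℂ ⊗[ℤ] A) := complexify S.Wm2

/-- The complexification of `W₋₁`. -/
abbrev W1 (S : LevelOneMHS A) : Submodule ℂ (ℂ ⊗[ℤ] A) := complexify S.Wm1

/-- The summand `I^{0,-1} = F⁰ ∩ W₋₁` of the Deligne splitting. -/
abbrev FW (S : LevelOneMHS A) : Submodule ℂ (ℂ ⊗[ℤ] A) := S.F0 ⊓ S.W1

/-- The summand `I^{-1,0}`, the complex conjugate of `I^{0,-1}`. -/
abbrev GW (S : LevelOneMHS A) : Submodule ℂ (ℂ ⊗[ℤ] A) := conjSubmodule S.FW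

/-- The summand `I^{0,0}` of the Deligne splitting. -/
abbrev I00 (S : LevelOneMHS A) : Submodule ℂ (ℂ ⊗[ℤ] A) := S.F0 ⊓ (conjSubmodule S.F0 ⊔ S.W2)

variable (S : LevelOneMHS A) (T : LevelOneMHS B)

theorem W2_le_W1 : S.W2 ≤ S.W1 := complexify_mono S.Wm2_le

theorem GW_le_W1 : S.GW ≤ S.W1 := fun x hx => by
  have h := conj_mem_complexify (mem_conjSubmodule.1 hx).2
  rwa [conj_conj] at h

variable {S T}

theorem eq_zero_of_mem_F0_of_mem_W2 {x : ℂ ⊗[ℤ] A} (h : x ∈ S.F0) (h' : x ∈ S.W2) : x = 0 := by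
  have hx : x ∈ S.F0 ⊓ complexify S.Wm2 := ⟨h, h'⟩
  rwa [S.gr_m2] at hx

theorem mem_W2_of_mem {x : ℂ ⊗[ℤ] A} (h : x ∈ S.FW ⊔ S.W2) (h' : x ∈ S.GW ⊔ S.W2) :
    x ∈ S.W2 := by
  have hx : x ∈ (S.F0 ⊓ complexify S.Wm1 ⊔ complexify S.Wm2) ⊓
    (conjSubmodule (S.F0 ⊓ complexify S.Wm1) ⊔ complexify S.Wm2) := ⟨h, h'⟩
  rwa [S.gr_m1_inf] at hx

theorem exists_split_of_mem_W1 {x : ℂ ⊗[ℤ] A} (hx : x ∈ S.W1) :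
    ∃ w ∈ S.W2, ∃ p ∈ S.FW, ∃ q ∈ S.GW, x = w + p + q := by
  rw [W1, ← S.gr_m1_sup] at hx
  obtain ⟨y, hy, w, hw, rfl⟩ := Submodule.mem_sup.1 hx
  obtain ⟨p, hp, q, hq, rfl⟩ := Submodule.mem_sup.1 hy
  exact ⟨w, hw, p, hp, q, hq, by abel⟩

/-- The condition on gr₀ is applied to the conjugate of `x`. Conjugating back expresses `x` as an
element of conj F⁰ plus one of W₋₁, and removing the `FW` component of the latter leaves an element
of F⁰ ∩ (conj F⁰ + W₋₂). -/
theorem exists_split_of_mem_F0 {x : ℂ ⊗[ℤ] A} (hx : x ∈ S.F0) :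
    ∃ p ∈ S.FW, ∃ r ∈ S.I00, x = p + r := by
  have h : conj A x ∈ S.F0 ⊔ S.W1 := by rw [S.gr_0]; trivial
  obtain ⟨y, hy, z, hz, hyz⟩ := Submodule.mem_sup.1 h
  have hx' : x = conj A y + conj A z := by rw [← map_add, hyz, conj_conj]
  obtain ⟨w, hw, p, hp, q, hq, hz'⟩ := exists_split_of_mem_W1 (conj_mem_complexify hz)
  refine ⟨p, hp, conj A y + q + w, ⟨?_, ?_⟩, ?_⟩
  · have h2 : conj A y + q + w = x - p := by rw [hx', hz']; abel
    rw [h2]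
    exact S.F0.sub_mem hx hp.1
  · exact Submodule.add_mem_sup (Submodule.add_mem _ (conj_mem_conjSubmodule hy) hq.1) hw
  · rw [hx', hz']; abel

theorem exists_split (x : ℂ ⊗[ℤ] A) :
    ∃ w ∈ S.W2, ∃ p ∈ S.FW, ∃ q ∈ S.GW, ∃ r ∈ S.I00, x = w + p + q + r := by
  have h : x ∈ S.F0 ⊔ S.W1 := by rw [S.gr_0]; trivial
  obtain ⟨y, hy, z, hz, rfl⟩ := Submodule.mem_sup.1 h
  obtain ⟨p, hp, r, hr, rfl⟩ := exists_split_of_mem_F0 hy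
  obtain ⟨w, hw, p', hp', q, hq, rfl⟩ := exists_split_of_mem_W1 hz
  exact ⟨w, hw, p + p', Submodule.add_mem _ hp hp', q, hq, r, hr, by abel⟩

/-- Components are eliminated one at a time. For `r` and then `p`, the relation places the component
in both `FW` and `GW` + W₋₂, hence in W₋₂ by the weight −1 condition, and F⁰ ∩ W₋₂ = 0. For `q` the
last fact is applied to its conjugate. -/
theorem eq_zero_of_split {w p q r : ℂ ⊗[ℤ] A} (hw : w ∈ S.W2) (hp : p ∈ S.FW) (hq : q ∈ S.GW)
    (hr : r ∈ S.I00) (h : w + p + q + r = 0) : w = 0 ∧ p = 0 ∧ q = 0 ∧ r = 0 := by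
  have hr0 : r = 0 := by
    have hr1 : r ∈ S.W1 := by
      have h' : r = -(w + p + q) := by rw [eq_neg_iff_add_eq_zero, add_comm]; exact h
      rw [h']
      exact Submodule.neg_mem _ (Submodule.add_mem _ (Submodule.add_mem _ (S.W2_le_W1 hw) hp.2)
        (S.GW_le_W1 hq))
    obtain ⟨y, hy, w', hw', rfl⟩ := Submodule.mem_sup.1 hr.2
    -- Since `r` and `w'` lie in W₋₁, so does their difference `y`; this improves membership in conj
    -- F⁰ to membership in `GW`.
    have hy1 : y ∈ S.GW := by
      refine ⟨hy, conj_mem_complexify ?_⟩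
      have := Submodule.sub_mem _ hr1 (S.W2_le_W1 hw')
      rwa [add_sub_cancel_right] at this
    exact eq_zero_of_mem_F0_of_mem_W2 hr.1
      (mem_W2_of_mem (Submodule.mem_sup_left ⟨hr.1, hr1⟩) (Submodule.add_mem_sup hy1 hw'))
  subst hr0
  rw [add_zero] at h
  have hp0 : p = 0 := by
    refine eq_zero_of_mem_F0_of_mem_W2 hp.1 (mem_W2_of_mem (Submodule.mem_sup_left hp) ?_)
    have h' : p = -q + -w := by
      rw [← sub_eq_zero, ← h]; abel
    rw [h']
    exact Submodule.add_mem_sup (Submodule.neg_mem _ hq) (Submodule.neg_mem _ hw)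
  subst hp0
  rw [add_zero] at h
  have hq0 : conj A q = 0 := by
    refine eq_zero_of_mem_F0_of_mem_W2 hq.1 (conj_mem_complexify ?_)
    rw [eq_neg_of_add_eq_zero_right h]
    exact Submodule.neg_mem _ hw
  have hq0' : q = 0 := by rw [← conj_conj q, hq0, map_zero]
  subst hq0'
  rw [add_zero] at h
  exact ⟨h, rfl, rfl, rfl⟩

end LevelOneMHS

open LevelOneMHS

variable {S : LevelOneMHS A} {T : LevelOneMHS B} {f : A →+ B}

namespace IsMHSHom

theorem mapC_W2 (hf : IsMHSHom S T f) {x : ℂ ⊗[ℤ] A} (hx : x ∈ S.W2) : mapC f x ∈ T.W2 :=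
  mapC_mem_complexify hf.Wm2 hx

theorem mapC_W1 (hf : IsMHSHom S T f) {x : ℂ ⊗[ℤ] A} (hx : x ∈ S.W1) : mapC f x ∈ T.W1 :=
  mapC_mem_complexify hf.Wm1 hx

theorem mapC_FW (hf : IsMHSHom S T f) {x : ℂ ⊗[ℤ] A} (hx : x ∈ S.FW) : mapC f x ∈ T.FW :=
  ⟨hf.F0 x hx.1, hf.mapC_W1 hx.2⟩

theorem mapC_GW (hf : IsMHSHom S T f) {x : ℂ ⊗[ℤ] A} (hx : x ∈ S.GW) : mapC f x ∈ T.GW := by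
  rw [mem_conjSubmodule, conj_mapC]
  exact hf.mapC_FW hx

theorem mapC_I00 (hf : IsMHSHom S T f) {x : ℂ ⊗[ℤ] A} (hx : x ∈ S.I00) : mapC f x ∈ T.I00 := by
  refine ⟨hf.F0 x hx.1, ?_⟩
  obtain ⟨y, hy, w, hw, rfl⟩ := Submodule.mem_sup.1 hx.2
  rw [map_add]
  refine Submodule.add_mem_sup ?_ (hf.mapC_W2 hw)
  rw [mem_conjSubmodule, conj_mapC]
  exact hf.F0 _ hy

/-- Strictness for F⁰. The image of a split vector is split, and an element of F⁰ has only `FW` and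
`I00` components; by uniqueness the W₋₂ and `GW` components of `x` map to zero and can be dropped.
The two weight statements follow in the same way. -/
theorem exists_mem_F0_map_eq (hf : IsMHSHom S T f) {x : ℂ ⊗[ℤ] A} (hx : mapC f x ∈ T.F0) :
    ∃ y ∈ S.F0, mapC f y = mapC f x := by
  obtain ⟨w, hw, p, hp, q, hq, r, hr, rfl⟩ := exists_split (S := S) x
  obtain ⟨p', hp', r', hr', h⟩ := exists_split_of_mem_F0 hx
  obtain ⟨h1, -, h3, -⟩ := eq_zero_of_split (hf.mapC_W2 hw)
    (Submodule.sub_mem _ (hf.mapC_FW hp) hp') (hf.mapC_GW hq)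
    (Submodule.sub_mem _ (hf.mapC_I00 hr) hr') (by
      rw [← sub_eq_zero] at h
      rw [← h]; simp only [map_add]; abel)
  exact ⟨p + r, S.F0.add_mem hp.1 hr.1, by simp only [map_add, h1, h3]; abel⟩

theorem exists_mem_W1_map_eq (hf : IsMHSHom S T f) {x : ℂ ⊗[ℤ] A} (hx : mapC f x ∈ T.W1) :
    ∃ y ∈ S.W1, mapC f y = mapC f x := by
  obtain ⟨w, hw, p, hp, q, hq, r, hr, rfl⟩ := exists_split (S := S) x
  obtain ⟨w', hw', p', hp', q', hq', h⟩ := exists_split_of_mem_W1 hx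
  obtain ⟨-, -, -, h4⟩ := eq_zero_of_split (Submodule.sub_mem _ (hf.mapC_W2 hw) hw')
    (Submodule.sub_mem _ (hf.mapC_FW hp) hp') (Submodule.sub_mem _ (hf.mapC_GW hq) hq')
    (hf.mapC_I00 hr) (by
      rw [← sub_eq_zero] at h
      rw [← h]; simp only [map_add]; abel)
  exact ⟨w + p + q, Submodule.add_mem _ (Submodule.add_mem _ (S.W2_le_W1 hw) hp.2)
    (S.GW_le_W1 hq), by simp only [map_add, h4, add_zero]⟩

theorem exists_mem_W2_map_eq (hf : IsMHSHom S T f) {x : ℂ ⊗[ℤ] A} (hx : mapC f x ∈ T.W2) :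
    ∃ y ∈ S.W2, mapC f y = mapC f x := by
  obtain ⟨w, hw, p, hp, q, hq, r, hr, rfl⟩ := exists_split (S := S) x
  obtain ⟨-, h2, h3, h4⟩ := eq_zero_of_split
    (Submodule.sub_mem _ (hf.mapC_W2 hw) hx) (hf.mapC_FW hp) (hf.mapC_GW hq)
    (hf.mapC_I00 hr) (by simp only [map_add]; abel)
  exact ⟨w, hw, by simp only [map_add, h2, h3, h4, add_zero]⟩

/-- A bijective morphism of mixed Hodge structures is an isomorphism. -/
theorem of_rightInverse (hf : IsMHSHom S T f) (hinj : Function.Injective f) {g : B →+ A}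
    (hg : Function.RightInverse g f) : IsMHSHom T S g := by
  have hQ : ∀ x, mapQ f (mapQ g x) = x := fun x => by
    have h : f.comp g = AddMonoidHom.id B := AddMonoidHom.ext hg
    rw [← LinearMap.comp_apply, ← mapQ_comp, h, mapQ_id]; rfl
  have hC : ∀ x, mapC f (mapC g x) = x := fun x => by
    have h : f.comp g = AddMonoidHom.id B := AddMonoidHom.ext hg
    rw [← LinearMap.comp_apply, ← mapC_comp, h, mapC_id]; rfl
  refine ⟨fun x hx => ?_, fun x hx => ?_, fun x hx => ?_⟩
  · obtain ⟨y, hy, h⟩ := hf.exists_mem_W2_map_eq (x := ratC A (mapQ g x)) (by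
      rw [mapC_ratC, hQ]; exact ratC_mem_complexify hx)
    rwa [mapC_injective hinj h, ratC_mem_complexify_iff] at hy
  · obtain ⟨y, hy, h⟩ := hf.exists_mem_W1_map_eq (x := ratC A (mapQ g x)) (by
      rw [mapC_ratC, hQ]; exact ratC_mem_complexify hx)
    rwa [mapC_injective hinj h, ratC_mem_complexify_iff] at hy
  · obtain ⟨y, hy, h⟩ := hf.exists_mem_F0_map_eq (x := mapC g x) (by rw [hC]; exact hx)
    rwa [mapC_injective hinj h] at hy

end IsMHSHom

/-! ### Subobjects, quotients and products of mixed Hodge structures -/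

/-- A complex subspace compatible with the Deligne splitting. -/
def LevelOneMHS.Graded (S : LevelOneMHS A) (N : Submodule ℂ (ℂ ⊗[ℤ] A)) : Prop :=
  ∀ ⦃w⦄, w ∈ S.W2 → ∀ ⦃p⦄, p ∈ S.FW → ∀ ⦃q⦄, q ∈ S.GW → ∀ ⦃r⦄, r ∈ S.I00 →
    w + p + q + r ∈ N → w ∈ N ∧ p ∈ N ∧ q ∈ N ∧ r ∈ N

/-- A morphism acts separately on the four summands, so a vector is killed exactly when all its
components are. Gradedness is the only property of kernels and images used to induce a mixed Hodge
structure. -/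
theorem IsMHSHom.graded_ker (hf : IsMHSHom S T f) : S.Graded (LinearMap.ker (mapC f)) := by
  intro w hw p hp q hq r hr h
  rw [LinearMap.mem_ker, map_add, map_add, map_add] at h
  exact eq_zero_of_split (hf.mapC_W2 hw) (hf.mapC_FW hp) (hf.mapC_GW hq) (hf.mapC_I00 hr) h

theorem IsMHSHom.graded_range (hf : IsMHSHom S T f) :
    T.Graded (LinearMap.range (mapC f)) := by
  rintro w hw p hp q hq r hr ⟨x, hx⟩
  obtain ⟨w', hw', p', hp', q', hq', r', hr', rfl⟩ := exists_split (S := S) x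
  obtain ⟨h1, h2, h3, h4⟩ := eq_zero_of_split
    (Submodule.sub_mem _ (hf.mapC_W2 hw') hw) (Submodule.sub_mem _ (hf.mapC_FW hp') hp)
    (Submodule.sub_mem _ (hf.mapC_GW hq') hq) (Submodule.sub_mem _ (hf.mapC_I00 hr') hr) (by
      rw [← sub_eq_zero] at hx
      rw [← hx]; simp only [map_add]; abel)
  exact ⟨⟨w', sub_eq_zero.1 h1⟩, ⟨p', sub_eq_zero.1 h2⟩, ⟨q', sub_eq_zero.1 h3⟩,
    ⟨r', sub_eq_zero.1 h4⟩⟩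

theorem complexify_comap_mapQ (i : K →+ A) (W : Submodule ℚ (ℚ ⊗[ℤ] A)) :
    complexify (W.comap (mapQ i)) = (complexify W).comap (mapC i) := by
  rw [complexify_comap, extC_mapQ]

theorem complexify_map_mapQ (q : A →+ Q) (W : Submodule ℚ (ℚ ⊗[ℤ] A)) :
    complexify (W.map (mapQ q)) = (complexify W).map (mapC q) := by
  rw [complexify_map, extC_mapQ]

/-- The mixed Hodge structure induced on a subgroup whose complexification is graded. -/
def LevelOneMHS.sub (S : LevelOneMHS A) (i : K →+ A) (hi : Function.Injective i)
    (hN : S.Graded (LinearMap.range (mapC i))) : LevelOneMHS K where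
  Wm2 := S.Wm2.comap (mapQ i)
  Wm1 := S.Wm1.comap (mapQ i)
  F0 := S.F0.comap (mapC i)
  Wm2_le := Submodule.comap_mono S.Wm2_le
  gr_m2 := by
    rw [complexify_comap_mapQ, eq_bot_iff]
    rintro x ⟨hx, hx'⟩
    exact mapC_injective hi ((eq_zero_of_mem_F0_of_mem_W2 hx hx').trans (map_zero _).symm)
  gr_m1_sup := by
    rw [complexify_comap_mapQ, complexify_comap_mapQ]
    refine le_antisymm (sup_le (sup_le inf_le_right fun x hx => ?_)
      (Submodule.comap_mono S.W2_le_W1)) fun x hx => ?_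
    · have h := hx.2
      change mapC i (conj K x) ∈ S.W1 at h
      rw [← conj_mapC] at h
      have h2 := conj_mem_complexify h
      rwa [conj_conj] at h2
    · obtain ⟨w, hw, p, hp, q, hq, h⟩ := exists_split_of_mem_W1 (S := S) hx
      -- Gradedness of the image of `i` puts each component back in the subgroup's complexification,
      -- so the ambient splitting restricts.
      obtain ⟨⟨w, rfl⟩, ⟨p, rfl⟩, ⟨q, rfl⟩, -⟩ := hN hw hp hq (Submodule.zero_mem _)
        (by rw [add_zero, ← h]; exact ⟨x, rfl⟩)
      have hx' : x = p + q + w := mapC_injective hi (by rw [h]; simp only [map_add]; abel)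
      rw [hx']
      refine Submodule.add_mem_sup (Submodule.add_mem_sup hp ?_) hw
      rw [mem_conjSubmodule, conj_mapC] at hq
      exact hq
  gr_m1_inf := by
    rw [complexify_comap_mapQ, complexify_comap_mapQ]
    refine le_antisymm ?_ (le_inf le_sup_right le_sup_right)
    rintro x ⟨hx, hx'⟩
    refine mem_W2_of_mem ?_ ?_
    · obtain ⟨a, ha, b, hb, rfl⟩ := Submodule.mem_sup.1 hx
      rw [map_add]
      exact Submodule.add_mem_sup ha hb
    · obtain ⟨a, ha, b, hb, rfl⟩ := Submodule.mem_sup.1 hx'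
      rw [map_add]
      refine Submodule.add_mem_sup ?_ hb
      rw [mem_conjSubmodule, conj_mapC]
      exact ha
  gr_0 := by
    rw [complexify_comap_mapQ, eq_top_iff]
    rintro x -
    obtain ⟨w, hw, p, hp, q, hq, r, hr, h⟩ := exists_split (S := S) (mapC i x)
    obtain ⟨⟨w, rfl⟩, ⟨p, rfl⟩, ⟨q, rfl⟩, ⟨r, rfl⟩⟩ := hN hw hp hq hr
      (by rw [← h]; exact ⟨x, rfl⟩)
    have hx' : x = (p + r) + (w + q) := mapC_injective hi (by rw [h]; simp only [map_add]; abel)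
    rw [hx']
    refine Submodule.add_mem_sup (Submodule.add_mem _ hp.1 hr.1)
      (Submodule.add_mem _ (S.W2_le_W1 hw) (S.GW_le_W1 hq))
  polarizable := by
    rw [complexify_comap_mapQ, complexify_comap_mapQ]
    obtain ⟨ψ, h1, h2, h3, h4, h5⟩ := S.polarizable
    refine ⟨ψ.compl₁₂ (mapC i) (mapC i), fun a b => h1 (i a) (i b), fun x hx => h2 _ hx,
      fun x hx y hy => h3 _ hx _ hy, fun x hx y hy => h4 _ hx _ hy, fun x hx hx0 => ?_⟩
    have h := h5 _ hx fun h => hx0 (mapC_injective hi (h.trans (map_zero _).symm))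
    rw [conj_mapC] at h
    exact h

/-! ### Polarizations on quotients -/

theorem exists_sub_orthogonal {F V : Type*} [Field F] [AddCommGroup V] [Module F V]
    (β : V →ₗ[F] V →ₗ[F] F) (U : Submodule F V) [FiniteDimensional F U] (b : V)
    (h : ∀ u ∈ U, (∀ u' ∈ U, β u' u = 0) → β b u = 0) :
    ∃ u ∈ U, ∀ u' ∈ U, β (b - u) u' = 0 := by
  let βU : U →ₗ[F] Module.Dual F U := β.compl₁₂ U.subtype U.subtype
  -- In finite dimension the range of U → U* is the annihilator of its coannihilator, here the
  -- radical of β on `U`, which β(`b`, ·) kills by hypothesis.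
  have hb : (β b).comp U.subtype ∈ LinearMap.range βU := by
    rw [← Subspace.dualCoannihilator_dualAnnihilator_eq (W := LinearMap.range βU),
      Submodule.mem_dualAnnihilator]
    intro u hu
    refine h u u.2 fun u' hu' => ?_
    rw [Submodule.mem_dualCoannihilator] at hu
    exact hu _ ⟨⟨u', hu'⟩, rfl⟩
  obtain ⟨u, hu⟩ := hb
  refine ⟨u, u.2, fun u' hu' => ?_⟩
  rw [map_sub, LinearMap.sub_apply, sub_eq_zero]
  exact (LinearMap.congr_fun hu ⟨u', hu'⟩).symm

/-- The orthogonal complement and the section used for a quotient must be chosen over ℚ, because the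
new form again has to be rational on the lattice. -/
theorem exists_rat_form (ψ : (ℂ ⊗[ℤ] A) →ₗ[ℂ] (ℂ ⊗[ℤ] A) →ₗ[ℂ] ℂ)
    (h : ∀ a b : A, ∃ q : ℚ, ψ (1 ⊗ₜ a) (1 ⊗ₜ b) = (q : ℂ)) :
    ∃ β : (ℚ ⊗[ℤ] A) →ₗ[ℚ] (ℚ ⊗[ℤ] A) →ₗ[ℚ] ℚ,
      ∀ x y, ψ (ratC A x) (ratC A y) = (β x y : ℂ) := by
  have h' : ∀ x y, ∃ q : ℚ, ψ (ratC A x) (ratC A y) = (q : ℂ) := by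
    intro x y
    induction x with
    | zero => exact ⟨0, by simp⟩
    | tmul r a =>
      induction y with
      | zero => exact ⟨0, by simp⟩
      | tmul r' b =>
        obtain ⟨q, hq⟩ := h a b
        refine ⟨r * (r' * q), ?_⟩
        rw [ratC_tmul, ratC_tmul, map_smul, map_smul, LinearMap.smul_apply, hq]
        simp
        ring
      | add y y' hy hy' =>
        obtain ⟨q, hq⟩ := hy
        obtain ⟨q', hq'⟩ := hy'
        exact ⟨q + q', by rw [map_add, map_add, hq, hq', Rat.cast_add]⟩
    | add x x' hx hx' =>
      obtain ⟨q, hq⟩ := hx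
      obtain ⟨q', hq'⟩ := hx'
      exact ⟨q + q', by rw [map_add, map_add, LinearMap.add_apply, hq, hq', Rat.cast_add]⟩
  choose β hβ using h'
  have inj := Rat.cast_injective (α := ℂ)
  refine ⟨LinearMap.mk₂ ℚ β ?_ ?_ ?_ ?_, hβ⟩
  · intro x x' y
    apply inj
    rw [Rat.cast_add, ← hβ, ← hβ, ← hβ, map_add, map_add, LinearMap.add_apply]
  · intro c x y
    apply inj
    rw [smul_eq_mul, Rat.cast_mul, ← hβ, ← hβ, ratC_smul, map_smul, LinearMap.smul_apply,
      smul_eq_mul]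
  · intro x y y'
    apply inj
    rw [Rat.cast_add, ← hβ, ← hβ, ← hβ, map_add, map_add]
  · intro c x y
    apply inj
    rw [smul_eq_mul, Rat.cast_mul, ← hβ, ← hβ, ratC_smul, map_smul, smul_eq_mul]

/-- An element in the images of both F⁰ and W₋₁ has two lifts that differ by an element of the
kernel. Gradedness puts the `I00` component of the F⁰ lift in the kernel, and discarding it leaves a
lift in `FW`. -/
theorem exists_mem_FW_map_eq {q : A →+ Q} (hN : S.Graded (LinearMap.ker (mapC q)))
    {x : ℂ ⊗[ℤ] Q} (hx : x ∈ S.F0.map (mapC q) ⊓ S.W1.map (mapC q)) :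
    ∃ p ∈ S.FW, mapC q p = x := by
  obtain ⟨⟨y, hy, rfl⟩, z, hz, hzy⟩ := hx
  obtain ⟨p, hp, r, hr, rfl⟩ := exists_split_of_mem_F0 hy
  obtain ⟨w, hw, p', hp', q', hq', rfl⟩ := exists_split_of_mem_W1 hz
  obtain ⟨-, -, -, h⟩ := hN (Submodule.neg_mem _ hw) (Submodule.sub_mem _ hp hp')
    (Submodule.neg_mem _ hq') hr (by
      rw [LinearMap.mem_ker]
      rw [← sub_eq_zero] at hzy
      rw [← neg_eq_zero, ← hzy]
      simp only [map_add, map_sub, map_neg]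
      abel)
  exact ⟨p, hp, by rw [map_add, LinearMap.mem_ker.1 h, add_zero]⟩

/-- Let U be the part of the kernel in W₋₁ and P its ψ-orthogonal in W₋₁. Positivity forces the
radical of ψ on U into W₋₂, so W₋₁ = U + P, and the quotient map has a rational section over the
image of W₋₁ with values in P. The form on the quotient is ψ evaluated on this section; modulo W₋₂,
on which ψ vanishes, the section respects F⁰. -/
theorem polarizable_map [Module.Finite ℤ A] (S : LevelOneMHS A) {q : A →+ Q}
    (hN : S.Graded (LinearMap.ker (mapC q))) :
    ∃ ψ : (ℂ ⊗[ℤ] Q) →ₗ[ℂ] (ℂ ⊗[ℤ] Q) →ₗ[ℂ] ℂ,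
      (∀ a b : Q, ∃ q : ℚ, ψ (1 ⊗ₜ a) (1 ⊗ₜ b) = (q : ℂ)) ∧
      (∀ x ∈ S.W1.map (mapC q), ψ x x = 0) ∧
      (∀ x ∈ S.W2.map (mapC q), ∀ y ∈ S.W1.map (mapC q), ψ x y = 0) ∧
      (∀ x ∈ S.F0.map (mapC q) ⊓ S.W1.map (mapC q),
        ∀ y ∈ S.F0.map (mapC q) ⊓ S.W1.map (mapC q), ψ x y = 0) ∧
      (∀ x ∈ S.F0.map (mapC q) ⊓ S.W1.map (mapC q), x ≠ 0 →
        0 < (Complex.I * ψ x (conj Q x)).re) := by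
  obtain ⟨ψ, h1, h2, h3, h4, h5⟩ := S.polarizable
  obtain ⟨β, hβ⟩ := exists_rat_form ψ h1
  have hskew : ∀ x ∈ S.W1, ∀ y ∈ S.W1, ψ x y = -ψ y x := fun x hx y hy => by
    have h := h2 _ (Submodule.add_mem _ hx hy)
    simp only [map_add, LinearMap.add_apply, h2 x hx, h2 y hy] at h
    linear_combination h
  have h3' : ∀ x ∈ S.W1, ∀ y ∈ S.W2, ψ x y = 0 := fun x hx y hy => by
    rw [hskew x hx y (S.W2_le_W1 hy), h3 y hy x hx, neg_zero]
  -- Positivity on `FW`, transported to `GW` by conjugation and skew-symmetry.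
  have hGW : ∀ z ∈ S.GW, ψ z (conj A z) = 0 → z = 0 := fun z hz h => by
    by_contra hz0
    have hz' : conj A z ≠ 0 := fun h' => hz0 (by rw [← conj_conj z, h', map_zero])
    have h6 := h5 _ hz hz'
    rw [conj_conj, hskew _ hz.2 _ (S.GW_le_W1 hz), h] at h6
    simp at h6
  let U : Submodule ℚ (ℚ ⊗[ℤ] A) := LinearMap.ker (mapQ q) ⊓ S.Wm1
  have hU : complexify U = LinearMap.ker (mapC q) ⊓ S.W1 := by
    rw [complexify_inf, complexify_ker, extC_mapQ]
  have hNc : ∀ x ∈ LinearMap.ker (mapC q), conj A x ∈ LinearMap.ker (mapC q) := fun x hx => by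
    rw [LinearMap.mem_ker, ← conj_mapC, LinearMap.mem_ker.1 hx, map_zero]
  have hrad : ∀ u ∈ U, (∀ u' ∈ U, β u u' = 0) → u ∈ S.Wm2 := by
    intro u hu hu'
    have hu1 : ratC A u ∈ LinearMap.ker (mapC q) ⊓ S.W1 := by
      rw [← hU]; exact ratC_mem_complexify hu
    have hu2 : ∀ y ∈ LinearMap.ker (mapC q) ⊓ S.W1, ψ (ratC A u) y = 0 := by
      rw [← hU]
      refine complexify_le (P := LinearMap.ker (ψ (ratC A u))) fun y hy => ?_
      rw [LinearMap.mem_ker, hβ, hu' y hy, Rat.cast_zero]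
    obtain ⟨w, hw, p, hp, z, hz, h⟩ := exists_split_of_mem_W1 hu1.2
    have hg := hN hw hp hz (Submodule.zero_mem _) (by rw [add_zero, ← h]; exact hu1.1)
    -- Pairing with conj `z`, which lies in the complexification of `U`, leaves only ψ(`z`, conj
    -- `z`): W₋₂ is in the radical and `FW` is isotropic.
    have hz0 : z = 0 := by
      refine hGW z hz ?_
      have h6 := hu2 (conj A z) ⟨hNc _ hg.2.2.1, hz.2⟩
      rw [h] at h6
      simpa only [map_add, LinearMap.add_apply, h3 w hw _ hz.2, h4 p hp _ hz, zero_add] using h6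
    rw [hz0, add_zero] at h
    have hp0 : p = 0 := by
      refine eq_zero_of_mem_F0_of_mem_W2 hp.1 (mem_W2_of_mem (Submodule.mem_sup_left hp) ?_)
      -- The vector `u` is rational, hence fixed by conjugation; comparing `w` + `p` with its
      -- conjugate puts `p` in `GW` + W₋₂.
      have h7 : p = conj A p + (conj A w - w) := by
        have h8 := conj_ratC u
        rw [h, map_add] at h8
        rw [← sub_eq_zero] at h8
        rw [← sub_eq_zero, ← neg_eq_zero, ← h8]
        abel
      rw [h7]
      exact Submodule.add_mem_sup (conj_mem_conjSubmodule hp)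
        (Submodule.sub_mem _ (conj_mem_complexify hw) hw)
    rw [hp0, add_zero] at h
    rw [← ratC_mem_complexify_iff, h]
    exact hw
  let P : Submodule ℚ (ℚ ⊗[ℤ] A) :=
    { carrier := {b | b ∈ S.Wm1 ∧ ∀ u ∈ U, β b u = 0}
      add_mem' := fun {x y} hx hy => ⟨Submodule.add_mem _ hx.1 hy.1, fun u hu => by
        rw [map_add, LinearMap.add_apply, hx.2 u hu, hy.2 u hu, add_zero]⟩
      zero_mem' := ⟨Submodule.zero_mem _, fun u _ => by rw [map_zero]; rfl⟩
      smul_mem' := fun c x hx => ⟨Submodule.smul_mem _ _ hx.1, fun u hu => by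
        rw [map_smul, LinearMap.smul_apply, hx.2 u hu, smul_zero]⟩ }
  have hPU : ∀ b ∈ S.Wm1, ∃ u ∈ U, b - u ∈ P := by
    intro b hb
    obtain ⟨u, hu, hu'⟩ := exists_sub_orthogonal β U b (fun u hu h => by
      have hinj := Rat.cast_injective (α := ℂ)
      have hu2 : u ∈ S.Wm2 := hrad u hu fun u' hu' => by
        apply hinj
        rw [← hβ, hskew _ (ratC_mem_complexify hu.2) _ (ratC_mem_complexify hu'.2), hβ, h u' hu']
        simp
      apply hinj
      rw [← hβ, h3' _ (ratC_mem_complexify hb) _ (ratC_mem_complexify hu2), Rat.cast_zero])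
    exact ⟨u, hu, Submodule.sub_mem _ hb hu.2, hu'⟩
  obtain ⟨N, hNinv⟩ := exists_generalizedInverse ((mapQ q).comp P.subtype)
  let s : (ℚ ⊗[ℤ] Q) →ₗ[ℚ] (ℚ ⊗[ℤ] A) := P.subtype.comp N
  have hsP : ∀ x, s x ∈ P := fun x => (N x).2
  have hqs : ∀ b ∈ S.Wm1, mapQ q (s (mapQ q b)) = mapQ q b := by
    intro b hb
    obtain ⟨u, hu, hbu⟩ := hPU b hb
    have h : mapQ q b = mapQ q (b - u) := by
      rw [map_sub, LinearMap.mem_ker.1 hu.1, sub_zero]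
    rw [h]
    exact hNinv ⟨b - u, hbu⟩
  have hsW2 : ∀ b ∈ S.Wm2, s (mapQ q b) ∈ S.Wm2 := by
    intro b hb
    have hb1 := S.Wm2_le hb
    have hd : s (mapQ q b) - b ∈ U :=
      ⟨LinearMap.mem_ker.2 (by rw [map_sub, hqs b hb1, sub_self]),
        Submodule.sub_mem _ (hsP _).1 hb1⟩
    -- The difference lies in `U` and is orthogonal to `U`: the section takes values in `P`, and `b`
    -- ∈ W₋₂ pairs to zero with W₋₁.
    have hd2 : s (mapQ q b) - b ∈ S.Wm2 := hrad _ hd fun u hu => by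
      have h : β b u = 0 := by
        apply Rat.cast_injective (α := ℂ)
        rw [← hβ, h3 _ (ratC_mem_complexify hb) _ (ratC_mem_complexify hu.2), Rat.cast_zero]
      rw [map_sub, LinearMap.sub_apply, (hsP _).2 u hu, h, sub_zero]
    have := Submodule.add_mem _ hd2 hb
    rwa [sub_add_cancel] at this
  have hPC : ∀ y ∈ complexify P, y ∈ S.W1 ∧ ∀ u ∈ LinearMap.ker (mapC q) ⊓ S.W1, ψ y u = 0 := by
    intro y hy
    refine ⟨complexify_mono (fun x (hx : x ∈ P) => hx.1) hy, fun u hu => ?_⟩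
    rw [← hU] at hu
    refine complexify_le (P := LinearMap.ker (ψ.flip u)) (fun b hb => ?_) hy
    change ψ (ratC A b) u = 0
    refine complexify_le (P := LinearMap.ker (ψ (ratC A b))) (fun u hu => ?_) hu
    rw [LinearMap.mem_ker, hβ, hb.2 u hu, Rat.cast_zero]
  have hsC : ∀ x, extC s x ∈ complexify P := fun x => by
    have h : LinearMap.range (extC s) ≤ complexify P := by
      rw [← Submodule.map_top, ← complexify_top, ← complexify_map]
      exact complexify_mono (by rintro _ ⟨x, -, rfl⟩; exact hsP x)
    exact h ⟨x, rfl⟩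
  have hqsC : ∀ y ∈ S.W1, mapC q (extC s (mapC q y)) = mapC q y := fun y hy => by
    have h : S.W1 ≤ LinearMap.ker ((mapC q).comp ((extC s).comp (mapC q)) - mapC q) :=
      complexify_le fun b hb => by
        rw [LinearMap.mem_ker, LinearMap.sub_apply, LinearMap.comp_apply, LinearMap.comp_apply,
          mapC_ratC, extC_ratC, mapC_ratC, hqs b hb, sub_self]
    exact sub_eq_zero.1 (h hy)
  have hsFW : ∀ x ∈ S.F0.map (mapC q) ⊓ S.W1.map (mapC q),
      ∃ p ∈ S.FW, ∃ w ∈ S.W2, extC s x = p + w := by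
    intro x hx
    obtain ⟨p, hp, rfl⟩ := exists_mem_FW_map_eq hN hx
    have hn : p - extC s (mapC q p) ∈ LinearMap.ker (mapC q) ⊓ S.W1 :=
      ⟨LinearMap.mem_ker.2 (by rw [map_sub, hqsC p hp.2, sub_self]),
        Submodule.sub_mem _ hp.2 (hPC _ (hsC _)).1⟩
    obtain ⟨w, hw, p', hp', z, hz, h⟩ := exists_split_of_mem_W1 hn.2
    have hg := hN hw hp' hz (Submodule.zero_mem _) (by rw [add_zero, ← h]; exact hn.1)
    have hs : extC s (mapC q p) = p - (w + p' + z) := by rw [← h]; abel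
    have hz0 : z = 0 := by
      refine hGW z hz ?_
      -- The section is orthogonal to the kernel in W₋₁, which contains conj `z`. Expanding leaves
      -- only ψ(`z`, conj `z`), so the correction to `p` has no `GW` component.
      have h6 := (hPC _ (hsC (mapC q p))).2 (conj A z) ⟨hNc _ hg.2.2.1, hz.2⟩
      rw [hs] at h6
      simpa only [map_add, map_sub, LinearMap.sub_apply, LinearMap.add_apply, h3 w hw _ hz.2,
        h4 p' hp' _ hz, h4 p hp _ hz, zero_add, zero_sub, neg_eq_zero] using h6
    refine ⟨p - p', Submodule.sub_mem _ hp hp', -w, Submodule.neg_mem _ hw, ?_⟩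
    rw [hs, hz0]
    abel
  refine ⟨ψ.compl₁₂ (extC s) (extC s), fun a b => ?_, fun x _ => h2 _ (hPC _ (hsC x)).1,
    ?_, fun x hx y hy => ?_, fun x hx hx0 => ?_⟩
  · refine ⟨β (s (1 ⊗ₜ a)) (s (1 ⊗ₜ b)), ?_⟩
    rw [LinearMap.compl₁₂_apply, ← ratC_one_tmul a, ← ratC_one_tmul b, extC_ratC, extC_ratC, hβ]
  · rintro x hx y -
    refine h3 _ ?_ _ (hPC _ (hsC y)).1
    rw [← complexify_map_mapQ] at hx
    refine complexify_le (P := S.W2.comap (extC s)) ?_ hx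
    rintro _ ⟨b, hb, rfl⟩
    rw [Submodule.mem_comap, extC_ratC]
    exact ratC_mem_complexify (hsW2 b hb)
  · obtain ⟨p, hp, w, hw, h⟩ := hsFW x hx
    obtain ⟨p', hp', w', hw', h'⟩ := hsFW y hy
    rw [LinearMap.compl₁₂_apply, h, h']
    simp only [map_add, LinearMap.add_apply, h4 p hp p' hp', h3 w hw p' hp'.2, h3' p hp.2 w' hw',
      h3 w hw w' (S.W2_le_W1 hw'), add_zero]
  · obtain ⟨p, hp, w, hw, h⟩ := hsFW x hx
    have hw' := conj_mem_complexify hw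
    have hp' : conj A p ∈ S.W1 := conj_mem_complexify hp.2
    have hp0 : p ≠ 0 := by
      rintro rfl
      rw [zero_add] at h
      obtain ⟨y, hy, rfl⟩ := exists_mem_FW_map_eq hN hx
      have h6 := hqsC y hy.2
      rw [h] at h6
      have hg := hN (Submodule.neg_mem _ hw) hy (Submodule.zero_mem _) (Submodule.zero_mem _) (by
        rw [LinearMap.mem_ker, add_zero, add_zero, map_add, map_neg, h6, neg_add_cancel])
      exact hx0 hg.2.1
    have h7 := h5 p hp hp0
    rw [LinearMap.compl₁₂_apply, ← conj_extC, h]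
    simpa only [map_add, LinearMap.add_apply, h3 w hw _ hp', h3' p hp.2 _ hw',
      h3 w hw _ (S.W2_le_W1 hw'), add_zero] using h7

/-- The mixed Hodge structure induced on a quotient by a subgroup whose complexification is
graded. -/
def LevelOneMHS.quot [Module.Finite ℤ A] (S : LevelOneMHS A) (q : A →+ Q)
    (hq : Function.Surjective q) (hN : S.Graded (LinearMap.ker (mapC q))) : LevelOneMHS Q where
  Wm2 := S.Wm2.map (mapQ q)
  Wm1 := S.Wm1.map (mapQ q)
  F0 := S.F0.map (mapC q)
  Wm2_le := Submodule.map_mono S.Wm2_le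
  gr_m2 := by
    rw [complexify_map_mapQ, eq_bot_iff]
    rintro x ⟨⟨y, hy, rfl⟩, w, hw, h⟩
    obtain ⟨p, hp, r, hr, rfl⟩ := exists_split_of_mem_F0 hy
    -- The lifts in F⁰ and W₋₂ differ by a kernel element having −`w` as its W₋₂ component, so
    -- gradedness kills the image of `w`.
    obtain ⟨h', -, -, -⟩ := hN (Submodule.neg_mem _ hw) hp (Submodule.zero_mem _) hr (by
      rw [← sub_eq_zero] at h
      rw [LinearMap.mem_ker, ← neg_eq_zero, ← h]
      simp only [map_add, map_neg, map_zero]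
      abel)
    rw [LinearMap.mem_ker, map_neg, neg_eq_zero, h] at h'
    exact h'
  gr_m1_sup := by
    rw [complexify_map_mapQ, complexify_map_mapQ]
    refine le_antisymm (sup_le (sup_le inf_le_right fun x hx => ?_)
      (Submodule.map_mono S.W2_le_W1)) ?_
    · have h := hx.2
      rw [← complexify_map_mapQ] at h ⊢
      have h2 := conj_mem_complexify h
      rwa [conj_conj] at h2
    · rintro _ ⟨x, hx, rfl⟩
      obtain ⟨w, hw, p, hp, z, hz, rfl⟩ := exists_split_of_mem_W1 (S := S) hx
      have h : mapC q (w + p + z) = mapC q p + mapC q z + mapC q w := by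
        simp only [map_add]; abel
      rw [h]
      refine Submodule.add_mem_sup (Submodule.add_mem_sup ⟨⟨p, hp.1, rfl⟩, p, hp.2, rfl⟩ ?_)
        ⟨w, hw, rfl⟩
      rw [mem_conjSubmodule, conj_mapC]
      exact ⟨⟨_, hz.1, rfl⟩, _, hz.2, rfl⟩
  gr_m1_inf := by
    rw [complexify_map_mapQ, complexify_map_mapQ]
    refine le_antisymm ?_ (le_inf le_sup_right le_sup_right)
    rintro x ⟨hx, hx'⟩
    obtain ⟨a, ha, _, ⟨w, hw, rfl⟩, rfl⟩ := Submodule.mem_sup.1 hx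
    obtain ⟨b, hb, _, ⟨w', hw', rfl⟩, h⟩ := Submodule.mem_sup.1 hx'
    obtain ⟨p, hp, rfl⟩ := exists_mem_FW_map_eq hN ha
    obtain ⟨p', hp', hpb⟩ := exists_mem_FW_map_eq hN (mem_conjSubmodule.1 hb)
    -- Both descriptions of `x` are lifted: their difference is a kernel element with components in
    -- W₋₂, `FW` and `GW`, and its `FW` component `p` must die.
    have hb' : b = mapC q (conj A p') := by rw [← conj_mapC, hpb, conj_conj]
    have hg := hN (Submodule.sub_mem _ hw hw') hp
      (Submodule.neg_mem _ (conj_mem_conjSubmodule hp')) (Submodule.zero_mem _) (by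
        rw [hb', ← sub_eq_zero] at h
        rw [LinearMap.mem_ker, ← neg_eq_zero, ← h]
        simp only [map_add, map_sub, map_neg, map_zero]
        abel)
    rw [LinearMap.mem_ker.1 hg.2.1, zero_add]
    exact ⟨w, hw, rfl⟩
  gr_0 := by
    rw [complexify_map_mapQ, ← Submodule.map_sup, S.gr_0, Submodule.map_top,
      LinearMap.range_eq_top]
    exact mapC_surjective hq
  polarizable := by
    rw [complexify_map_mapQ, complexify_map_mapQ]
    exact polarizable_map S hN

/-! ### Products of mixed Hodge structures -/

/-- The subspace of `(A × B)_ℂ` given by subspaces of `A_ℂ` and `B_ℂ`. -/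
def prodC (P : Submodule ℂ (ℂ ⊗[ℤ] A)) (P' : Submodule ℂ (ℂ ⊗[ℤ] B)) :
    Submodule ℂ (ℂ ⊗[ℤ] (A × B)) :=
  P.comap (mapC (AddMonoidHom.fst A B)) ⊓ P'.comap (mapC (AddMonoidHom.snd A B))

theorem mapC_inl_add_mapC_inr (x : ℂ ⊗[ℤ] (A × B)) :
    mapC (AddMonoidHom.inl A B) (mapC (AddMonoidHom.fst A B) x) +
      mapC (AddMonoidHom.inr A B) (mapC (AddMonoidHom.snd A B) x) = x := by
  induction x with
  | zero => simp
  | tmul z a =>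
    change z ⊗ₜ[ℤ] (a.1, (0 : B)) + z ⊗ₜ[ℤ] ((0 : A), a.2) = z ⊗ₜ[ℤ] a
    rw [← TensorProduct.tmul_add]
    simp
  | add x y hx hy =>
    nth_rw 3 [← hx, ← hy]
    simp only [map_add]
    abel

theorem mapC_zero : mapC (0 : A →+ B) = 0 := by
  ext a
  exact TensorProduct.tmul_zero _ _

theorem mapC_fst_inl_add_inr (x : ℂ ⊗[ℤ] A) (y : ℂ ⊗[ℤ] B) :
    mapC (AddMonoidHom.fst A B) (mapC (AddMonoidHom.inl A B) x + mapC (AddMonoidHom.inr A B) y)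
      = x := by
  rw [map_add, ← LinearMap.comp_apply, ← LinearMap.comp_apply, ← mapC_comp, ← mapC_comp,
    AddMonoidHom.fst_comp_inl, AddMonoidHom.fst_comp_inr, mapC_id]
  rw [mapC_zero, LinearMap.zero_apply, add_zero, LinearMap.id_apply]

theorem mapC_snd_inl_add_inr (x : ℂ ⊗[ℤ] A) (y : ℂ ⊗[ℤ] B) :
    mapC (AddMonoidHom.snd A B) (mapC (AddMonoidHom.inl A B) x + mapC (AddMonoidHom.inr A B) y)
      = y := by
  rw [map_add, ← LinearMap.comp_apply, ← LinearMap.comp_apply, ← mapC_comp, ← mapC_comp,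
    AddMonoidHom.snd_comp_inl, AddMonoidHom.snd_comp_inr, mapC_id]
  rw [mapC_zero, LinearMap.zero_apply, zero_add, LinearMap.id_apply]

theorem prodC_sup (P P₁ : Submodule ℂ (ℂ ⊗[ℤ] A)) (P' P₁' : Submodule ℂ (ℂ ⊗[ℤ] B)) :
    prodC (P ⊔ P₁) (P' ⊔ P₁') = prodC P P' ⊔ prodC P₁ P₁' := by
  refine le_antisymm ?_ (sup_le (inf_le_inf (Submodule.comap_mono le_sup_left)
    (Submodule.comap_mono le_sup_left)) (inf_le_inf (Submodule.comap_mono le_sup_right)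
    (Submodule.comap_mono le_sup_right)))
  rintro x ⟨hx, hx'⟩
  obtain ⟨a, ha, b, hb, h⟩ := Submodule.mem_sup.1 hx
  obtain ⟨a', ha', b', hb', h'⟩ := Submodule.mem_sup.1 hx'
  rw [Submodule.mem_sup]
  refine ⟨mapC (AddMonoidHom.inl A B) a + mapC (AddMonoidHom.inr A B) a', ⟨?_, ?_⟩,
    mapC (AddMonoidHom.inl A B) b + mapC (AddMonoidHom.inr A B) b', ⟨?_, ?_⟩, ?_⟩
  · rwa [SetLike.mem_coe, Submodule.mem_comap, mapC_fst_inl_add_inr]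
  · rwa [SetLike.mem_coe, Submodule.mem_comap, mapC_snd_inl_add_inr]
  · rwa [SetLike.mem_coe, Submodule.mem_comap, mapC_fst_inl_add_inr]
  · rwa [SetLike.mem_coe, Submodule.mem_comap, mapC_snd_inl_add_inr]
  · rw [← mapC_inl_add_mapC_inr x, ← h, ← h']
    simp only [map_add]
    abel

theorem prodC_inf (P P₁ : Submodule ℂ (ℂ ⊗[ℤ] A)) (P' P₁' : Submodule ℂ (ℂ ⊗[ℤ] B)) :
    prodC (P ⊓ P₁) (P' ⊓ P₁') = prodC P P' ⊓ prodC P₁ P₁' := by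
  simp only [prodC, Submodule.comap_inf]
  exact inf_inf_inf_comm _ _ _ _

theorem conjSubmodule_prodC (P : Submodule ℂ (ℂ ⊗[ℤ] A)) (P' : Submodule ℂ (ℂ ⊗[ℤ] B)) :
    conjSubmodule (prodC P P') = prodC (conjSubmodule P) (conjSubmodule P') := by
  ext x
  change mapC _ (conj _ x) ∈ P ∧ mapC _ (conj _ x) ∈ P' ↔
    conj _ (mapC _ x) ∈ P ∧ conj _ (mapC _ x) ∈ P'
  rw [conj_mapC, conj_mapC]

theorem prodC_bot : prodC (⊥ : Submodule ℂ (ℂ ⊗[ℤ] A)) (⊥ : Submodule ℂ (ℂ ⊗[ℤ] B)) = ⊥ := by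
  rw [eq_bot_iff]
  rintro x ⟨hx, hx'⟩
  rw [SetLike.mem_coe, Submodule.mem_comap, Submodule.mem_bot] at hx hx'
  rw [Submodule.mem_bot, ← mapC_inl_add_mapC_inr x, hx, hx', map_zero, map_zero, add_zero]

theorem prodC_top : prodC (⊤ : Submodule ℂ (ℂ ⊗[ℤ] A)) (⊤ : Submodule ℂ (ℂ ⊗[ℤ] B)) = ⊤ := by
  simp [prodC]

/-- The product of two mixed Hodge structures. -/
def LevelOneMHS.prod (S : LevelOneMHS A) (T : LevelOneMHS B) : LevelOneMHS (A × B) :=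
  have h2 : complexify (S.Wm2.comap (mapQ (AddMonoidHom.fst A B)) ⊓
      T.Wm2.comap (mapQ (AddMonoidHom.snd A B))) = prodC S.W2 T.W2 := by
    rw [complexify_inf, complexify_comap_mapQ, complexify_comap_mapQ]; rfl
  have h1 : complexify (S.Wm1.comap (mapQ (AddMonoidHom.fst A B)) ⊓
      T.Wm1.comap (mapQ (AddMonoidHom.snd A B))) = prodC S.W1 T.W1 := by
    rw [complexify_inf, complexify_comap_mapQ, complexify_comap_mapQ]; rfl
  { Wm2 := S.Wm2.comap (mapQ (AddMonoidHom.fst A B)) ⊓ T.Wm2.comap (mapQ (AddMonoidHom.snd A B))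
    Wm1 := S.Wm1.comap (mapQ (AddMonoidHom.fst A B)) ⊓ T.Wm1.comap (mapQ (AddMonoidHom.snd A B))
    F0 := prodC S.F0 T.F0
    Wm2_le := inf_le_inf (Submodule.comap_mono S.Wm2_le) (Submodule.comap_mono T.Wm2_le)
    gr_m2 := by rw [h2, ← prodC_inf, S.gr_m2, T.gr_m2, prodC_bot]
    gr_m1_sup := by
      rw [h1, h2, ← prodC_inf, conjSubmodule_prodC, ← prodC_sup, ← prodC_sup, S.gr_m1_sup,
        T.gr_m1_sup]
    gr_m1_inf := by
      rw [h1, h2, ← prodC_inf, conjSubmodule_prodC, ← prodC_sup, ← prodC_sup, ← prodC_inf,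
        S.gr_m1_inf, T.gr_m1_inf]
    gr_0 := by rw [h1, ← prodC_sup, S.gr_0, T.gr_0, prodC_top]
    polarizable := by
      rw [h1, h2, ← prodC_inf]
      obtain ⟨ψ, a1, a2, a3, a4, a5⟩ := S.polarizable
      obtain ⟨φ, b1, b2, b3, b4, b5⟩ := T.polarizable
      refine ⟨ψ.compl₁₂ (mapC (AddMonoidHom.fst A B)) (mapC (AddMonoidHom.fst A B)) +
        φ.compl₁₂ (mapC (AddMonoidHom.snd A B)) (mapC (AddMonoidHom.snd A B)), fun a b => ?_,
        fun x hx => ?_, fun x hx y hy => ?_, fun x hx y hy => ?_, fun x hx hx0 => ?_⟩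
      · obtain ⟨q, hq⟩ := a1 a.1 b.1
        obtain ⟨r, hr⟩ := b1 a.2 b.2
        refine ⟨q + r, ?_⟩
        rw [Rat.cast_add, ← hq, ← hr]
        rfl
      · simp only [LinearMap.add_apply, LinearMap.compl₁₂_apply, a2 _ hx.1, b2 _ hx.2, add_zero]
      · simp only [LinearMap.add_apply, LinearMap.compl₁₂_apply, a3 _ hx.1 _ hy.1,
          b3 _ hx.2 _ hy.2, add_zero]
      · simp only [LinearMap.add_apply, LinearMap.compl₁₂_apply, a4 _ hx.1 _ hy.1,
          b4 _ hx.2 _ hy.2, add_zero]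
      · simp only [LinearMap.add_apply, LinearMap.compl₁₂_apply, ← conj_mapC, mul_add,
          Complex.add_re]
        -- Each form is positive only on nonzero vectors, and one of the two projections of a
        -- nonzero `x` may vanish.
        by_cases h : mapC (AddMonoidHom.fst A B) x = 0
        · have h' : mapC (AddMonoidHom.snd A B) x ≠ 0 := fun h' => hx0 (by
            rw [← mapC_inl_add_mapC_inr x, h, h', map_zero, map_zero, add_zero])
          rw [h]
          simpa using b5 _ hx.2 h'
        · refine add_pos_of_pos_of_nonneg (a5 _ hx.1 h) ?_
          by_cases h' : mapC (AddMonoidHom.snd A B) x = 0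
          · rw [h']; simp
          · exact (b5 _ hx.2 h').le }

end Splitting

/-! ### Endomorphisms of the formal additive group -/

section TruncatedPolynomials

open Polynomial

/-- The algebra `ℂ[ε] / ε ^ (n + 1)` of truncated polynomials. -/
abbrev Trunc (n : ℕ) : Type := AdjoinRoot (X ^ (n + 1) : ℂ[X])

namespace Trunc

/-- The generator of the algebra of truncated polynomials. -/
abbrev ε (n : ℕ) : Trunc n := AdjoinRoot.root _

theorem ε_pow (n : ℕ) : ε n ^ (n + 1) = 0 := by
  rw [ε, ← AdjoinRoot.mk_X, ← map_pow, AdjoinRoot.mk_self]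

theorem mk_eq_iff {n : ℕ} {p q : ℂ[X]} :
    (AdjoinRoot.mk (X ^ (n + 1)) p : Trunc n) = AdjoinRoot.mk _ q ↔
      ∀ d ≤ n, p.coeff d = q.coeff d := by
  rw [AdjoinRoot.mk_eq_mk, X_pow_dvd_iff]
  refine forall_congr' fun d => ?_
  rw [coeff_sub, sub_eq_zero, Nat.lt_succ_iff]

instance (n : ℕ) : Nontrivial (Trunc n) := by
  refine ⟨1, 0, fun h => ?_⟩
  rw [← map_one (AdjoinRoot.mk _), ← map_zero (AdjoinRoot.mk _), mk_eq_iff] at h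
  simpa using h 0 (Nat.zero_le _)

theorem ε_one_ne_zero : ε 1 ≠ 0 := by
  intro h
  rw [ε, ← AdjoinRoot.mk_X, ← map_zero (AdjoinRoot.mk _), mk_eq_iff] at h
  simpa using h 1 le_rfl

instance (n : ℕ) : IsLocalRing (Trunc n) := by
  refine IsLocalRing.of_isUnit_or_isUnit_one_sub_self fun a => ?_
  obtain ⟨p, rfl⟩ := AdjoinRoot.mk_surjective a
  have hnil : IsNilpotent (AdjoinRoot.mk (X ^ (n + 1)) (X * p.divX)) := by
    refine ⟨n + 1, ?_⟩
    rw [map_mul, mul_pow, AdjoinRoot.mk_X, ε_pow, zero_mul]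
  have hp : AdjoinRoot.mk (X ^ (n + 1)) p =
      AdjoinRoot.mk (X ^ (n + 1)) (C (p.coeff 0)) + AdjoinRoot.mk (X ^ (n + 1)) (X * p.divX) := by
    rw [← map_add, add_comm (C _), X_mul_divX_add]
  by_cases h : p.coeff 0 = 0
  · right
    rw [hp, h, map_zero, map_zero, zero_add]
    exact hnil.isUnit_one_sub
  · left
    rw [hp]
    refine hnil.isUnit_add_left_of_commute ?_ (Commute.all _ _)
    exact ((isUnit_C.2 (isUnit_iff_ne_zero.2 h)).map _)

instance (n : ℕ) : Module.Finite ℂ (Trunc n) := (monic_X_pow (n + 1)).finite_adjoinRoot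

/-- The truncated polynomials as a local Artinian algebra. -/
def art (n : ℕ) : ArtAlg where
  obj := CommAlgCat.of ℂ (Trunc n)
  property := ⟨inferInstanceAs (IsLocalRing (Trunc n)), inferInstanceAs (Module.Finite ℂ (Trunc n))⟩

/-- The generator as a nilpotent element. -/
def εNil (n : ℕ) : nilradical (art n).obj := ⟨ε n, mem_nilradical.2 ⟨n + 1, ε_pow n⟩⟩

/-- The homomorphism `ε ↦ x`. -/
def hom {R : ArtAlg} (n : ℕ) (x : R.obj) (hx : x ^ (n + 1) = 0) : art n ⟶ R :=
  ObjectProperty.homMk (CommAlgCat.ofHom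
    (AdjoinRoot.liftAlgHom (X ^ (n + 1)) (Algebra.ofId ℂ R.obj) x (by simp [hx])))

theorem hom_mk {R : ArtAlg} (n : ℕ) (x : R.obj) (hx : x ^ (n + 1) = 0) (p : ℂ[X]) :
    ArtAlg.alg (hom n x hx) (AdjoinRoot.mk (X ^ (n + 1)) p : Trunc n) = aeval x p := rfl

theorem hom_ε {R : ArtAlg} (n : ℕ) (x : R.obj) (hx : x ^ (n + 1) = 0) :
    ArtAlg.alg (hom n x hx) (ε n : Trunc n) = x := by
  rw [ε, ← AdjoinRoot.mk_X, hom_mk, aeval_X]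

end Trunc

/-- Natural additive endomorphisms of the nilradical functor are scalar. -/
theorem exists_scalar (ψ : ∀ R : ArtAlg, nilradical R.obj →+ nilradical R.obj)
    (hψ : ∀ {R S : ArtAlg} (φ : R ⟶ S) (x : nilradical R.obj) (y : nilradical S.obj),
      ArtAlg.alg φ x.1 = y.1 → ArtAlg.alg φ (ψ R x).1 = (ψ S y).1) :
    ∃ c : ℂ, ∀ (R : ArtAlg) (x : nilradical R.obj), (ψ R x).1 = c • x.1 := by
  have h1 : ∀ n, ∃ c : ℂ, (ψ (Trunc.art n) (Trunc.εNil n)).1 = c • (Trunc.εNil n).1 := by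
    intro n
    obtain ⟨p, hp⟩ := AdjoinRoot.mk_surjective (g := X ^ (n + 1))
      ((ψ (Trunc.art n) (Trunc.εNil n)).1 : Trunc n)
    refine ⟨p.coeff 1, ?_⟩
    have hx : (((2 : ℂ) • Trunc.ε n : Trunc n)) ^ (n + 1) = 0 := by
      rw [_root_.smul_pow, Trunc.ε_pow, smul_zero]
    -- Naturality along ε ↦ 2ε together with additivity gives p(2ε) = 2p(ε). Comparing coefficients,
    -- (2^d − 2)p_d = 0, so in characteristic zero only the linear term survives.
    have h2 := hψ (Trunc.hom (R := Trunc.art n) n ((2 : ℂ) • Trunc.ε n : Trunc n) hx) (Trunc.εNil n)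
      (Trunc.εNil n + Trunc.εNil n) (by
        refine (Trunc.hom_ε n _ hx).trans ?_
        exact two_smul ℂ (Trunc.ε n))
    rw [map_add] at h2
    change _ = (ψ (Trunc.art n) (Trunc.εNil n)).1 + (ψ (Trunc.art n) (Trunc.εNil n)).1 at h2
    have h3 : aeval ((2 : ℂ) • Trunc.ε n : Trunc n) p =
        AdjoinRoot.mk (X ^ (n + 1)) p + AdjoinRoot.mk (X ^ (n + 1)) p := by
      rw [hp]
      refine Eq.trans ?_ h2
      rw [← hp]
      rfl
    have h4 : aeval ((2 : ℂ) • Trunc.ε n : Trunc n) p =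
        AdjoinRoot.mk (X ^ (n + 1)) (p.comp (C 2 * X)) := by
      rw [← AdjoinRoot.aeval_eq, aeval_comp, map_mul, aeval_X, aeval_C, Algebra.smul_def]
    rw [h4, ← map_add, Trunc.mk_eq_iff] at h3
    have h5 : AdjoinRoot.mk (X ^ (n + 1)) p =
        (AdjoinRoot.mk (X ^ (n + 1)) (C (p.coeff 1) * X) : Trunc n) := by
      rw [Trunc.mk_eq_iff]
      intro d hd
      have h6 := h3 d hd
      rw [comp_C_mul_X_coeff, coeff_add] at h6
      rw [coeff_C_mul_X]
      split_ifs with hd1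
      · rw [hd1]
      · have h7 : ((2 : ℂ) ^ d - 2) ≠ 0 := by
          intro h7
          have h8 : (2 : ℂ) ^ d = 2 ^ 1 := by rw [pow_one]; exact sub_eq_zero.1 h7
          have h9 : (2 : ℕ) ^ d = 2 ^ 1 := by exact_mod_cast h8
          exact hd1 (Nat.pow_right_injective le_rfl h9)
        have h8 : p.coeff d * ((2 : ℂ) ^ d - 2) = 0 := by linear_combination h6
        exact (mul_eq_zero.1 h8).resolve_right h7
    rw [hp, map_mul, AdjoinRoot.mk_X] at h5
    rw [Algebra.smul_def]
    exact h5
  choose c hc using h1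
  have h2 : ∀ n, ∀ (R : ArtAlg) (x : nilradical R.obj), x.1 ^ (n + 1) = 0 →
      (ψ R x).1 = c n • x.1 := by
    intro n R x hx
    rw [← hψ (Trunc.hom n x.1 hx) (Trunc.εNil n) x (Trunc.hom_ε n x.1 hx), hc, map_smul]
    congr 1
    exact Trunc.hom_ε n x.1 hx
  refine ⟨c 1, fun R x => ?_⟩
  obtain ⟨m, hm⟩ := mem_nilradical.1 x.2
  -- The scalar does not depend on the truncation order, as seen on ε with ε² = 0. The index `m + 1`
  -- ensures that `m + 1 + 1` is at least 2 even when `m` is zero.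
  have h3 : (c (m + 1) - c 1) • Trunc.ε 1 = 0 := by
    rw [sub_smul, sub_eq_zero]
    refine (h2 (m + 1) (Trunc.art 1) (Trunc.εNil 1) ?_).symm.trans (hc 1)
    exact pow_eq_zero_of_le (by omega) (Trunc.ε_pow 1)
  rw [h2 (m + 1) R x (pow_eq_zero_of_le (by omega) hm),
    sub_eq_zero.1 ((smul_eq_zero.1 h3).resolve_right Trunc.ε_one_ne_zero)]

end TruncatedPolynomials

/-! ### Points of formal groups -/

namespace ArtAlg

/-- If φ and χ differ at `x`, set `y` = `x` − φ(`x`) and `w` = χ(`y`) ≠ 0. In the local ring, `y` or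
`w` − `y` is a unit, but φ kills the first and χ the second. -/
theorem hom_pt_ext {R : ArtAlg} (φ χ : R ⟶ pt) : φ = χ := by
  have := R.property.1
  apply ObjectProperty.hom_ext
  apply CommAlgCat.hom_ext
  apply AlgHom.ext
  intro x
  change alg φ x = alg χ x
  let z : ℂ := alg φ x
  have h1 : ∀ c : ℂ, alg χ (algebraMap ℂ R.obj c) = c := fun c => (alg χ).commutes c
  have h1' : ∀ c : ℂ, alg φ (algebraMap ℂ R.obj c) = c := fun c => (alg φ).commutes c
  let y : R.obj := x - algebraMap ℂ R.obj z
  have hy : alg φ y = 0 := by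
    rw [map_sub, h1']; exact sub_self z
  by_contra hne
  have hy' : alg χ y ≠ 0 := by
    rw [map_sub, h1]
    exact fun h => hne (sub_eq_zero.1 h).symm
  let w : ℂ := alg χ y
  have hu : IsUnit (y + (algebraMap ℂ R.obj w - y)) := by
    rw [add_sub_cancel]
    exact (isUnit_iff_ne_zero.2 hy').map (algebraMap ℂ R.obj)
  rcases IsLocalRing.isUnit_or_isUnit_of_isUnit_add hu with h | h
  · have h2 := h.map (alg φ)
    rw [hy] at h2
    exact not_isUnit_zero (M₀ := ℂ) h2
  · have h2 := h.map (alg χ)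
    rw [map_sub, h1] at h2
    have h3 : (show ℂ from w) - (show ℂ from alg χ y) = 0 := sub_self w
    exact not_isUnit_zero (M₀ := ℂ) (h3 ▸ h2)

/-- The structure map `ℂ → R`. -/
def unit (R : ArtAlg) : pt ⟶ R :=
  ObjectProperty.homMk (CommAlgCat.ofHom (Algebra.ofId ℂ R.obj))

theorem hom_ext_of_pt {R : ArtAlg} (φ χ : pt ⟶ R) : φ = χ := by
  apply ObjectProperty.hom_ext
  apply CommAlgCat.hom_ext
  exact Subsingleton.elim (α := ℂ →ₐ[ℂ] R.obj) _ _

end ArtAlg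

section Points

variable {G G' : GroupFunctor} (f : G ⟶ G')

theorem naturality_apply {R S : ArtAlg} (φ : R ⟶ S) (x : G.obj R) :
    (f.app S).hom ((G.map φ).hom x) = (G'.map φ).hom ((f.app R).hom x) :=
  ConcreteCategory.congr_hom (f.naturality φ) x

theorem map_map_apply (G : GroupFunctor) {R S T : ArtAlg} (φ : R ⟶ S) (χ : S ⟶ T) (x : G.obj R) :
    (G.map χ).hom ((G.map φ).hom x) = (G.map (φ ≫ χ)).hom x := by
  rw [G.map_comp]; rfl

theorem map_id_apply (G : GroupFunctor) {R : ArtAlg} (x : G.obj R) :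
    (G.map (𝟙 R)).hom x = x := by
  rw [G.map_id]; rfl

theorem map_pt_unit (G : GroupFunctor) {R : ArtAlg} (φ : R ⟶ pt) (x : G.obj pt) :
    (G.map φ).hom ((G.map (ArtAlg.unit R)).hom x) = x := by
  rw [map_map_apply, ArtAlg.hom_pt_ext (ArtAlg.unit R ≫ φ) (𝟙 pt), map_id_apply]

theorem mem_connectedSubgroup_iff {R : ArtAlg} (φ : R ⟶ pt) {x : G.obj R} :
    x ∈ connectedSubgroup G R ↔ (G.map φ).hom x = 0 :=
  mem_connectedSubgroup.trans
    ⟨fun h => h φ, fun h χ => by rw [ArtAlg.hom_pt_ext χ φ]; exact h⟩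

/-- This is the splitting of `G` into its connected part and the constant group of ℂ-points:
subtracting the constant point with the same specialisation leaves a connected point. -/
theorem sub_unit_mem_connectedSubgroup {R : ArtAlg} (φ : R ⟶ pt) (x : G.obj R) :
    x - (G.map (ArtAlg.unit R)).hom ((G.map φ).hom x) ∈ connectedSubgroup G R := by
  rw [mem_connectedSubgroup_iff φ, map_sub, map_pt_unit, sub_self]

theorem connectedSubgroup_formalAdditive (s : ℕ) (R : ArtAlg) :
    connectedSubgroup (formalAdditive s) R = ⊤ := by
  rw [eq_top_iff]
  intro x _
  rw [mem_connectedSubgroup]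
  intro φ
  funext i
  have h := (((formalAdditive s).map φ).hom x i).2
  have h' : IsNilpotent (R := ℂ) _ := mem_nilradical.1 h
  exact Subtype.ext h'.eq_zero

theorem app_mem_connectedSubgroup {s : ℕ} (η : formalAdditive s ⟶ G) {R : ArtAlg}
    (x : (formalAdditive s).obj R) : (η.app R).hom x ∈ connectedSubgroup G R :=
  natTrans_mem_connectedSubgroup η (by rw [connectedSubgroup_formalAdditive]; trivial)

end Points

/-! ### Homomorphisms of formal additive groups are given by matrices -/

/-- The homomorphism of formal additive groups given by a matrix. -/
def formalMap {s t : ℕ} (M : Matrix (Fin t) (Fin s) ℂ) : formalAdditive s ⟶ formalAdditive t where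
  app R := AddCommGrpCat.ofHom
    { toFun := fun (x : Fin s → nilradical R.obj) i => ∑ j, M i j • x j
      map_zero' := by ext i; simp
      map_add' := fun x y => by
        funext i
        simp only [Pi.add_apply, smul_add, Finset.sum_add_distrib] }
  naturality R S φ := by
    ext x
    funext i
    apply Subtype.ext
    change ((∑ j, M i j • _ : nilradical S.obj) : S.obj) =
      ArtAlg.alg φ ((∑ j, M i j • x j : nilradical R.obj) : R.obj)
    simp only [Submodule.coe_sum, Submodule.coe_smul_of_tower, map_sum, map_smul]
    rfl

theorem formalMap_mul {s t u : ℕ} (M : Matrix (Fin u) (Fin t) ℂ) (N : Matrix (Fin t) (Fin s) ℂ)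
    {R : ArtAlg} (x : (formalAdditive s).obj R) :
    ((formalMap (M * N)).app R).hom x =
      ((formalMap M).app R).hom (((formalMap N).app R).hom x) := by
  change Fin s → nilradical R.obj at x
  funext i
  change ∑ k, (M * N) i k • x k = ∑ j, M i j • ∑ k, N j k • x k
  simp only [Matrix.mul_apply, Finset.sum_smul, Finset.smul_sum, mul_smul]
  exact Finset.sum_comm

theorem formalMap_one {s : ℕ} {R : ArtAlg} (x : (formalAdditive s).obj R) :
    ((formalMap (1 : Matrix (Fin s) (Fin s) ℂ)).app R).hom x = x := by
  change Fin s → nilradical R.obj at x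
  funext i
  change ∑ k, (1 : Matrix (Fin s) (Fin s) ℂ) i k • x k = x i
  simp [Matrix.one_apply]

theorem formalMap_zero {s t : ℕ} {R : ArtAlg} (x : (formalAdditive s).obj R) :
    ((formalMap (0 : Matrix (Fin t) (Fin s) ℂ)).app R).hom x = 0 := by
  change Fin s → nilradical R.obj at x
  funext i
  change ∑ k, (0 : Matrix (Fin t) (Fin s) ℂ) i k • x k = 0
  simp

theorem formalMap_sub {s t : ℕ} (M N : Matrix (Fin t) (Fin s) ℂ) {R : ArtAlg}
    (x : (formalAdditive s).obj R) :
    ((formalMap (M - N)).app R).hom x =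
      ((formalMap M).app R).hom x - ((formalMap N).app R).hom x := by
  change Fin s → nilradical R.obj at x
  funext i
  change ∑ k, (M - N) i k • x k = ∑ k, M i k • x k - ∑ k, N i k • x k
  simp [sub_smul]

/-- Each entry, obtained by including one coordinate and projecting to another, is a natural
additive endomorphism of the nilradical, hence a scalar. -/
theorem exists_eq_formalMap {s t : ℕ} (φ : formalAdditive s ⟶ formalAdditive t) :
    ∃ M, φ = formalMap M := by
  have h : ∀ (i : Fin t) (j : Fin s), ∃ c : ℂ, ∀ (R : ArtAlg) (x : nilradical R.obj),
      ((φ.app R).hom (Pi.single j x : Fin s → nilradical R.obj) : Fin t → nilradical R.obj) i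
        = c • x := by
    intro i j
    obtain ⟨c, hc⟩ := exists_scalar (fun R =>
      ((Pi.evalAddMonoidHom (fun _ : Fin t => nilradical R.obj) i).comp (φ.app R).hom).comp
        (AddMonoidHom.single (fun _ : Fin s => nilradical R.obj) j)) (by
      intro R S χ x y hxy
      have hy : ((formalAdditive s).map χ).hom (Pi.single j x : Fin s → nilradical R.obj) =
          (Pi.single j y : Fin s → nilradical S.obj) := by
        funext k
        apply Subtype.ext
        change ArtAlg.alg χ ((Pi.single j x : Fin s → nilradical R.obj) k).1 = _
        by_cases hk : k = j
        · subst hk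
          rw [Pi.single_eq_same, Pi.single_eq_same, hxy]
        · rw [Pi.single_eq_of_ne hk, Pi.single_eq_of_ne hk]
          exact map_zero _
      have h := naturality_apply φ χ (Pi.single j x : Fin s → nilradical R.obj)
      rw [hy] at h
      exact congrArg Subtype.val (congrFun h i).symm)
    exact ⟨c, fun R x => Subtype.ext (hc R x)⟩
  choose M hM using h
  refine ⟨Matrix.of M, ?_⟩
  ext R x
  change Fin s → nilradical R.obj at x
  funext i
  have hx : x = ∑ j, Pi.single j (x j) := (Finset.univ_sum_single x).symm
  change ((φ.app R).hom x : Fin t → nilradical R.obj) i = ∑ j, M i j • x j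
  conv_lhs => rw [hx]
  have h2 : (φ.app R).hom (∑ j, Pi.single j (x j) : Fin s → nilradical R.obj) =
      ∑ j, (φ.app R).hom (Pi.single j (x j) : Fin s → nilradical R.obj) := map_sum _ _ _
  have h3 := congrFun h2 i
  refine h3.trans ?_
  refine (Finset.sum_apply i Finset.univ
    (fun j => ((φ.app R).hom (Pi.single j (x j) : Fin s → nilradical R.obj) :
      Fin t → nilradical R.obj))).trans ?_
  exact Finset.sum_congr rfl fun j _ => hM i j R (x j)

/-- Choosing a basis of the range identifies the image of an idempotent with ℂ^k, and so the
corresponding summand of a formal additive group with a smaller power. -/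
theorem exists_split_idempotent {s : ℕ} (E : Matrix (Fin s) (Fin s) ℂ) (hE : E * E = E) :
    ∃ (k : ℕ) (i : Matrix (Fin s) (Fin k) ℂ) (r : Matrix (Fin k) (Fin s) ℂ),
      r * i = 1 ∧ i * r = E := by
  let g := Matrix.toLin' E
  have hg : ∀ x, g (g x) = g x := fun x => by
    rw [← LinearMap.comp_apply, ← Matrix.toLin'_mul, hE]
  let b := (Module.finBasis ℂ (LinearMap.range g)).equivFun
  refine ⟨_, LinearMap.toMatrix' ((LinearMap.range g).subtype.comp b.symm.toLinearMap),
    LinearMap.toMatrix' (b.toLinearMap.comp g.rangeRestrict), ?_, ?_⟩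
  · rw [← LinearMap.toMatrix'_comp, ← LinearMap.toMatrix'_id]
    congr 1
    refine LinearMap.ext fun y => ?_
    change b (g.rangeRestrict (b.symm y).1) = y
    have h : g.rangeRestrict (b.symm y).1 = b.symm y := by
      apply Subtype.ext
      obtain ⟨x, hx⟩ := (b.symm y).2
      change g (b.symm y).1 = (b.symm y).1
      rw [← hx, hg]
    rw [h, LinearEquiv.apply_symm_apply]
  · rw [← LinearMap.toMatrix'_comp]
    have h : ((LinearMap.range g).subtype.comp b.symm.toLinearMap).comp
        (b.toLinearMap.comp g.rangeRestrict) = g := by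
      refine LinearMap.ext fun x => ?_
      change (b.symm (b (g.rangeRestrict x))).1 = g x
      rw [LinearEquiv.symm_apply_apply]; rfl
    rw [h, LinearMap.toMatrix'_toLin']

theorem exists_matrix_generalizedInverse {s t : ℕ} (M : Matrix (Fin t) (Fin s) ℂ) :
    ∃ N : Matrix (Fin s) (Fin t) ℂ, M * N * M = M := by
  obtain ⟨N, hN⟩ := exists_generalizedInverse (Matrix.toLin' M)
  refine ⟨LinearMap.toMatrix' N, ?_⟩
  apply Matrix.toLin'.injective
  refine LinearMap.ext fun x => ?_
  rw [Matrix.toLin'_mul, Matrix.toLin'_mul, Matrix.toLin'_toMatrix']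
  exact hN x

/-! ### Kernels, cokernels and products of formal groups -/

namespace IsFormalGroup

variable {G G' : GroupFunctor}

/-- A formal additive group is connected, so `η` automatically lands in the connected part;
pointwise bijectivity onto it suffices. In this form no category of formal groups is needed. -/
theorem of_formalAdditive (fg : Module.Finite ℤ (G.obj pt)) {s : ℕ} (η : formalAdditive s ⟶ G)
    (hinj : ∀ R, Function.Injective (η.app R).hom)
    (hsurj : ∀ R, ∀ x ∈ connectedSubgroup G R, ∃ y, (η.app R).hom y = x) : IsFormalGroup G where
  fg := fg
  connected := by
    let η' : formalAdditive s ⟶ connectedPart G :=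
      { app := fun R => AddCommGrpCat.ofHom ((η.app R).hom.codRestrict (connectedSubgroup G R)
          (app_mem_connectedSubgroup η))
        naturality := fun R S φ => by
          ext x
          exact Subtype.ext (naturality_apply η φ x) }
    have : ∀ R, IsIso (η'.app R) := fun R => by
      rw [ConcreteCategory.isIso_iff_bijective]
      refine ⟨fun x y h => hinj R (congrArg Subtype.val h), fun x => ?_⟩
      obtain ⟨y, hy⟩ := hsurj R x.1 x.2
      exact ⟨y, Subtype.ext hy⟩
    have := NatIso.isIso_of_isIso_app η'
    exact ⟨s, ⟨(asIso η').symm⟩⟩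

theorem exists_formalAdditive (h : IsFormalGroup G) : ∃ (s : ℕ) (η : formalAdditive s ⟶ G),
    (∀ R, Function.Injective (η.app R).hom) ∧
    ∀ R, ∀ x ∈ connectedSubgroup G R, ∃ y, (η.app R).hom y = x := by
  obtain ⟨s, ⟨i⟩⟩ := h.connected
  refine ⟨s, i.inv ≫ connectedIncl G, fun R x y hxy => ?_, fun R x hx => ?_⟩
  · have h : (i.inv.app R).hom x = (i.inv.app R).hom y := Subtype.ext hxy
    have h2 := congrArg (i.hom.app R).hom h
    have h3 : ∀ z, (i.hom.app R).hom ((i.inv.app R).hom z) = z := fun z =>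
      ConcreteCategory.congr_hom (i.inv_hom_id_app R) z
    rwa [h3, h3] at h2
  · refine ⟨(i.hom.app R).hom ⟨x, hx⟩, ?_⟩
    exact congrArg Subtype.val (ConcreteCategory.congr_hom (i.hom_inv_id_app R)
      (⟨x, hx⟩ : connectedSubgroup G R))

theorem exists_matrix {s t : ℕ} (η : formalAdditive s ⟶ G) (η' : formalAdditive t ⟶ G')
    (hinj : ∀ R, Function.Injective (η'.app R).hom)
    (hsurj : ∀ R, ∀ x ∈ connectedSubgroup G' R, ∃ y, (η'.app R).hom y = x) (f : G ⟶ G') :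
    ∃ M : Matrix (Fin t) (Fin s) ℂ, ∀ R x, (f.app R).hom ((η.app R).hom x) =
      (η'.app R).hom (((formalMap M).app R).hom x) := by
  have h : ∀ R x, ∃ y, (η'.app R).hom y = (f.app R).hom ((η.app R).hom x) := fun R x =>
    hsurj R _ (natTrans_mem_connectedSubgroup f (app_mem_connectedSubgroup η x))
  choose φ hφ using h
  have h0 : ∀ R, φ R 0 = 0 := fun R => hinj R (by rw [hφ, map_zero, map_zero, map_zero])
  have hadd : ∀ R x y, φ R (x + y) = φ R x + φ R y := fun R x y =>
    hinj R (by rw [hφ, map_add, map_add, map_add, hφ, hφ])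
  let Φ : formalAdditive s ⟶ formalAdditive t :=
    { app := fun R => AddCommGrpCat.ofHom
        { toFun := φ R
          map_zero' := h0 R
          map_add' := hadd R }
      naturality := fun R S χ => by
        ext x
        apply hinj S
        change (η'.app S).hom (φ S (((formalAdditive s).map χ).hom x)) = (η'.app S).hom (((formalAdditive t).map χ).hom (φ R x))
        rw [hφ, naturality_apply, naturality_apply, naturality_apply, hφ] }
  obtain ⟨M, hM⟩ := exists_eq_formalMap Φ
  refine ⟨M, fun R x => ?_⟩
  rw [← hM]
  exact (hφ R x).symm

end IsFormalGroup

section Constructions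

variable {G G' : GroupFunctor} (f : G ⟶ G')

/-- The pointwise kernel of a homomorphism. -/
def kerFunctor : GroupFunctor where
  obj R := AddCommGrpCat.of (f.app R).hom.ker
  map {R S} φ := AddCommGrpCat.ofHom
    (((G.map φ).hom.comp (AddSubgroup.subtype _)).codRestrict _ fun x => by
      rw [AddMonoidHom.mem_ker]
      refine (naturality_apply f φ x.1).trans ?_
      rw [AddMonoidHom.mem_ker.1 x.2, map_zero])
  map_id R := by
    ext x
    exact map_id_apply G x.1
  map_comp φ χ := by
    ext x
    exact (map_map_apply G φ χ x.1).symm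

/-- The inclusion of the kernel. -/
def kerIncl : kerFunctor f ⟶ G where
  app _ := AddCommGrpCat.ofHom (AddSubgroup.subtype _)
  naturality _ _ _ := rfl

/-- The universal property of the kernel. -/
def kerLift {Z : GroupFunctor} (a : Z ⟶ G) (h : a ≫ f = 0) : Z ⟶ kerFunctor f where
  app R := AddCommGrpCat.ofHom ((a.app R).hom.codRestrict _ fun x =>
    ConcreteCategory.congr_hom (NatTrans.congr_app h R) x)
  naturality R S φ := by
    ext x
    exact Subtype.ext (naturality_apply a φ x)

/-- The pointwise cokernel of a homomorphism. -/
def cokerFunctor : GroupFunctor where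
  obj R := AddCommGrpCat.of (G'.obj R ⧸ (f.app R).hom.range)
  map {R S} φ := AddCommGrpCat.ofHom
    (QuotientAddGroup.map _ _ (G'.map φ).hom (by
      rintro _ ⟨x, rfl⟩
      exact ⟨(G.map φ).hom x, naturality_apply f φ x⟩))
  map_id R := by
    ext x
    exact congrArg (QuotientAddGroup.mk' _) (map_id_apply G' x)
  map_comp φ χ := by
    ext x
    exact congrArg (QuotientAddGroup.mk' _) (map_map_apply G' φ χ x).symm

/-- The projection to the cokernel. -/
def cokerProj : G' ⟶ cokerFunctor f where
  app _ := AddCommGrpCat.ofHom (QuotientAddGroup.mk' _)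
  naturality _ _ _ := rfl

theorem comp_cokerProj : f ≫ cokerProj f = 0 := by
  ext R x
  exact (QuotientAddGroup.eq_zero_iff _).2 ⟨x, rfl⟩

theorem kerIncl_comp : kerIncl f ≫ f = 0 := by
  ext R x
  exact x.2

/-- The universal property of the cokernel. -/
def cokerDesc {Z : GroupFunctor} (a : G' ⟶ Z) (h : f ≫ a = 0) : cokerFunctor f ⟶ Z where
  app R := AddCommGrpCat.ofHom (QuotientAddGroup.lift _ (a.app R).hom (by
    rintro _ ⟨x, rfl⟩
    exact ConcreteCategory.congr_hom (NatTrans.congr_app h R) x))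
  naturality R S φ := by
    ext x
    obtain ⟨x, rfl⟩ := QuotientAddGroup.mk'_surjective _ x
    exact naturality_apply a φ x

/-- The product of two group functors. -/
def prodFunctor (G G' : GroupFunctor) : GroupFunctor where
  obj R := AddCommGrpCat.of (G.obj R × G'.obj R)
  map φ := AddCommGrpCat.ofHom ((G.map φ).hom.prodMap (G'.map φ).hom)
  map_id R := by
    refine AddCommGrpCat.hom_ext (AddMonoidHom.ext fun x => ?_)
    exact Prod.ext (map_id_apply G x.1) (map_id_apply G' x.2)
  map_comp φ χ := by
    refine AddCommGrpCat.hom_ext (AddMonoidHom.ext fun x => ?_)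
    exact Prod.ext (map_map_apply G φ χ x.1).symm (map_map_apply G' φ χ x.2).symm

/-! ### Closure of formal groups under kernels, cokernels and products -/

variable {f}

/-- On connected parts `f` is a matrix M. With MNM = M, the idempotent 1 − NM projects onto the
kernel of M, and splitting it parametrizes the connected part of the kernel. -/
theorem isFormalGroup_kerFunctor (hG : IsFormalGroup G) (hG' : IsFormalGroup G') :
    IsFormalGroup (kerFunctor f) := by
  obtain ⟨s, η, hη, hη'⟩ := hG.exists_formalAdditive
  obtain ⟨t, θ, hθ, hθ'⟩ := hG'.exists_formalAdditive
  obtain ⟨M, hM⟩ := IsFormalGroup.exists_matrix η θ hθ hθ' f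
  obtain ⟨N, hN⟩ := exists_matrix_generalizedInverse M
  obtain ⟨k, i, r, hri, hir⟩ := exists_split_idempotent (1 - N * M) (by
    rw [mul_sub, mul_one, sub_mul, one_mul, Matrix.mul_assoc N, ← Matrix.mul_assoc M, hN, sub_self,
      sub_zero])
  have hMi : M * i = 0 := by
    have h : M * (i * r * i) = M * i := by rw [Matrix.mul_assoc, hri, Matrix.mul_one]
    rw [← h, hir, ← Matrix.mul_assoc, Matrix.mul_sub, Matrix.mul_one, ← Matrix.mul_assoc, hN,
      sub_self, Matrix.zero_mul]
  have := hG.fg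
  refine IsFormalGroup.of_formalAdditive ?_
    (kerLift f (formalMap i ≫ η) (by
      ext R x
      change (f.app R).hom ((η.app R).hom (((formalMap i).app R).hom x)) = 0
      rw [hM, ← formalMap_mul, hMi, formalMap_zero, map_zero])) (fun R x y h => ?_)
      (fun R x hx => ?_)
  · exact Module.Finite.of_injective ((f.app pt).hom.ker.subtype.toIntLinearMap)
      (AddSubgroup.subtype_injective _)
  · have h1 : (η.app R).hom (((formalMap i).app R).hom x) =
        (η.app R).hom (((formalMap i).app R).hom y) := congrArg Subtype.val h
    have h2 := congrArg ((formalMap r).app R).hom (hη R h1)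
    rwa [← formalMap_mul, ← formalMap_mul, hri, formalMap_one, formalMap_one] at h2
  · obtain ⟨y, hy⟩ := hη' R _ (natTrans_mem_connectedSubgroup (kerIncl f) hx)
    refine ⟨((formalMap r).app R).hom y, Subtype.ext ?_⟩
    refine Eq.trans ?_ hy
    change (η.app R).hom (((formalMap i).app R).hom (((formalMap r).app R).hom y)) = _
    have h0 : ((formalMap M).app R).hom y = 0 := by
      apply hθ R
      rw [← hM, hy, map_zero]
      exact x.2
    rw [← formalMap_mul, hir, formalMap_sub, formalMap_mul, h0, map_zero, formalMap_one, sub_zero]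

/-- Dually, the idempotent 1 − MN splits off a complement of the image of M. The constant parts must
be removed before the matrix can be used, since a connected point may be the image of a
non-connected one. -/
theorem isFormalGroup_cokerFunctor (hG : IsFormalGroup G) (hG' : IsFormalGroup G') :
    IsFormalGroup (cokerFunctor f) := by
  obtain ⟨s, η, hη, hη'⟩ := hG.exists_formalAdditive
  obtain ⟨t, θ, hθ, hθ'⟩ := hG'.exists_formalAdditive
  obtain ⟨M, hM⟩ := IsFormalGroup.exists_matrix η θ hθ hθ' f
  obtain ⟨N, hN⟩ := exists_matrix_generalizedInverse M
  obtain ⟨k, j, B, hBj, hjB⟩ := exists_split_idempotent (1 - M * N) (by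
    rw [mul_sub, mul_one, sub_mul, one_mul, ← Matrix.mul_assoc, hN, sub_self,
      sub_zero])
  have hBM : B * M = 0 := by
    have h : (B * j * B) * M = B * M := by rw [hBj, Matrix.one_mul]
    rw [← h, Matrix.mul_assoc B, hjB, Matrix.mul_assoc, Matrix.sub_mul, Matrix.one_mul, hN,
      sub_self, Matrix.mul_zero]
  have := hG'.fg
  refine IsFormalGroup.of_formalAdditive ?_ (formalMap j ≫ θ ≫ cokerProj f) (fun R x y h => ?_)
    (fun R x hx => ?_)
  · exact Module.Finite.of_surjective
      ((QuotientAddGroup.mk' (f.app pt).hom.range).toIntLinearMap)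
      (QuotientAddGroup.mk'_surjective _)
  · obtain ⟨φ⟩ := ArtAlg.exists_hom_pt R
    have h1 : QuotientAddGroup.mk' (f.app R).hom.range ((θ.app R).hom
        (((formalMap j).app R).hom (x - y))) = 0 := by
      rw [map_sub, map_sub, map_sub, sub_eq_zero]
      exact h
    obtain ⟨z, hz⟩ := (QuotientAddGroup.eq_zero_iff _).1 h1
    -- The constant part of `z` lies in the kernel of `f`, because the image of `z` is connected;
    -- hence `z` may be replaced by its connected part.
    have h2 : (f.app pt).hom ((G.map φ).hom z) = 0 := by
      rw [naturality_apply, hz]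
      exact mem_connectedSubgroup.1 (app_mem_connectedSubgroup θ _) φ
    obtain ⟨w, hw⟩ := hη' R _ (sub_unit_mem_connectedSubgroup φ z)
    have h3 : (θ.app R).hom (((formalMap M).app R).hom w) =
        (θ.app R).hom (((formalMap j).app R).hom (x - y)) := by
      rw [← hM, hw, map_sub, naturality_apply, h2, map_zero, sub_zero, hz]
    have h4 := congrArg ((formalMap B).app R).hom (hθ R h3)
    rw [← formalMap_mul, ← formalMap_mul, hBM, hBj, formalMap_zero, formalMap_one] at h4
    exact (sub_eq_zero.1 h4.symm)
  · obtain ⟨φ⟩ := ArtAlg.exists_hom_pt R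
    obtain ⟨x, rfl⟩ := QuotientAddGroup.mk'_surjective _ x
    have h1 : QuotientAddGroup.mk' (f.app pt).hom.range ((G'.map φ).hom x) = 0 :=
      mem_connectedSubgroup.1 hx φ
    obtain ⟨z, hz⟩ := (QuotientAddGroup.eq_zero_iff _).1 h1
    obtain ⟨y, hy⟩ := hθ' R _ (sub_unit_mem_connectedSubgroup φ x)
    refine ⟨((formalMap B).app R).hom y, ?_⟩
    change QuotientAddGroup.mk' (f.app R).hom.range
      ((θ.app R).hom (((formalMap j).app R).hom (((formalMap B).app R).hom y))) = _
    rw [← formalMap_mul, hjB, formalMap_sub, formalMap_one, formalMap_mul, map_sub, ← hM, hy, ← hz,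
      ← naturality_apply, ← sub_eq_zero, ← map_sub]
    refine (QuotientAddGroup.eq_zero_iff _).2 ?_
    -- The two terms account for the constant part of `x`, which is in the image because its class
    -- is connected, and for the correction MN`y`.
    refine ⟨-((G.map (ArtAlg.unit R)).hom z) -
      (η.app R).hom (((formalMap N).app R).hom y), ?_⟩
    rw [map_sub, map_neg]
    abel

theorem isFormalGroup_prodFunctor (hG : IsFormalGroup G) (hG' : IsFormalGroup G') :
    IsFormalGroup (prodFunctor G G') := by
  obtain ⟨s, η, hη, hη'⟩ := hG.exists_formalAdditive
  obtain ⟨t, θ, hθ, hθ'⟩ := hG'.exists_formalAdditive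
  have := hG.fg
  have := hG'.fg
  refine IsFormalGroup.of_formalAdditive (s := s + t)
    (inferInstanceAs (Module.Finite ℤ (G.obj pt × G'.obj pt)))
    { app := fun R => AddCommGrpCat.ofHom
        { toFun := fun (x : Fin (s + t) → nilradical R.obj) =>
            ((η.app R).hom (fun i => x (Fin.castAdd t i)),
              (θ.app R).hom (fun i => x (Fin.natAdd s i)))
          map_zero' := Prod.ext (map_zero (η.app R).hom) (map_zero (θ.app R).hom)
          map_add' := fun x y => Prod.ext (map_add (η.app R).hom _ _)
            (map_add (θ.app R).hom _ _) }
      naturality := fun R S φ => by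
        ext x
        exact Prod.ext (naturality_apply η φ _) (naturality_apply θ φ _) }
    (fun R x y h => ?_) (fun R x hx => ?_)
  · have h1 := congrFun (hη R (congrArg Prod.fst h))
    have h2 := congrFun (hθ R (congrArg Prod.snd h))
    funext i
    refine Fin.addCases (fun i => h1 i) (fun i => h2 i) i
  · rw [mem_connectedSubgroup] at hx
    obtain ⟨y, hy⟩ := hη' R x.1 (mem_connectedSubgroup.2 fun φ => congrArg Prod.fst (hx φ))
    obtain ⟨z, hz⟩ := hθ' R x.2 (mem_connectedSubgroup.2 fun φ => congrArg Prod.snd (hx φ))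
    refine ⟨fun i => Fin.addCases (motive := fun _ => nilradical R.obj) y z i, ?_⟩
    refine Prod.ext ?_ ?_
    · refine Eq.trans ?_ hy
      refine congrArg (η.app R).hom ?_
      funext i
      exact Fin.addCases_left i
    · refine Eq.trans ?_ hz
      refine congrArg (θ.app R).hom ?_
      funext i
      exact Fin.addCases_right i

end Constructions

/-! ### A criterion for a preadditive category to be abelian -/

section Criterion

universe v u w

theorem isLimit_kernelFork_ab {A B D : AddCommGrpCat.{0}} (i : A ⟶ B) (f : B ⟶ D) (w : i ≫ f = 0)
    (hi : Function.Injective i.hom) (h : ∀ x, f.hom x = 0 → ∃ y, i.hom y = x) :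
    Nonempty (IsLimit (KernelFork.ofι i w)) := by
  let S := ShortComplex.mk i f w
  have : Mono S.f := (AddCommGrpCat.mono_iff_injective i).2 hi
  exact ⟨((ShortComplex.ab_exact_iff S).2 h).fIsKernel⟩

theorem isColimit_cokernelCofork_ab {A B D : AddCommGrpCat.{0}} (f : A ⟶ B) (p : B ⟶ D)
    (w : f ≫ p = 0) (hp : Function.Surjective p.hom) (h : ∀ x, p.hom x = 0 → ∃ y, f.hom y = x) :
    Nonempty (IsColimit (CokernelCofork.ofπ p w)) := by
  let S := ShortComplex.mk f p w
  have : Epi S.g := (AddCommGrpCat.epi_iff_surjective p).2 hp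
  exact ⟨((ShortComplex.ab_exact_iff S).2 h).gIsCokernel⟩

theorem preservesLimit_parallelPair {C : Type u} [Category.{v} C] [HasZeroMorphisms C]
    {D : Type*} [Category* D] [HasZeroMorphisms D] (F : C ⥤ D)
    [F.PreservesZeroMorphisms] {X Y : C} {f : X ⟶ Y} (K : KernelFork f) (hK : IsLimit K)
    (h : Nonempty (IsLimit (K.map F))) : PreservesLimit (parallelPair f 0) F :=
  preservesLimit_of_preserves_limit_cone hK ((KernelFork.isLimitMapConeEquiv K F).symm h.some)

theorem preservesColimit_parallelPair {C : Type u} [Category.{v} C] [HasZeroMorphisms C]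
    {D : Type*} [Category* D] [HasZeroMorphisms D] (F : C ⥤ D)
    [F.PreservesZeroMorphisms] {X Y : C} {f : X ⟶ Y} (K : CokernelCofork f) (hK : IsColimit K)
    (h : Nonempty (IsColimit (K.map F))) : PreservesColimit (parallelPair f 0) F :=
  preservesColimit_of_preserves_colimit_cocone hK
    ((CokernelCofork.isColimitMapCoconeEquiv K F).symm h.some)

variable {C : Type u} [Category.{v} C] [Preadditive C]

theorem hasFiniteProducts_of_bicone (h0 : ∃ Z : C, IsZero Z)
    (hb : ∀ X Y : C, ∃ b : BinaryBicone X Y, b.fst ≫ b.inl + b.snd ≫ b.inr = 𝟙 b.pt) :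
    HasFiniteProducts C := by
  obtain ⟨Z, hZ⟩ := h0
  have : HasZeroObject C := ⟨Z, hZ⟩
  have : HasBinaryBiproducts C := ⟨fun X Y => by
    obtain ⟨b, total⟩ := hb X Y
    exact HasBinaryBiproduct.mk ⟨b, isBinaryBilimitOfTotal b total⟩⟩
  exact hasFiniteProducts_of_has_binary_and_terminal

/-- A preadditive category with finite products, kernels and cokernels is abelian if it has a
jointly conservative family of functors to abelian groups preserving kernels and cokernels. -/
@[reducible]
def abelianOfJointlyConservative [HasFiniteProducts C] {J : Type w} (U : J → C ⥤ AddCommGrpCat.{0})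
    (hU : ∀ j, (U j).PreservesZeroMorphisms)
    (hker : ∀ {X Y : C} (f : X ⟶ Y), ∃ (K : C) (i : K ⟶ X) (w : i ≫ f = 0),
      Nonempty (IsLimit (KernelFork.ofι i w)) ∧ ∀ j, Function.Injective ((U j).map i).hom ∧
        ∀ x, ((U j).map f).hom x = 0 → ∃ y, ((U j).map i).hom y = x)
    (hcoker : ∀ {X Y : C} (f : X ⟶ Y), ∃ (Q : C) (p : Y ⟶ Q) (w : f ≫ p = 0),
      Nonempty (IsColimit (CokernelCofork.ofπ p w)) ∧ ∀ j, Function.Surjective ((U j).map p).hom ∧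
        ∀ x, ((U j).map p).hom x = 0 → ∃ y, ((U j).map f).hom y = x)
    (hiso : ∀ {X Y : C} (f : X ⟶ Y), (∀ j, Function.Bijective ((U j).map f).hom) → IsIso f) :
    Abelian C :=
  haveI : HasKernels C := ⟨fun f => by
    obtain ⟨K, i, w, ⟨h⟩, -⟩ := hker f
    exact ⟨⟨_, h⟩⟩⟩
  haveI : HasCokernels C := ⟨fun f => by
    obtain ⟨K, i, w, ⟨h⟩, -⟩ := hcoker f
    exact ⟨⟨_, h⟩⟩⟩
  haveI h1 : ∀ (j : J) {X Y : C} (f : X ⟶ Y), PreservesLimit (parallelPair f 0) (U j) :=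
    fun j X Y f => by
      obtain ⟨K, i, w, ⟨h⟩, h'⟩ := hker f
      exact preservesLimit_parallelPair _ _ h
        (isLimit_kernelFork_ab _ _ (KernelFork.map_condition _ (U j)) (h' j).1 (h' j).2)
  haveI h2 : ∀ (j : J) {X Y : C} (f : X ⟶ Y), PreservesColimit (parallelPair f 0) (U j) :=
    fun j X Y f => by
      obtain ⟨K, i, w, ⟨h⟩, h'⟩ := hcoker f
      exact preservesColimit_parallelPair _ _ h
        (isColimit_cokernelCofork_ab _ _ (CokernelCofork.map_condition _ (U j)) (h' j).1 (h' j).2)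
  haveI h3 : ∀ {X Y : C} (f : X ⟶ Y), IsIso (Abelian.coimageImageComparison f) := fun f => by
    refine hiso _ fun j => ?_
    -- A functor preserving kernels and cokernels carries the comparison map to the comparison map
    -- of abelian groups, which is invertible.
    have : IsIso ((U j).map (Abelian.coimageImageComparison f)) := by
      have h := Abelian.PreservesCoimageImageComparison.iso (U j) f
      exact (Arrow.isIso_iff_isIso_of_isIso h.hom).2 inferInstance
    exact ConcreteCategory.bijective_of_isIso ((U j).map (Abelian.coimageImageComparison f))
  Abelian.ofCoimageImageComparisonIsIso

end Criterion

/-! ### The category of mixed Hodge structures -/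

section MHS

variable {A B D : Type} [AddCommGroup A] [AddCommGroup B] [AddCommGroup D]

theorem mapQ_zero : mapQ (0 : A →+ B) = 0 := by
  ext a
  exact TensorProduct.tmul_zero _ _

theorem mapC_add (f g : A →+ B) : mapC (f + g) = mapC f + mapC g := by
  ext a
  exact TensorProduct.tmul_add _ _ _

theorem mapQ_add (f g : A →+ B) : mapQ (f + g) = mapQ f + mapQ g := by
  ext a
  exact TensorProduct.tmul_add _ _ _

theorem mapC_neg (f : A →+ B) : mapC (-f) = -mapC f := by
  ext a
  exact TensorProduct.tmul_neg _ _

theorem mapQ_neg (f : A →+ B) : mapQ (-f) = -mapQ f := by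
  ext a
  exact TensorProduct.tmul_neg _ _

variable {S : LevelOneMHS A} {T : LevelOneMHS B} {U : LevelOneMHS D}

namespace IsMHSHom

theorem zero : IsMHSHom S T 0 where
  Wm2 x _ := by rw [mapQ_zero]; exact Submodule.zero_mem _
  Wm1 x _ := by rw [mapQ_zero]; exact Submodule.zero_mem _
  F0 x _ := by rw [mapC_zero]; exact Submodule.zero_mem _

theorem add {f g : A →+ B} (hf : IsMHSHom S T f) (hg : IsMHSHom S T g) :
    IsMHSHom S T (f + g) where
  Wm2 x hx := by rw [mapQ_add]; exact Submodule.add_mem _ (hf.Wm2 x hx) (hg.Wm2 x hx)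
  Wm1 x hx := by rw [mapQ_add]; exact Submodule.add_mem _ (hf.Wm1 x hx) (hg.Wm1 x hx)
  F0 x hx := by rw [mapC_add]; exact Submodule.add_mem _ (hf.F0 x hx) (hg.F0 x hx)

theorem neg {f : A →+ B} (hf : IsMHSHom S T f) : IsMHSHom S T (-f) where
  Wm2 x hx := by rw [mapQ_neg]; exact Submodule.neg_mem _ (hf.Wm2 x hx)
  Wm1 x hx := by rw [mapQ_neg]; exact Submodule.neg_mem _ (hf.Wm1 x hx)
  F0 x hx := by rw [mapC_neg]; exact Submodule.neg_mem _ (hf.F0 x hx)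

end IsMHSHom

/-- Flatness of ℂ over ℤ lets complexification commute with kernels; the companion for cokernels
needs only right exactness of the tensor product. -/
theorem range_mapC_ker_subtype (f : A →+ B) :
    LinearMap.range (mapC f.ker.subtype) = LinearMap.ker (mapC f) := by
  ext x
  refine (mapC_exact (i := f.ker.subtype) (p := f) fun a => ?_) x |>.symm
  rw [← f.mem_ker, Set.mem_range]
  exact ⟨fun h => ⟨⟨a, h⟩, rfl⟩, by rintro ⟨y, rfl⟩; exact y.2⟩

theorem ker_mapC_mk (f : A →+ B) :
    LinearMap.ker (mapC (QuotientAddGroup.mk' f.range)) = LinearMap.range (mapC f) := by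
  ext x
  have hex : Function.Exact f (QuotientAddGroup.mk' f.range) :=
    fun a => QuotientAddGroup.eq_zero_iff a
  exact (lTensor_exact ℂ (f := f.toIntLinearMap)
    (g := (QuotientAddGroup.mk' f.range).toIntLinearMap) hex
    (QuotientAddGroup.mk'_surjective _)) x

/-- The kernel of a morphism of mixed Hodge structures. -/
def kerMHS {f : A →+ B} (hf : IsMHSHom S T f) : LevelOneMHS f.ker :=
  S.sub f.ker.subtype (AddSubgroup.subtype_injective _) (by
    rw [range_mapC_ker_subtype]; exact hf.graded_ker)

/-- The cokernel of a morphism of mixed Hodge structures. -/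
def cokerMHS [Module.Finite ℤ B] {f : A →+ B} (hf : IsMHSHom S T f) :
    LevelOneMHS (B ⧸ f.range) :=
  T.quot (QuotientAddGroup.mk' f.range) (QuotientAddGroup.mk'_surjective _) (by
    rw [ker_mapC_mk]; exact hf.graded_range)

theorem isMHSHom_ker_subtype {f : A →+ B} (hf : IsMHSHom S T f) :
    IsMHSHom (kerMHS hf) S f.ker.subtype :=
  ⟨fun _ hx => hx, fun _ hx => hx, fun _ hx => hx⟩

theorem isMHSHom_coker_mk [Module.Finite ℤ B] {f : A →+ B} (hf : IsMHSHom S T f) :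
    IsMHSHom T (cokerMHS hf) (QuotientAddGroup.mk' f.range) :=
  ⟨fun _ hx => ⟨_, hx, rfl⟩, fun _ hx => ⟨_, hx, rfl⟩, fun _ hx => ⟨_, hx, rfl⟩⟩

theorem IsMHSHom.of_comp_ker_subtype {f : A →+ B} (hf : IsMHSHom S T f) {a : D →+ f.ker}
    (ha : IsMHSHom U S (f.ker.subtype.comp a)) : IsMHSHom U (kerMHS hf) a where
  Wm2 x hx := by
    have h := ha.Wm2 x hx
    rwa [mapQ_comp] at h
  Wm1 x hx := by
    have h := ha.Wm1 x hx
    rwa [mapQ_comp] at h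
  F0 x hx := by
    have h := ha.F0 x hx
    rwa [mapC_comp] at h

theorem IsMHSHom.of_comp_coker_mk [Module.Finite ℤ B] {f : A →+ B} (hf : IsMHSHom S T f)
    {a : B ⧸ f.range →+ D} (ha : IsMHSHom T U (a.comp (QuotientAddGroup.mk' f.range))) :
    IsMHSHom (cokerMHS hf) U a where
  Wm2 := by
    rintro _ ⟨x, hx, rfl⟩
    have h := ha.Wm2 x hx
    rwa [mapQ_comp] at h
  Wm1 := by
    rintro _ ⟨x, hx, rfl⟩
    have h := ha.Wm1 x hx
    rwa [mapQ_comp] at h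
  F0 := by
    rintro _ ⟨x, hx, rfl⟩
    have h := ha.F0 x hx
    rwa [mapC_comp] at h

theorem isMHSHom_fst : IsMHSHom (S.prod T) S (AddMonoidHom.fst A B) :=
  ⟨fun _ hx => hx.1, fun _ hx => hx.1, fun _ hx => hx.1⟩

theorem isMHSHom_snd : IsMHSHom (S.prod T) T (AddMonoidHom.snd A B) :=
  ⟨fun _ hx => hx.2, fun _ hx => hx.2, fun _ hx => hx.2⟩

theorem IsMHSHom.of_fst_snd {a : D →+ A × B}
    (h1 : IsMHSHom U S ((AddMonoidHom.fst A B).comp a))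
    (h2 : IsMHSHom U T ((AddMonoidHom.snd A B).comp a)) : IsMHSHom U (S.prod T) a where
  Wm2 x hx := by
    have h := h1.Wm2 x hx
    have h' := h2.Wm2 x hx
    rw [mapQ_comp] at h h'
    exact ⟨h, h'⟩
  Wm1 x hx := by
    have h := h1.Wm1 x hx
    have h' := h2.Wm1 x hx
    rw [mapQ_comp] at h h'
    exact ⟨h, h'⟩
  F0 x hx := by
    have h := h1.F0 x hx
    have h' := h2.F0 x hx
    rw [mapC_comp] at h h'
    exact ⟨h, h'⟩

theorem isMHSHom_inl : IsMHSHom S (S.prod T) (AddMonoidHom.inl A B) :=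
  IsMHSHom.of_fst_snd (by rw [AddMonoidHom.fst_comp_inl]; exact IsMHSHom.id S)
    (by rw [AddMonoidHom.snd_comp_inl]; exact IsMHSHom.zero)

theorem isMHSHom_inr : IsMHSHom T (S.prod T) (AddMonoidHom.inr A B) :=
  IsMHSHom.of_fst_snd (by rw [AddMonoidHom.fst_comp_inr]; exact IsMHSHom.zero)
    (by rw [AddMonoidHom.snd_comp_inr]; exact IsMHSHom.id T)

end MHS

namespace MHS1

theorem hom_ext {X Y : MHS1} {f g : X ⟶ Y} (h : Hom.map f = Hom.map g) : f = g :=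
  Hom.ext h

instance (X Y : MHS1) : Add (X ⟶ Y) := ⟨fun f g => ⟨Hom.map f + Hom.map g, f.isHom.add g.isHom⟩⟩

instance (X Y : MHS1) : Zero (X ⟶ Y) := ⟨⟨0, IsMHSHom.zero⟩⟩

instance (X Y : MHS1) : Neg (X ⟶ Y) := ⟨fun f => ⟨-Hom.map f, f.isHom.neg⟩⟩

instance (X Y : MHS1) : AddCommGroup (X ⟶ Y) where
  add_assoc _ _ _ := hom_ext (add_assoc _ _ _)
  zero_add _ := hom_ext (zero_add _)
  add_zero _ := hom_ext (add_zero _)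
  neg_add_cancel _ := hom_ext (neg_add_cancel _)
  add_comm _ _ := hom_ext (add_comm _ _)
  nsmul := nsmulRec
  zsmul := zsmulRec

instance : Preadditive MHS1 where
  add_comp _ _ _ _ _ h := hom_ext (AddMonoidHom.comp_add (Hom.map h) _ _)
  comp_add _ _ _ f _ _ := hom_ext (AddMonoidHom.add_comp _ _ (Hom.map f))

/-- The underlying abelian group. -/
def forget : MHS1 ⥤ AddCommGrpCat.{0} where
  obj X := AddCommGrpCat.of X.carrier
  map f := AddCommGrpCat.ofHom (Hom.map f)

instance : forget.PreservesZeroMorphisms where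
  map_zero _ _ := rfl

theorem isZero_of_subsingleton (X : MHS1) [Subsingleton X.carrier] : IsZero X := by
  rw [IsZero.iff_id_eq_zero]
  exact hom_ext (AddMonoidHom.ext fun _ => Subsingleton.elim _ _)

theorem subsingleton_of_isZero {X : MHS1} (h : IsZero X) : Subsingleton X.carrier := by
  have h1 : 𝟙 X = 0 := (IsZero.iff_id_eq_zero X).1 h
  have h2 : ∀ x : X.carrier, x = 0 := fun x =>
    DFunLike.congr_fun (congrArg Hom.map h1) x
  exact ⟨fun x y => (h2 x).trans (h2 y).symm⟩

/-- The product of two mixed Hodge structures. -/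
def prodBicone (X Y : MHS1) : BinaryBicone X Y :=
  haveI := X.fg
  haveI := Y.fg
  { pt := ⟨X.carrier × Y.carrier, X.str.prod Y.str, inferInstance⟩
    fst := ⟨AddMonoidHom.fst _ _, isMHSHom_fst⟩
    snd := ⟨AddMonoidHom.snd _ _, isMHSHom_snd⟩
    inl := ⟨AddMonoidHom.inl _ _, isMHSHom_inl⟩
    inr := ⟨AddMonoidHom.inr _ _, isMHSHom_inr⟩
    inl_fst := hom_ext (AddMonoidHom.fst_comp_inl)
    inl_snd := hom_ext (AddMonoidHom.snd_comp_inl)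
    inr_fst := hom_ext (AddMonoidHom.fst_comp_inr)
    inr_snd := hom_ext (AddMonoidHom.snd_comp_inr) }

instance : HasFiniteProducts MHS1 := by
  refine hasFiniteProducts_of_bicone
    ⟨⟨PUnit, zeroMHS _, inferInstance⟩, @isZero_of_subsingleton _ (inferInstanceAs
      (Subsingleton PUnit))⟩ fun X Y => ⟨prodBicone X Y, hom_ext (AddMonoidHom.ext fun x => ?_)⟩
  refine Prod.ext ?_ ?_
  · exact add_zero x.1
  · exact zero_add x.2

variable {X Y : MHS1} (f : X ⟶ Y)

/-- The kernel of a morphism. -/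
def ker : MHS1 where
  carrier := (Hom.map f).ker
  str := kerMHS f.isHom
  fg := by
    have := X.fg
    exact Module.Finite.of_injective ((Hom.map f).ker.subtype.toIntLinearMap)
      (AddSubgroup.subtype_injective _)

/-- The inclusion of the kernel. -/
def kerι : ker f ⟶ X := ⟨(Hom.map f).ker.subtype, isMHSHom_ker_subtype f.isHom⟩

theorem kerι_comp : kerι f ≫ f = 0 := hom_ext (AddMonoidHom.ext fun x => x.2)

/-- The universal property of the kernel. -/
def kerIsLimit : IsLimit (KernelFork.ofι (kerι f) (kerι_comp f)) :=
  KernelFork.IsLimit.ofι _ _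
    (fun a h => ⟨(Hom.map a).codRestrict _ fun x =>
      DFunLike.congr_fun (congrArg Hom.map h) x, f.isHom.of_comp_ker_subtype a.isHom⟩)
    (fun _ _ => rfl)
    (fun _ _ _ hm => hom_ext (AddMonoidHom.ext fun x => Subtype.ext
      (DFunLike.congr_fun (congrArg Hom.map hm) x)))

/-- The cokernel of a morphism. -/
def coker : MHS1 :=
  haveI := Y.fg
  { carrier := Y.carrier ⧸ (Hom.map f).range
    str := cokerMHS f.isHom
    fg := Module.Finite.of_surjective ((QuotientAddGroup.mk' (Hom.map f).range).toIntLinearMap)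
      (QuotientAddGroup.mk'_surjective _) }

/-- The projection to the cokernel. -/
def cokerπ : Y ⟶ coker f :=
  haveI := Y.fg
  ⟨QuotientAddGroup.mk' (Hom.map f).range, isMHSHom_coker_mk f.isHom⟩

theorem comp_cokerπ : f ≫ cokerπ f = 0 :=
  hom_ext (AddMonoidHom.ext fun x => (QuotientAddGroup.eq_zero_iff _).2 ⟨x, rfl⟩)

/-- The universal property of the cokernel. -/
def cokerIsColimit : IsColimit (CokernelCofork.ofπ (cokerπ f) (comp_cokerπ f)) :=
  haveI := Y.fg
  CokernelCofork.IsColimit.ofπ _ _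
    (fun a h => ⟨QuotientAddGroup.lift _ (Hom.map a) (by
      rintro _ ⟨x, rfl⟩
      exact DFunLike.congr_fun (congrArg Hom.map h) x), f.isHom.of_comp_coker_mk a.isHom⟩)
    (fun _ _ => rfl)
    (fun _ _ _ hm => hom_ext (AddMonoidHom.ext fun x => by
      obtain ⟨x, rfl⟩ := QuotientAddGroup.mk'_surjective _ x
      exact DFunLike.congr_fun (congrArg Hom.map hm) x))

theorem isIso_of_bijective (h : Function.Bijective (Hom.map f)) : IsIso f := by
  let g := (AddEquiv.ofBijective (Hom.map f) h).symm.toAddMonoidHom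
  have h1 : ∀ y, Hom.map f (g y) = y := (AddEquiv.ofBijective (Hom.map f) h).apply_symm_apply
  have h2 : ∀ x, g (Hom.map f x) = x := (AddEquiv.ofBijective (Hom.map f) h).symm_apply_apply
  exact ⟨⟨g, f.isHom.of_rightInverse h.1 h1⟩, hom_ext (AddMonoidHom.ext h2),
    hom_ext (AddMonoidHom.ext h1)⟩

instance : Abelian MHS1 :=
  abelianOfJointlyConservative (J := Unit) (fun _ => forget) (fun _ => inferInstance)
    (fun f => ⟨ker f, kerι f, kerι_comp f, ⟨kerIsLimit f⟩, fun _ =>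
      ⟨AddSubgroup.subtype_injective _, fun x hx => ⟨⟨x, hx⟩, rfl⟩⟩⟩)
    (fun f => ⟨coker f, cokerπ f, comp_cokerπ f, ⟨cokerIsColimit f⟩, fun _ =>
      ⟨QuotientAddGroup.mk'_surjective (MHS1.Hom.map f).range, fun x hx =>
        (QuotientAddGroup.eq_zero_iff (N := (MHS1.Hom.map f).range) x).1 hx⟩⟩)
    (fun f h => isIso_of_bijective f (h ()))

end MHS1

/-! ### Vector groups -/

section VectorGroups

variable {G G' : GroupFunctor} {V V' V'' : Type} [AddCommGroup V] [Module ℂ V] [AddCommGroup V']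
  [Module ℂ V'] [AddCommGroup V''] [Module ℂ V'']

theorem vectorGroupMap_add (g g' : V →ₗ[ℂ] V') :
    vectorGroupMap (g + g') = vectorGroupMap g + vectorGroupMap g' := by
  ext R x
  exact LinearMap.congr_fun (LinearMap.lTensor_add R.obj g g') x

theorem vectorGroupMap_zero : vectorGroupMap (0 : V →ₗ[ℂ] V') = 0 := by
  ext R x
  exact LinearMap.congr_fun (LinearMap.lTensor_zero R.obj) x

theorem vectorGroupMap_neg (g : V →ₗ[ℂ] V') : vectorGroupMap (-g) = -vectorGroupMap g := by
  rw [eq_neg_iff_add_eq_zero, ← vectorGroupMap_add, neg_add_cancel, vectorGroupMap_zero]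

/-- Composing with the linear retraction 1 − N∘`g` of V onto the kernel gives the lift; the
correction term vanishes since `a` followed by `g` is zero. -/
theorem exists_vectorGroup_lift (a : G ⟶ vectorGroup V) (g : V →ₗ[ℂ] V')
    (h : a ≫ vectorGroupMap g = 0) :
    ∃ v : G ⟶ vectorGroup (LinearMap.ker g),
      v ≫ vectorGroupMap (LinearMap.ker g).subtype = a := by
  obtain ⟨N, hN⟩ := exists_generalizedInverse g
  let r : V →ₗ[ℂ] LinearMap.ker g := (LinearMap.id - N.comp g).codRestrict _ fun x => by
    rw [LinearMap.mem_ker, LinearMap.sub_apply, map_sub, LinearMap.comp_apply, hN]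
    exact sub_self _
  have hr : (LinearMap.ker g).subtype.comp r + N.comp g = LinearMap.id :=
    LinearMap.ext fun x => sub_add_cancel _ _
  refine ⟨a ≫ vectorGroupMap r, ?_⟩
  have h2 := congrArg (fun t => a ≫ vectorGroupMap t) hr
  simp only [vectorGroupMap_add, vectorGroupMap_comp, vectorGroupMap_id, Preadditive.comp_add,
    Category.comp_id, reassoc_of% h, zero_comp, add_zero] at h2
  rw [Category.assoc, h2]

theorem eq_of_comp_vectorGroupMap_subtype {P : Submodule ℂ V} {a b : G ⟶ vectorGroup P}
    (h : a ≫ vectorGroupMap P.subtype = b ≫ vectorGroupMap P.subtype) : a = b := by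
  obtain ⟨r, hr⟩ := P.subtype.exists_leftInverse_of_injective (Submodule.ker_subtype _)
  have h2 := congrArg (fun t => t ≫ vectorGroupMap r) h
  simpa only [Category.assoc, ← vectorGroupMap_comp, hr, vectorGroupMap_id, Category.comp_id]
    using h2

theorem intMap_comp_vectorGroupMap (v : G ⟶ vectorGroup V) (g : V →ₗ[ℂ] V') (h : G.obj pt) :
    intMap (v ≫ vectorGroupMap g) h = g (intMap v h) := by
  have key : ∀ y : ℂ ⊗[ℂ] V, TensorProduct.lid ℂ V' (LinearMap.lTensor ℂ g y) =
      g (TensorProduct.lid ℂ V y) := fun y => by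
    induction y with
    | zero => simp
    | tmul z x => simp
    | add x y hx hy => simp only [map_add, hx, hy]
  exact key ((v.app pt).hom h)

/-- The complex linear map `H_ℂ → V` induced by `v : H → V`. -/
def complexMap (v : G ⟶ vectorGroup V) : (ℂ ⊗[ℤ] G.obj pt) →ₗ[ℂ] V :=
  LinearMap.liftBaseChange ℂ (intMap v).toIntLinearMap

theorem complexMap_one_tmul (v : G ⟶ vectorGroup V) (h : G.obj pt) :
    complexMap v (1 ⊗ₜ h) = intMap v h := by
  rw [complexMap, LinearMap.liftBaseChange_tmul, one_smul]
  rfl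

theorem complexMap_naturality {v : G ⟶ vectorGroup V} {v' : G' ⟶ vectorGroup V'} {f : G ⟶ G'}
    {g : V →ₗ[ℂ] V'} (h : v ≫ vectorGroupMap g = f ≫ v') (x : ℂ ⊗[ℤ] G.obj pt) :
    complexMap v' (mapC (f.app pt).hom x) = g (complexMap v x) := by
  suffices (complexMap v').comp (mapC (f.app pt).hom) = g.comp (complexMap v) from
    LinearMap.congr_fun this x
  ext a
  change complexMap v' (1 ⊗ₜ (f.app pt).hom a) = g (complexMap v (1 ⊗ₜ a))
  rw [complexMap_one_tmul, complexMap_one_tmul, ← intMap_comp_vectorGroupMap, h]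
  rfl

end VectorGroups

namespace FHS1

/-! ### Formal Hodge structures in terms of `H_ℂ → V` -/

/-- The map `H_ℂ → V`. -/
abbrev vC (X : FHS1) : (ℂ ⊗[ℤ] X.H.obj pt) →ₗ[ℂ] X.V := complexMap X.v

theorem mkQ_vC (X : FHS1) (x : ℂ ⊗[ℤ] X.H.obj pt) :
    X.V0.mkQ (X.vC x) = X.σ (X.et.F0.mkQ x) := by
  suffices X.V0.mkQ.comp X.vC = X.σ.toLinearMap.comp X.et.F0.mkQ from LinearMap.congr_fun this x
  ext a
  change X.V0.mkQ (complexMap X.v (1 ⊗ₜ a)) = X.σ (X.et.F0.mkQ (1 ⊗ₜ a))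
  rw [complexMap_one_tmul, X.comm]

/-- Injectivity of σ. Surjectivity is `exists_sub_vC_mem`; together they say everything σ says, in a
form convenient for kernels and quotients. -/
theorem vC_mem_V0 (X : FHS1) {x : ℂ ⊗[ℤ] X.H.obj pt} : X.vC x ∈ X.V0 ↔ x ∈ X.et.F0 := by
  rw [← Submodule.Quotient.mk_eq_zero, ← Submodule.mkQ_apply, mkQ_vC,
    LinearEquiv.map_eq_zero_iff, Submodule.mkQ_apply, Submodule.Quotient.mk_eq_zero]

theorem exists_sub_vC_mem (X : FHS1) (y : X.V) : ∃ x, y - X.vC x ∈ X.V0 := by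
  obtain ⟨x, hx⟩ := Submodule.mkQ_surjective _ (X.σ.symm (X.V0.mkQ y))
  refine ⟨x, ?_⟩
  rw [← Submodule.Quotient.mk_eq_zero, ← Submodule.mkQ_apply, map_sub, mkQ_vC, hx,
    LinearEquiv.apply_symm_apply, sub_self]

theorem exists_of_mem_V1 (X : FHS1) {y : X.V} (hy : y ∈ X.V1) :
    ∃ x ∈ complexify X.et.Wm2, y - X.vC x ∈ X.V0 := by
  have h : X.V0.mkQ y ∈ X.V1.map X.V0.mkQ := ⟨y, hy, rfl⟩
  rw [← X.σ_Wm2] at h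
  obtain ⟨_, ⟨x, hx, rfl⟩, h⟩ := h
  refine ⟨x, hx, ?_⟩
  rw [← Submodule.Quotient.mk_eq_zero, ← Submodule.mkQ_apply, map_sub, mkQ_vC, sub_eq_zero]
  exact h.symm

theorem vC_mem_V1 (X : FHS1) {x : ℂ ⊗[ℤ] X.H.obj pt} (hx : x ∈ complexify X.et.Wm2) :
    X.vC x ∈ X.V1 := by
  have h : X.σ (X.et.F0.mkQ x) ∈ X.V1.map X.V0.mkQ := by
    rw [← X.σ_Wm2]
    exact ⟨_, ⟨x, hx, rfl⟩, rfl⟩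
  rw [← mkQ_vC] at h
  obtain ⟨y, hy, h⟩ := h
  rw [← sub_eq_zero, ← map_sub, Submodule.mkQ_apply, Submodule.Quotient.mk_eq_zero] at h
  have := X.V1.sub_mem hy (X.V0_le h)
  rwa [sub_sub_cancel] at this

theorem surjective_mkQ_comp {E V : Type} [AddCommGroup E] [Module ℂ E] [AddCommGroup V]
    [Module ℂ V] {V0 : Submodule ℂ V} {u : E →ₗ[ℂ] V} (h : ∀ y : V, ∃ x, y - u x ∈ V0) :
    Function.Surjective (V0.mkQ.comp u) := fun y => by
  obtain ⟨y, rfl⟩ := V0.mkQ_surjective y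
  obtain ⟨x, hx⟩ := h y
  refine ⟨x, ?_⟩
  rw [← Submodule.Quotient.mk_eq_zero, ← Submodule.mkQ_apply, map_sub, sub_eq_zero] at hx
  exact hx.symm

theorem eq_ker_mkQ_comp {E V : Type} [AddCommGroup E] [Module ℂ E] [AddCommGroup V]
    [Module ℂ V] {V0 : Submodule ℂ V} {F : Submodule ℂ E} {u : E →ₗ[ℂ] V}
    (h : ∀ x, u x ∈ V0 ↔ x ∈ F) : F = LinearMap.ker (V0.mkQ.comp u) := by
  ext x
  rw [LinearMap.mem_ker, LinearMap.comp_apply, Submodule.mkQ_apply,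
    Submodule.Quotient.mk_eq_zero, h]

/-- A formal Hodge structure is determined by `V⁰` and `v`. -/
def ofMap (H : GroupFunctor) (hH : IsFormalGroup H) (et : LevelOneMHS (H.obj pt)) (V : Type)
    [AddCommGroup V] [Module ℂ V] [FiniteDimensional ℂ V] (V0 : Submodule ℂ V)
    (v : H ⟶ vectorGroup V) (h : ∀ x, complexMap v x ∈ V0 ↔ x ∈ et.F0)
    (h' : ∀ y, ∃ x, y - complexMap v x ∈ V0) : FHS1 where
  H := H
  isFormalGroup := hH
  et := et
  V := V
  V0 := V0
  V1 := (complexify et.Wm2).map (complexMap v) ⊔ V0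
  V0_le := le_sup_right
  v := v
  σ := (Submodule.quotEquivOfEq _ _ (eq_ker_mkQ_comp h)).trans
    ((V0.mkQ.comp (complexMap v)).quotKerEquivOfSurjective (surjective_mkQ_comp h'))
  σ_Wm2 := by
    rw [Submodule.map_sup, ← Submodule.map_comp, ← Submodule.map_comp,
      Submodule.mkQ_map_self, sup_bot_eq]
    rfl
  comm a := by
    rw [← complexMap_one_tmul]
    rfl

namespace Hom

variable {X Y : FHS1}

theorem vC_map (φ : Hom X Y) (x : ℂ ⊗[ℤ] X.H.obj pt) :
    Y.vC (mapC (φ.f.app pt).hom x) = φ.g (X.vC x) :=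
  complexMap_naturality φ.square x

/-- The compatibility of a morphism with `V¹` and `σ` is automatic. -/
def mk' (f : X.H ⟶ Y.H) (g : X.V →ₗ[ℂ] Y.V) (h : IsMHSHom X.et Y.et (f.app pt).hom)
    (h0 : ∀ x ∈ X.V0, g x ∈ Y.V0) (hsq : X.v ≫ vectorGroupMap g = f ≫ Y.v) : X ⟶ Y where
  f := f
  g := g
  isMHSHom := h
  map_V0 := h0
  map_V1 y hy := by
    obtain ⟨x, hx, hxy⟩ := X.exists_of_mem_V1 hy
    have h1 : g y = Y.vC (mapC (f.app pt).hom x) + g (y - X.vC x) := by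
      rw [vC, complexMap_naturality hsq, map_sub]; abel
    rw [Submodule.mem_comap, h1]
    exact Y.V1.add_mem (Y.vC_mem_V1 (mapC_mem_complexify h.Wm2 hx)) (Y.V0_le (h0 _ hxy))
  square := hsq
  square_σ x := by
    obtain ⟨x, rfl⟩ := Submodule.mkQ_surjective _ x
    rw [← mkQ_vC]
    change Y.σ (Y.et.F0.mkQ _) = Y.V0.mkQ (g (X.vC x))
    rw [← mkQ_vC, ← complexMap_naturality hsq]

/-- Strictness of morphisms with respect to `V⁰`. -/
theorem exists_mem_V0_map_eq (φ : Hom X Y) {x : X.V} (hx : φ.g x ∈ Y.V0) :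
    ∃ a, mapC (φ.f.app pt).hom a = 0 ∧ x - X.vC a ∈ X.V0 := by
  obtain ⟨a, ha⟩ := X.exists_sub_vC_mem x
  have h1 : mapC (φ.f.app pt).hom a ∈ Y.et.F0 := by
    rw [← vC_mem_V0, φ.vC_map]
    have h2 := Y.V0.sub_mem hx (φ.map_V0 ha)
    rwa [← map_sub, sub_sub_cancel] at h2
  -- Strictness for F⁰ supplies an element of F⁰ with the same image as `a`; subtracting it puts the
  -- representative in the kernel without changing its class modulo V⁰.
  obtain ⟨b, hb, hab⟩ := φ.isMHSHom.exists_mem_F0_map_eq h1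
  refine ⟨a - b, by rw [map_sub, hab, sub_self], ?_⟩
  have h2 := X.V0.add_mem ha (X.vC_mem_V0.2 hb)
  rw [map_sub]
  convert h2 using 1
  abel

end Hom

/-! ### The additive structure on `FHS₁` -/

theorem hom_ext {X Y : FHS1} {φ χ : X ⟶ Y} (hf : Hom.f φ = Hom.f χ) (hg : Hom.g φ = Hom.g χ) :
    φ = χ :=
  Hom.ext hf hg

instance (X Y : FHS1) : Add (X ⟶ Y) := ⟨fun φ χ => Hom.mk' (Hom.f φ + Hom.f χ) (Hom.g φ + Hom.g χ)
  (φ.isMHSHom.add χ.isMHSHom) (fun _ hx => Y.V0.add_mem (φ.map_V0 hx) (χ.map_V0 hx)) (by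
    rw [vectorGroupMap_add, Preadditive.comp_add, Preadditive.add_comp, φ.square, χ.square])⟩

instance (X Y : FHS1) : Zero (X ⟶ Y) := ⟨Hom.mk' 0 0 IsMHSHom.zero
  (fun _ _ => Y.V0.zero_mem) (by rw [vectorGroupMap_zero, comp_zero, zero_comp])⟩

instance (X Y : FHS1) : Neg (X ⟶ Y) := ⟨fun φ => Hom.mk' (-Hom.f φ) (-Hom.g φ)
  φ.isMHSHom.neg (fun _ hx => Y.V0.neg_mem (φ.map_V0 hx)) (by
    rw [vectorGroupMap_neg, Preadditive.comp_neg, Preadditive.neg_comp, φ.square])⟩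

instance (X Y : FHS1) : AddCommGroup (X ⟶ Y) where
  add_assoc _ _ _ := hom_ext (add_assoc _ _ _) (add_assoc _ _ _)
  zero_add _ := hom_ext (zero_add _) (zero_add _)
  add_zero _ := hom_ext (add_zero _) (add_zero _)
  neg_add_cancel _ := hom_ext (neg_add_cancel _) (neg_add_cancel _)
  add_comm _ _ := hom_ext (add_comm _ _) (add_comm _ _)
  nsmul := nsmulRec
  zsmul := zsmulRec

theorem add_f {X Y : FHS1} (φ χ : X ⟶ Y) : Hom.f (φ + χ) = Hom.f φ + Hom.f χ := rfl

theorem add_g {X Y : FHS1} (φ χ : X ⟶ Y) : Hom.g (φ + χ) = Hom.g φ + Hom.g χ := rfl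

theorem comp_f {X Y Z : FHS1} (φ : X ⟶ Y) (χ : Y ⟶ Z) :
    Hom.f (φ ≫ χ) = Hom.f φ ≫ Hom.f χ := rfl

theorem comp_g {X Y Z : FHS1} (φ : X ⟶ Y) (χ : Y ⟶ Z) :
    Hom.g (φ ≫ χ) = (Hom.g χ).comp (Hom.g φ) := rfl

instance : Preadditive FHS1 where
  add_comp _ _ _ φ φ' χ := hom_ext
    (by simp only [comp_f, add_f, Preadditive.add_comp])
    (by simp only [comp_g, add_g, LinearMap.comp_add])
  comp_add _ _ _ φ χ χ' := hom_ext
    (by simp only [comp_f, add_f, Preadditive.comp_add])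
    (by simp only [comp_g, add_g, LinearMap.add_comp])

/-! ### Kernels -/

section Kernel

variable {X Y : FHS1} (φ : X ⟶ Y)

/-- The restriction of `v` to the kernel of f is killed by g, so it factors through the vector group
of the kernel of g. -/
theorem exists_kerMap : ∃ v : kerFunctor (Hom.f φ) ⟶ vectorGroup (LinearMap.ker (Hom.g φ)),
    v ≫ vectorGroupMap (LinearMap.ker (Hom.g φ)).subtype = kerIncl (Hom.f φ) ≫ X.v :=
  exists_vectorGroup_lift _ _ (by
    rw [Category.assoc, φ.square, ← Category.assoc, kerIncl_comp, zero_comp])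

/-- The kernel of a morphism. -/
def ker : FHS1 :=
  ofMap (kerFunctor (Hom.f φ)) (isFormalGroup_kerFunctor X.isFormalGroup Y.isFormalGroup)
    (kerMHS φ.isMHSHom) (LinearMap.ker (Hom.g φ))
    (X.V0.comap (LinearMap.ker (Hom.g φ)).subtype) (exists_kerMap φ).choose
    (fun x => by
      rw [Submodule.mem_comap, ← complexMap_naturality (exists_kerMap φ).choose_spec.symm.symm]
      exact X.vC_mem_V0)
    (fun y => by
      have hy : Hom.g φ y.1 ∈ Y.V0 := by
        rw [LinearMap.mem_ker.1 y.2]; exact Y.V0.zero_mem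
      -- Strictness for V⁰ is what makes the kernel's σ surjective: the representative modulo V⁰ can
      -- be taken from the kernel of H_ℂ.
      obtain ⟨a, ha, hya⟩ := Hom.exists_mem_V0_map_eq φ hy
      have ha' : a ∈ LinearMap.range (mapC ((Hom.f φ).app pt).hom.ker.subtype) := by
        rw [range_mapC_ker_subtype]; exact ha
      obtain ⟨b, rfl⟩ := ha'
      refine ⟨b, ?_⟩
      have hnat := complexMap_naturality (G := kerFunctor (Hom.f φ)) (exists_kerMap φ).choose_spec
        b
      change y.1 - (LinearMap.ker (Hom.g φ)).subtype (complexMap (G := kerFunctor (Hom.f φ)) _ b) ∈ X.V0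
      rw [← hnat]
      exact hya)

/-- The inclusion of the kernel. -/
def kerι : ker φ ⟶ X :=
  Hom.mk' (kerIncl (Hom.f φ)) (LinearMap.ker (Hom.g φ)).subtype (isMHSHom_ker_subtype φ.isMHSHom)
    (fun _ hx => hx) (exists_kerMap φ).choose_spec

theorem kerι_comp : kerι φ ≫ φ = 0 :=
  hom_ext (kerIncl_comp _) (LinearMap.ext fun x => x.2)

/-- The universal property of the kernel. -/
def kerIsLimit : IsLimit (KernelFork.ofι (kerι φ) (kerι_comp φ)) :=
  KernelFork.IsLimit.ofι _ _
    (fun {Z} a h => Hom.mk' (Y := ker φ) (kerLift (Hom.f φ) (Hom.f a) (congrArg Hom.f h))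
      ((Hom.g a).codRestrict (LinearMap.ker (Hom.g φ)) fun x =>
        LinearMap.mem_ker.2 (LinearMap.congr_fun (congrArg Hom.g h) x))
      (IsMHSHom.of_comp_ker_subtype φ.isMHSHom a.isMHSHom)
      (fun x hx => a.map_V0 hx)
      (by
        apply eq_of_comp_vectorGroupMap_subtype
        refine Eq.trans ?_ ((Category.assoc _ _ _).trans
          (congrArg (kerLift (Hom.f φ) (Hom.f a) (congrArg Hom.f h) ≫ ·)
            (exists_kerMap φ).choose_spec)).symm
        refine Eq.trans ?_ a.square
        refine (Category.assoc _ _ _).trans (congrArg (Z.v ≫ ·) ?_)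
        exact (vectorGroupMap_comp _ _).symm))
    (fun _ _ => rfl)
    (fun _ _ _ hm => hom_ext
      (by
        ext R x
        exact Subtype.ext (ConcreteCategory.congr_hom
          (NatTrans.congr_app (congrArg Hom.f hm) R) x))
      (LinearMap.ext fun x => Subtype.ext (LinearMap.congr_fun (congrArg Hom.g hm) x)))

end Kernel

/-! ### Cokernels -/

section Cokernel

variable {X Y : FHS1} (φ : X ⟶ Y)

/-- The homomorphism `v` of the cokernel. -/
def cokerMap : cokerFunctor (Hom.f φ) ⟶ vectorGroup (Y.V ⧸ LinearMap.range (Hom.g φ)) :=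
  cokerDesc (Hom.f φ) (Y.v ≫ vectorGroupMap (LinearMap.range (Hom.g φ)).mkQ) (by
    rw [← Category.assoc, ← φ.square, Category.assoc, ← vectorGroupMap_comp,
      LinearMap.range_mkQ_comp, vectorGroupMap_zero, comp_zero])

theorem comp_cokerMap : Y.v ≫ vectorGroupMap (LinearMap.range (Hom.g φ)).mkQ =
    cokerProj (Hom.f φ) ≫ cokerMap φ := rfl

/-- The cokernel of a morphism. -/
def coker : FHS1 :=
  haveI : Module.Finite ℤ (Y.H.obj pt) := Y.isFormalGroup.fg
  ofMap (cokerFunctor (Hom.f φ)) (isFormalGroup_cokerFunctor X.isFormalGroup Y.isFormalGroup)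
    (cokerMHS φ.isMHSHom) (Y.V ⧸ LinearMap.range (Hom.g φ))
    (Y.V0.map (LinearMap.range (Hom.g φ)).mkQ) (cokerMap φ)
    (fun x => by
      obtain ⟨x, rfl⟩ := mapC_surjective (f := ((cokerProj (Hom.f φ)).app pt).hom)
        (QuotientAddGroup.mk'_surjective _) x
      have hnat := complexMap_naturality (comp_cokerMap φ)
      constructor
      · rw [hnat]
        rintro ⟨w, hw, h⟩
        rw [← sub_eq_zero, ← map_sub, Submodule.mkQ_apply, Submodule.Quotient.mk_eq_zero] at h
        obtain ⟨y, hy⟩ := h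
        obtain ⟨a, ha⟩ := X.exists_sub_vC_mem y
        -- A relation in the quotient of V comes from some `y` in the source; representing `y` by
        -- `a` modulo V⁰ and adding the image of `a` changes `x` only within its class in the
        -- cokernel and brings it into F⁰.
        have h1 : x + mapC ((Hom.f φ).app pt).hom a ∈ Y.et.F0 := by
          rw [← vC_mem_V0, map_add, Hom.vC_map φ]
          have h2 := Y.V0.sub_mem hw (φ.map_V0 ha)
          have h3 : w = Hom.g φ y + Y.vC x := by rw [hy]; abel
          rw [map_sub, h3] at h2
          convert h2 using 1
          abel
        refine ⟨_, h1, ?_⟩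
        have h4 : mapC ((Hom.f φ).app pt).hom a ∈ LinearMap.ker
            (mapC (QuotientAddGroup.mk' ((Hom.f φ).app pt).hom.range)) := by
          rw [ker_mapC_mk]; exact ⟨a, rfl⟩
        rw [map_add, LinearMap.mem_ker.1 h4, add_zero]
        rfl
      · rintro ⟨z, hz, h⟩
        have h1 : complexMap (cokerMap φ) (mapC ((cokerProj (Hom.f φ)).app pt).hom z) =
          complexMap (cokerMap φ) (mapC ((cokerProj (Hom.f φ)).app pt).hom x) := congrArg _ h
        rw [← h1, hnat]
        exact ⟨_, Y.vC_mem_V0.2 hz, rfl⟩)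
    (fun y => by
      obtain ⟨y, rfl⟩ := Submodule.mkQ_surjective _ y
      obtain ⟨x, hx⟩ := Y.exists_sub_vC_mem y
      refine ⟨mapC ((cokerProj (Hom.f φ)).app pt).hom x, ?_⟩
      rw [complexMap_naturality (comp_cokerMap φ), ← map_sub]
      exact ⟨_, hx, rfl⟩)

/-- The projection to the cokernel. -/
def cokerπ : Y ⟶ coker φ :=
  haveI : Module.Finite ℤ (Y.H.obj pt) := Y.isFormalGroup.fg
  Hom.mk' (Y := coker φ) (cokerProj (Hom.f φ)) (LinearMap.range (Hom.g φ)).mkQ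
    (isMHSHom_coker_mk φ.isMHSHom) (fun _ hx => ⟨_, hx, rfl⟩) (comp_cokerMap φ)

theorem comp_cokerπ : φ ≫ cokerπ φ = 0 :=
  hom_ext (comp_cokerProj _) (LinearMap.range_mkQ_comp _)

/-- The universal property of the cokernel. -/
def cokerIsColimit : IsColimit (CokernelCofork.ofπ (cokerπ φ) (comp_cokerπ φ)) :=
  haveI : Module.Finite ℤ (Y.H.obj pt) := Y.isFormalGroup.fg
  CokernelCofork.IsColimit.ofπ _ _
    (fun a h => Hom.mk' (X := coker φ) (cokerDesc (Hom.f φ) (Hom.f a) (congrArg Hom.f h))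
      ((LinearMap.range (Hom.g φ)).liftQ (Hom.g a) (by
        rintro _ ⟨x, rfl⟩
        exact LinearMap.congr_fun (congrArg Hom.g h) x))
      (IsMHSHom.of_comp_coker_mk φ.isMHSHom a.isMHSHom)
      (by
        rintro _ ⟨x, hx, rfl⟩
        exact a.map_V0 hx)
      (by
        ext R x
        obtain ⟨x, rfl⟩ := QuotientAddGroup.mk'_surjective _ x
        have h1 := ConcreteCategory.congr_hom (NatTrans.congr_app a.square R) x
        refine Eq.trans ?_ h1
        refine (LinearMap.lTensor_comp_apply R.obj _ (LinearMap.range (Hom.g φ)).mkQ _).symm.trans ?_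
        exact LinearMap.congr_fun (congrArg (LinearMap.lTensor R.obj) (Submodule.liftQ_mkQ _ _ _)) _))
    (fun _ _ => rfl)
    (fun _ _ _ hm => hom_ext
      (by
        ext R x
        obtain ⟨x, rfl⟩ := QuotientAddGroup.mk'_surjective _ x
        exact ConcreteCategory.congr_hom (NatTrans.congr_app (congrArg Hom.f hm) R) x)
      (LinearMap.ext fun x => by
        obtain ⟨x, rfl⟩ := Submodule.mkQ_surjective _ x
        exact LinearMap.congr_fun (congrArg Hom.g hm) x))

end Cokernel

end FHS1

/-! ### Products and isomorphisms of formal Hodge structures -/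

section ProdFunctor

variable (G G' : GroupFunctor)

/-- The first projection. -/
def prodFst : prodFunctor G G' ⟶ G where
  app _ := AddCommGrpCat.ofHom (AddMonoidHom.fst _ _)
  naturality _ _ _ := rfl

/-- The second projection. -/
def prodSnd : prodFunctor G G' ⟶ G' where
  app _ := AddCommGrpCat.ofHom (AddMonoidHom.snd _ _)
  naturality _ _ _ := rfl

/-- The first inclusion. -/
def prodInl : G ⟶ prodFunctor G G' where
  app _ := AddCommGrpCat.ofHom (AddMonoidHom.inl _ _)
  naturality R S φ := by
    refine AddCommGrpCat.hom_ext (AddMonoidHom.ext fun x => ?_)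
    exact Prod.ext rfl (map_zero (G'.map φ).hom).symm

/-- The second inclusion. -/
def prodInr : G' ⟶ prodFunctor G G' where
  app _ := AddCommGrpCat.ofHom (AddMonoidHom.inr _ _)
  naturality R S φ := by
    refine AddCommGrpCat.hom_ext (AddMonoidHom.ext fun x => ?_)
    exact Prod.ext (map_zero (G.map φ).hom).symm rfl

theorem prodInl_fst : prodInl G G' ≫ prodFst G G' = 𝟙 G := rfl

theorem prodInl_snd : prodInl G G' ≫ prodSnd G G' = 0 := rfl

theorem prodInr_fst : prodInr G G' ≫ prodFst G G' = 0 := rfl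

theorem prodInr_snd : prodInr G G' ≫ prodSnd G G' = 𝟙 G' := rfl

theorem prodFst_inl_add_prodSnd_inr :
    prodFst G G' ≫ prodInl G G' + prodSnd G G' ≫ prodInr G G' = 𝟙 (prodFunctor G G') := by
  ext R x
  exact Prod.ext (add_zero x.1) (zero_add x.2)

end ProdFunctor

namespace FHS1

section Prod

variable (X Y : FHS1)

/-- The homomorphism `v` of a product. -/
def prodMap : prodFunctor X.H Y.H ⟶ vectorGroup (X.V × Y.V) :=
  prodFst _ _ ≫ X.v ≫ vectorGroupMap (LinearMap.inl ℂ X.V Y.V) +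
    prodSnd _ _ ≫ Y.v ≫ vectorGroupMap (LinearMap.inr ℂ X.V Y.V)

theorem prodMap_fst :
    prodMap X Y ≫ vectorGroupMap (LinearMap.fst ℂ X.V Y.V) = prodFst _ _ ≫ X.v := by
  simp only [prodMap, Preadditive.add_comp, Category.assoc, ← vectorGroupMap_comp,
    LinearMap.fst_comp_inl, LinearMap.fst_comp_inr, vectorGroupMap_zero, vectorGroupMap_id,
    comp_zero, Category.comp_id, add_zero]

theorem prodMap_snd :
    prodMap X Y ≫ vectorGroupMap (LinearMap.snd ℂ X.V Y.V) = prodSnd _ _ ≫ Y.v := by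
  simp only [prodMap, Preadditive.add_comp, Category.assoc, ← vectorGroupMap_comp,
    LinearMap.snd_comp_inl, LinearMap.snd_comp_inr, vectorGroupMap_zero, vectorGroupMap_id,
    comp_zero, Category.comp_id, zero_add]

theorem inl_prodMap :
    X.v ≫ vectorGroupMap (LinearMap.inl ℂ X.V Y.V) = prodInl _ _ ≫ prodMap X Y := by
  simp only [prodMap, Preadditive.comp_add, ← Category.assoc, prodInl_fst, prodInl_snd, zero_comp,
    Category.id_comp, add_zero]

theorem inr_prodMap :
    Y.v ≫ vectorGroupMap (LinearMap.inr ℂ X.V Y.V) = prodInr _ _ ≫ prodMap X Y := by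
  simp only [prodMap, Preadditive.comp_add, ← Category.assoc, prodInr_fst, prodInr_snd, zero_comp,
    Category.id_comp, zero_add]

theorem complexMap_prodMap_fst (x : ℂ ⊗[ℤ] (prodFunctor X.H Y.H).obj pt) :
    (complexMap (prodMap X Y) x).1 = X.vC (mapC ((prodFst X.H Y.H).app pt).hom x) :=
  (complexMap_naturality (prodMap_fst X Y) x).symm

theorem complexMap_prodMap_snd (x : ℂ ⊗[ℤ] (prodFunctor X.H Y.H).obj pt) :
    (complexMap (prodMap X Y) x).2 = Y.vC (mapC ((prodSnd X.H Y.H).app pt).hom x) :=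
  (complexMap_naturality (prodMap_snd X Y) x).symm

/-- The product of two formal Hodge structures. -/
def prod : FHS1 :=
  haveI : Module.Finite ℤ (X.H.obj pt) := X.isFormalGroup.fg
  haveI : Module.Finite ℤ (Y.H.obj pt) := Y.isFormalGroup.fg
  ofMap (prodFunctor X.H Y.H) (isFormalGroup_prodFunctor X.isFormalGroup Y.isFormalGroup)
    (X.et.prod Y.et) (X.V × Y.V) (X.V0.prod Y.V0) (prodMap X Y)
    (fun x => by
      rw [Submodule.mem_prod, complexMap_prodMap_fst, complexMap_prodMap_snd, vC_mem_V0,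
        vC_mem_V0]
      rfl)
    (fun y => by
      obtain ⟨a, ha⟩ := X.exists_sub_vC_mem y.1
      obtain ⟨b, hb⟩ := Y.exists_sub_vC_mem y.2
      refine ⟨mapC ((prodInl X.H Y.H).app pt).hom a + mapC ((prodInr X.H Y.H).app pt).hom b, ?_⟩
      rw [map_add, complexMap_naturality (inl_prodMap X Y), complexMap_naturality (inr_prodMap X Y)]
      refine ⟨?_, ?_⟩
      · change y.1 - (X.vC a + 0) ∈ X.V0
        rwa [add_zero]
      · change y.2 - (0 + Y.vC b) ∈ Y.V0
        rwa [zero_add])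

/-- The product as a bicone. -/
def prodBicone : BinaryBicone X Y where
  pt := prod X Y
  fst := Hom.mk' (X := prod X Y) (prodFst _ _) (LinearMap.fst ℂ X.V Y.V) isMHSHom_fst
    (fun _ h => h.1) (prodMap_fst X Y)
  snd := Hom.mk' (X := prod X Y) (prodSnd _ _) (LinearMap.snd ℂ X.V Y.V) isMHSHom_snd
    (fun _ h => h.2) (prodMap_snd X Y)
  inl := Hom.mk' (Y := prod X Y) (prodInl _ _) (LinearMap.inl ℂ X.V Y.V) isMHSHom_inl
    (fun _ h => ⟨h, Y.V0.zero_mem⟩) (inl_prodMap X Y)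
  inr := Hom.mk' (Y := prod X Y) (prodInr _ _) (LinearMap.inr ℂ X.V Y.V) isMHSHom_inr
    (fun _ h => ⟨X.V0.zero_mem, h⟩) (inr_prodMap X Y)
  inl_fst := hom_ext rfl (LinearMap.fst_comp_inl ℂ X.V Y.V)
  inl_snd := hom_ext rfl (LinearMap.snd_comp_inl ℂ X.V Y.V)
  inr_fst := hom_ext rfl (LinearMap.fst_comp_inr ℂ X.V Y.V)
  inr_snd := hom_ext rfl (LinearMap.snd_comp_inr ℂ X.V Y.V)

theorem exists_isZero : ∃ Z : FHS1, IsZero Z := by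
  let A : MHS1 := ⟨PUnit, zeroMHS _, inferInstance⟩
  have hA : Subsingleton A.carrier := inferInstanceAs (Subsingleton PUnit)
  refine ⟨cObj A, ?_⟩
  rw [IsZero.iff_id_eq_zero]
  refine hom_ext ?_ ?_
  · ext R x
    exact hA.elim _ _
  · refine Submodule.linearMap_qext _ ?_
    ext a
    exact congrArg _ ((congrArg (fun t => (1 : ℂ) ⊗ₜ[ℤ] t) (hA.elim a 0)).trans
      (TensorProduct.tmul_zero _ _))

instance : HasFiniteProducts FHS1 :=
  hasFiniteProducts_of_bicone exists_isZero fun X Y => ⟨prodBicone X Y, hom_ext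
    (prodFst_inl_add_prodSnd_inr X.H Y.H)
    (LinearMap.ext fun x => Prod.ext (add_zero x.1) (zero_add x.2))⟩

end Prod

/-! ### Detecting isomorphisms, and the abelian category of formal Hodge structures -/

theorem isIso_of_bijective {X Y : FHS1} (φ : X ⟶ Y)
    (hf : ∀ R, Function.Bijective ((Hom.f φ).app R).hom) (hg : Function.Bijective (Hom.g φ)) :
    IsIso φ := by
  have : ∀ R, IsIso ((Hom.f φ).app R) := fun R =>
    (ConcreteCategory.isIso_iff_bijective ((Hom.f φ).app R)).2 (hf R)
  have : IsIso (Hom.f φ) := NatIso.isIso_of_isIso_app _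
  let g := LinearEquiv.ofBijective (Hom.g φ) hg
  have hgg : (Hom.g φ).comp g.symm.toLinearMap = LinearMap.id :=
    LinearMap.ext fun y => g.apply_symm_apply y
  have hgg' : g.symm.toLinearMap.comp (Hom.g φ) = LinearMap.id :=
    LinearMap.ext fun y => g.symm_apply_apply y
  have hinv : Function.RightInverse ((inv (Hom.f φ)).app pt).hom ((Hom.f φ).app pt).hom :=
    fun y => ConcreteCategory.congr_hom (NatTrans.congr_app (IsIso.inv_hom_id (Hom.f φ)) pt) y
  let ψ : Y ⟶ X := Hom.mk' (inv (Hom.f φ)) g.symm.toLinearMap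
    (IsMHSHom.of_rightInverse φ.isMHSHom (hf pt).1 hinv)
    (fun y hy => by
      obtain ⟨x, rfl⟩ := hg.2 y
      have h1 : g.symm (Hom.g φ x) = x := g.symm_apply_apply x
      change g.symm (Hom.g φ x) ∈ X.V0
      rw [h1]
      -- The inverse respects V⁰ by strictness: the representative lies in the kernel of an
      -- injective map and is therefore zero.
      obtain ⟨a, ha, hxa⟩ := Hom.exists_mem_V0_map_eq φ hy
      have h2 : a = 0 := mapC_injective (hf pt).1 (by rw [ha, map_zero])
      rwa [h2, map_zero, sub_zero] at hxa)
    (by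
      rw [IsIso.eq_inv_comp, ← Category.assoc, ← φ.square, Category.assoc, ← vectorGroupMap_comp,
        hgg', vectorGroupMap_id, Category.comp_id])
  exact ⟨ψ, hom_ext (IsIso.hom_inv_id _) hgg', hom_ext (IsIso.inv_hom_id _) hgg⟩

/-- The `R`-points of `H` and the vector space `V`, as functors to abelian groups. -/
def points : Option ArtAlg → FHS1 ⥤ AddCommGrpCat.{0}
  | none =>
    { obj X := AddCommGrpCat.of X.V
      map φ := AddCommGrpCat.ofHom (Hom.g φ).toAddMonoidHom }
  | some R =>
    { obj X := X.H.obj R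
      map φ := (Hom.f φ).app R }

theorem cokerProj_app_surjective {G G' : GroupFunctor} (f : G ⟶ G') (R : ArtAlg) :
    Function.Surjective ((cokerProj f).app R).hom :=
  QuotientAddGroup.mk'_surjective _

theorem cokerπ_g_surjective {X Y : FHS1} (φ : X ⟶ Y) : Function.Surjective (Hom.g (cokerπ φ)) :=
  Submodule.mkQ_surjective (LinearMap.range (Hom.g φ))

theorem exists_app_eq {G G' : GroupFunctor} (f : G ⟶ G') (R : ArtAlg) (x : G'.obj R)
    (hx : ((cokerProj f).app R).hom x = 0) : ∃ y, (f.app R).hom y = x :=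
  (QuotientAddGroup.eq_zero_iff x).1 hx

theorem exists_g_eq {X Y : FHS1} (φ : X ⟶ Y) (x : Y.V) (hx : Hom.g (cokerπ φ) x = 0) :
    ∃ y, Hom.g φ y = x :=
  (Submodule.Quotient.mk_eq_zero (LinearMap.range (Hom.g φ))).1 hx

instance : Abelian FHS1 :=
  abelianOfJointlyConservative points
    (fun j => match j with
      | none => ⟨fun _ _ => rfl⟩
      | some _ => ⟨fun _ _ => rfl⟩)
    (fun φ => ⟨ker φ, kerι φ, kerι_comp φ, ⟨kerIsLimit φ⟩, fun j => match j with
      | none => ⟨Submodule.subtype_injective _, fun x hx => ⟨⟨x, hx⟩, rfl⟩⟩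
      | some _ => ⟨AddSubgroup.subtype_injective _, fun x hx => ⟨⟨x, hx⟩, rfl⟩⟩⟩)
    (fun φ => ⟨coker φ, cokerπ φ, comp_cokerπ φ, ⟨cokerIsColimit φ⟩, fun j => match j with
      | none => ⟨cokerπ_g_surjective φ, exists_g_eq φ⟩
      | some R => ⟨cokerProj_app_surjective (Hom.f φ) R, exists_app_eq (Hom.f φ) R⟩⟩)
    (fun φ h => isIso_of_bijective φ (fun R => h (some R)) (h none))

end FHS1

/-! ### Exactness of `e` and the Serre quotient -/

instance : e.Additive where
  map_add := rfl

/-- Kernels are computed pointwise, and their étale part is by definition the kernel of mixed Hodge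
structures, so the image fork is already the chosen limit. The same holds for cokernels. -/
instance {X Y : FHS1} (φ : X ⟶ Y) : PreservesLimit (parallelPair φ 0) e :=
  preservesLimit_parallelPair e _ (FHS1.kerIsLimit φ) ⟨MHS1.kerIsLimit (e.map φ)⟩

instance {X Y : FHS1} (φ : X ⟶ Y) : PreservesColimit (parallelPair φ 0) e :=
  preservesColimit_parallelPair e _ (FHS1.cokerIsColimit φ) ⟨MHS1.cokerIsColimit (e.map φ)⟩

instance : PreservesFiniteLimits e := e.preservesFiniteLimits_of_preservesKernels

instance : PreservesFiniteColimits e := e.preservesFiniteColimits_of_preservesCokernels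

/-- If H(ℂ) = 0 every point specialises to zero; conversely, a ℂ-point in the connected part is
zero, as the identity of `pt` shows. -/
theorem isZero_e_obj_iff (X : FHS1) : IsZero (e.obj X) ↔ connected X := by
  constructor
  · intro h R
    have h1 : Subsingleton (X.H.obj pt) := MHS1.subsingleton_of_isZero h
    rw [eq_top_iff]
    exact fun x _ => mem_connectedSubgroup.2 fun φ => Subsingleton.elim _ _
  · intro h
    have h1 : ∀ x : X.H.obj pt, x = 0 := fun x => by
      have hx : x ∈ connectedSubgroup X.H pt := by rw [h pt]; trivial
      rw [← map_id_apply X.H x]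
      exact mem_connectedSubgroup.1 hx (𝟙 pt)
    have : Subsingleton (e.obj X).carrier := ⟨fun x y => (h1 x).trans (h1 y).symm⟩
    exact MHS1.isZero_of_subsingleton _

theorem connected_eq_kernel : connected = e.kernel := by
  ext X
  exact (isZero_e_obj_iff X).symm

instance : connected.IsSerreClass := by
  rw [connected_eq_kernel]
  infer_instance

instance : connected.IsClosedUnderFiniteProducts where
  isClosedUnderLimitsOfShape J _ := by
    have := Fintype.ofFinite J
    refine ⟨?_⟩
    rintro X ⟨p⟩
    rw [← isZero_e_obj_iff, IsZero.iff_id_eq_zero]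
    exact (isLimitOfPreserves e p.isLimit).hom_ext fun j =>
      ((isZero_e_obj_iff _).2 (p.prop_diag_obj j)).eq_of_tgt _ _

instance : Abelian FHS10 := inferInstanceAs (Abelian connected.FullSubcategory)

instance : PreservesFiniteLimits ι :=
  have (X Y : FHS10) (φ : X ⟶ Y) : PreservesLimit (parallelPair φ 0) ι :=
    connected.preservesKernels_ι φ
  Functor.preservesFiniteLimits_of_preservesKernels ι

instance : PreservesFiniteColimits ι :=
  have (X Y : FHS10) (φ : X ⟶ Y) : PreservesColimit (parallelPair φ 0) ι :=
    connected.preservesCokernels_ι φ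
  Functor.preservesFiniteColimits_of_preservesCokernels ι

theorem isoModSerre_iff {X Y : FHS1} (φ : X ⟶ Y) :
    connected.isoModSerre φ ↔ IsIso (e.map φ) := by
  -- The equality with the kernel is used for a variable `P` because the Serre class instance
  -- depends on the property being rewritten.
  have h : ∀ (P : ObjectProperty FHS1) [P.IsSerreClass], P = e.kernel →
      (P.isoModSerre φ ↔ IsIso (e.map φ)) := by
    intro P _ hP
    subst hP
    rw [Abelian.isoModSerre_kernel_eq_inverseImage_isomorphisms]
    rfl
  exact h _ connected_eq_kernel

theorem isInvertedBy_e : connected.isoModSerre.IsInvertedBy e :=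
  fun _ _ φ h => (isoModSerre_iff φ).1 h

/-! ### The étale part -/

/-- The inclusion of the constant group `G(ℂ)` in `G`. -/
def etIncl (G : GroupFunctor) : constantGroup (G.obj pt) ⟶ G where
  app R := G.map (ArtAlg.unit R)
  naturality R S φ := by
    refine AddCommGrpCat.hom_ext (AddMonoidHom.ext fun x => ?_)
    refine Eq.trans ?_ (map_map_apply G (ArtAlg.unit R) φ x).symm
    rw [ArtAlg.hom_ext_of_pt (ArtAlg.unit R ≫ φ) (ArtAlg.unit S)]
    rfl

theorem etIncl_app_pt (G : GroupFunctor) :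
    ((etIncl G).app pt).hom = AddMonoidHom.id (G.obj pt) := by
  refine AddMonoidHom.ext fun x => ?_
  change (G.map (ArtAlg.unit pt)).hom x = x
  rw [ArtAlg.hom_ext_of_pt (ArtAlg.unit pt) (𝟙 pt)]
  exact map_id_apply G x

theorem comp_vectorGroupMap_id {G : GroupFunctor} {V : Type} [AddCommGroup V] [Module ℂ V]
    (v : G ⟶ vectorGroup V) : v ≫ vectorGroupMap LinearMap.id = v := by
  rw [vectorGroupMap_id, Category.comp_id]

theorem complexMap_etIncl_comp {G : GroupFunctor} {V : Type} [AddCommGroup V] [Module ℂ V]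
    (v : G ⟶ vectorGroup V) (x : ℂ ⊗[ℤ] G.obj pt) :
    complexMap (etIncl G ≫ v) x = complexMap v x := by
  have h := complexMap_naturality (v := etIncl G ≫ v) (v' := v) (f := etIncl G)
    (g := LinearMap.id) (comp_vectorGroupMap_id _) x
  refine h.symm.trans (congrArg (complexMap v) ?_)
  refine LinearMap.congr_fun (?_ : mapC ((etIncl G).app pt).hom = LinearMap.id) x
  exact (congrArg mapC (etIncl_app_pt G)).trans (mapC_id (G.obj pt))

/-- The structure `(H_ℤ, V)`. -/
def etObj (X : FHS1) : FHS1 :=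
  FHS1.ofMap (constantGroup (X.H.obj pt)) (isFormalGroup_constant _ X.isFormalGroup.fg) X.et X.V
    X.V0 (etIncl X.H ≫ X.v)
    (fun x => (iff_of_eq (congrArg (· ∈ X.V0) (complexMap_etIncl_comp X.v x))).trans
      X.vC_mem_V0)
    (fun y => by
      obtain ⟨x, hx⟩ := X.exists_sub_vC_mem y
      refine ⟨x, ?_⟩
      have h := complexMap_etIncl_comp X.v x
      exact (congrArg (fun z => y - z ∈ X.V0) h).mpr hx)

theorem etIncl_naturality {G G' : GroupFunctor} (f : G ⟶ G') :
    etIncl G ≫ f = (Functor.const _).map (f.app pt) ≫ etIncl G' := by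
  refine NatTrans.ext (funext fun R => AddCommGrpCat.hom_ext (AddMonoidHom.ext fun x => ?_))
  exact naturality_apply f (ArtAlg.unit R) x

/-- The functor `(H, V) ↦ (H_ℤ, V)`. -/
def etFunctor : FHS1 ⥤ FHS1 where
  obj := etObj
  map {X Y} φ := FHS1.Hom.mk' (X := etObj X) (Y := etObj Y) ((Functor.const _).map (φ.f.app pt))
    φ.g φ.isMHSHom φ.map_V0 (by
      change (etIncl X.H ≫ X.v) ≫ vectorGroupMap φ.g = _ ≫ etIncl Y.H ≫ Y.v
      rw [Category.assoc, φ.square, ← Category.assoc]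
      exact congrArg (· ≫ Y.v) (etIncl_naturality φ.f))
  map_id _ := rfl
  map_comp _ _ := rfl

/-- The morphism `(H_ℤ, V) ⟶ (H, V)`. -/
def fromEt : etFunctor ⟶ 𝟭 FHS1 where
  app X := FHS1.Hom.mk' (X := etObj X) (Y := X) (etIncl X.H) LinearMap.id
    ((congrArg (IsMHSHom X.et X.et) (etIncl_app_pt X.H)).mpr (IsMHSHom.id X.et))
    (fun _ h => h) (comp_vectorGroupMap_id (etIncl X.H ≫ X.v))
  naturality _ _ φ := FHS1.hom_ext (etIncl_naturality φ.f).symm rfl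

theorem app_pt_eq {G : GroupFunctor} {V : Type} [AddCommGroup V] [Module ℂ V]
    (v : G ⟶ vectorGroup V) (h : G.obj pt) : (v.app pt).hom h = (1 : ℂ) ⊗ₜ[ℂ] intMap v h :=
  ((TensorProduct.lid ℂ V).symm_apply_apply _).symm

theorem etIncl_comp_app {G : GroupFunctor} {V : Type} [AddCommGroup V] [Module ℂ V]
    (v : G ⟶ vectorGroup V) (R : ArtAlg) (h : G.obj pt) :
    ((etIncl G ≫ v).app R).hom h = (1 : R.obj) ⊗ₜ[ℂ] intMap v h := by
  refine (naturality_apply v (ArtAlg.unit R) h).trans ?_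
  refine (congrArg _ (app_pt_eq v h)).trans ?_
  change ArtAlg.alg (ArtAlg.unit R) 1 ⊗ₜ[ℂ] intMap v h = _
  rw [map_one]

/-- The linear map `V → V / V⁰ ≃ H_ℂ / F⁰`. -/
def toEtMap (X : FHS1) : X.V →ₗ[ℂ] (ℂ ⊗[ℤ] X.H.obj pt) ⧸ X.et.F0 :=
  X.σ.symm.toLinearMap.comp X.V0.mkQ

/-- The morphism `(H_ℤ, V) ⟶ (H_ℤ, H_ℂ / F⁰)`. -/
def toEt : etFunctor ⟶ e ⋙ c where
  app X := FHS1.Hom.mk' (X := etObj X) (Y := c.obj (e.obj X)) (𝟙 _) (toEtMap X) (IsMHSHom.id _)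
    (fun x hx => by
      have h : X.V0.mkQ x = 0 := (Submodule.Quotient.mk_eq_zero _).2 hx
      change X.σ.symm (X.V0.mkQ x) = 0
      rw [h, map_zero])
    (by
      refine NatTrans.ext (funext fun R => AddCommGrpCat.hom_ext (AddMonoidHom.ext fun x => ?_))
      refine (congrArg (LinearMap.lTensor R.obj (toEtMap X)) (etIncl_comp_app X.v R x)).trans ?_
      refine congrArg (fun y => (1 : R.obj) ⊗ₜ[ℂ] y) ?_
      exact (congrArg X.σ.symm (X.comm x).symm).trans (X.σ.symm_apply_apply _))
  naturality X Y φ := FHS1.hom_ext rfl (LinearMap.ext fun y => by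
    change Y.σ.symm (Y.V0.mkQ (φ.g y)) =
      X.et.F0.mapQ Y.et.F0 (mapC (φ.f.app pt).hom) φ.isMHSHom.F0 (X.σ.symm (X.V0.mkQ y))
    rw [LinearEquiv.symm_apply_eq, φ.square_σ, LinearEquiv.apply_symm_apply]
    rfl)

/-- On ℂ-points the inclusion of the constant group is the identity, so only the connected part of H
is lost. -/
theorem isoModSerre_fromEt (X : FHS1) : connected.isoModSerre (fromEt.app X) := by
  rw [isoModSerre_iff]
  refine MHS1.isIso_of_bijective _ ?_
  change Function.Bijective ((etIncl X.H).app pt).hom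
  rw [etIncl_app_pt]
  exact Function.bijective_id

theorem isoModSerre_toEt (X : FHS1) : connected.isoModSerre (toEt.app X) := by
  rw [isoModSerre_iff]
  exact MHS1.isIso_of_bijective _ Function.bijective_id

/-! ### The equivalence from the Serre quotient -/

theorem c_comp_e : c ⋙ e = 𝟭 MHS1 := rfl

/-- In the Serre quotient, every formal Hodge structure is isomorphic to its étale quotient. -/
def quotientIso : connected.isoModSerre.Q ≅ (e ⋙ c) ⋙ connected.isoModSerre.Q :=
  haveI : ∀ X, IsIso ((Functor.whiskerRight fromEt connected.isoModSerre.Q).app X) := fun X =>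
    connected.isoModSerre.Q_inverts _ (isoModSerre_fromEt X)
  haveI : ∀ X, IsIso ((Functor.whiskerRight toEt connected.isoModSerre.Q).app X) := fun X =>
    connected.isoModSerre.Q_inverts _ (isoModSerre_toEt X)
  haveI := NatIso.isIso_of_isIso_app (Functor.whiskerRight fromEt connected.isoModSerre.Q)
  haveI := NatIso.isIso_of_isIso_app (Functor.whiskerRight toEt connected.isoModSerre.Q)
  (asIso (Functor.whiskerRight fromEt connected.isoModSerre.Q)).symm ≪≫
    asIso (Functor.whiskerRight toEt connected.isoModSerre.Q)

theorem isEquivalence_lift :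
    (Localization.Construction.lift e isInvertedBy_e).IsEquivalence := by
  let L := Localization.Construction.lift e isInvertedBy_e
  have hL : connected.isoModSerre.Q ⋙ L = e := Localization.Construction.fac e isInvertedBy_e
  let _ : Localization.Lifting connected.isoModSerre.Q connected.isoModSerre
      ((e ⋙ c) ⋙ connected.isoModSerre.Q) (L ⋙ c ⋙ connected.isoModSerre.Q) :=
    ⟨Functor.isoWhiskerRight (eqToIso hL) (c ⋙ connected.isoModSerre.Q)⟩
  -- The inverse is `c` followed by localization. The isomorphism on the quotient side is
  -- `quotientIso`, extended by the universal property of localization; on the other side the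
  -- composite is strictly the identity.
  refine Functor.IsEquivalence.mk' (c ⋙ connected.isoModSerre.Q)
    (Localization.liftNatIso connected.isoModSerre.Q connected.isoModSerre
      connected.isoModSerre.Q ((e ⋙ c) ⋙ connected.isoModSerre.Q) _ _ quotientIso) ?_
  exact Functor.isoWhiskerLeft c (eqToIso hL) ≪≫ eqToIso c_comp_e

/-! ### The connected part -/

theorem isIso_connectedIncl {G : GroupFunctor} (h : ∀ R, connectedSubgroup G R = ⊤) :
    IsIso (connectedIncl G) := by
  have : ∀ R, IsIso ((connectedIncl G).app R) := fun R =>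
    (ConcreteCategory.isIso_iff_bijective ((connectedIncl G).app R)).2
      ⟨AddSubgroup.subtype_injective _, fun x => ⟨⟨x, by rw [h R]; trivial⟩, rfl⟩⟩
  exact NatIso.isIso_of_isIso_app _

theorem subsingleton_of_connected {X : FHS1} (h : connected X) : Subsingleton (X.H.obj pt) :=
  MHS1.subsingleton_of_isZero ((isZero_e_obj_iff X).2 h)

/-- For a connected structure H_ℂ = 0, so V/V⁰ ≅ H_ℂ/F⁰ vanishes. This is why replacing V⁰ by V in
`π` loses nothing on connected structures. -/
theorem V0_eq_top {X : FHS1} (h : connected X) : X.V0 = ⊤ := by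
  have := subsingleton_of_connected h
  rw [eq_top_iff]
  intro y _
  obtain ⟨x, hx⟩ := X.exists_sub_vC_mem y
  rwa [Subsingleton.elim x 0, map_zero, sub_zero] at hx

/-- The inclusion `H⁰ ⊆ H` and the identity of `V`, for a connected structure. -/
def fromConnectedPart (X : FHS10) : (πObj X.obj).obj ⟶ X.obj :=
  FHS1.Hom.mk' (X := (πObj X.obj).obj) (connectedIncl X.obj.H) LinearMap.id
    ((congrArg (IsMHSHom (zeroMHS _) X.obj.et) (Subsingleton.elim (α := _ →+ _)
      ((connectedIncl X.obj.H).app pt).hom 0)).mpr IsMHSHom.zero)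
    (fun x _ => by rw [V0_eq_top X.property]; trivial)
    (comp_vectorGroupMap_id (connectedIncl X.obj.H ≫ X.obj.v))

theorem isIso_fromConnectedPart (X : FHS10) : IsIso (fromConnectedPart X) := by
  refine FHS1.isIso_of_bijective _ (fun R => ?_) Function.bijective_id
  have := isIso_connectedIncl X.property
  exact ConcreteCategory.bijective_of_isIso ((connectedIncl X.obj.H).app R)

/-- The isomorphism `πι ≅ 1`. -/
def πιIso : ι ⋙ π ≅ 𝟭 FHS10 :=
  NatIso.ofComponents (fun X => connected.isoMk (@asIso _ _ _ _ (fromConnectedPart X) (isIso_fromConnectedPart X)))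
    (fun _ => ObjectProperty.hom_ext _ (FHS1.hom_ext rfl rfl))

end FormalHodge

end

/-- `connected.isoModSerre.Localization` is the Serre quotient `FHS₁ / FHS₁⁰`, and
`Localization.Construction.lift e h` is the functor `FHS₁ / FHS₁⁰ ⥤ MHS₁` through which `e`
factors. -/
theorem mainTheorem3 :
    ∃ (_ : Abelian FormalHodge.FHS1) (_ : Abelian FormalHodge.MHS1)
      (_ : Abelian FormalHodge.FHS10) (_ : FormalHodge.connected.IsSerreClass),
      (PreservesFiniteLimits FormalHodge.ι ∧ PreservesFiniteColimits FormalHodge.ι) ∧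
      (PreservesFiniteLimits FormalHodge.e ∧ PreservesFiniteColimits FormalHodge.e) ∧
      (∀ X : FormalHodge.FHS1, IsZero (FormalHodge.e.obj X) ↔ FormalHodge.connected X) ∧
      (∃ h : FormalHodge.connected.isoModSerre.IsInvertedBy FormalHodge.e,
        (Localization.Construction.lift FormalHodge.e h).IsEquivalence) ∧
      (∃ i : FormalHodge.ι ⋙ FormalHodge.π ≅ 𝟭 FormalHodge.FHS10,
        ∀ X : FormalHodge.FHS10,
          FormalHodge.FHS1.Hom.f (i.hom.app X).hom = FormalHodge.connectedIncl X.obj.H ∧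
          FormalHodge.FHS1.Hom.g (i.hom.app X).hom = LinearMap.id) ∧
      FormalHodge.c ⋙ FormalHodge.e = 𝟭 FormalHodge.MHS1 := by
  exact ⟨inferInstance, inferInstance, inferInstance, inferInstance,
    ⟨inferInstance, inferInstance⟩, ⟨inferInstance, inferInstance⟩,
    FormalHodge.isZero_e_obj_iff,
    ⟨FormalHodge.isInvertedBy_e, FormalHodge.isEquivalence_lift⟩,
    ⟨FormalHodge.πιIso, fun _ => ⟨rfl, rfl⟩⟩, FormalHodge.c_comp_e⟩
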